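/- **Setting (concurrent pattern calculus).** Fix a countably infinite set of names. Patterns are $p ::= \lambda x \mid x \mid \ulcorner x\urcorner \mid p\bullet p$ (binding, variable, protected name, compound), with sets $\mathsf{bn}(p)$, $\mathsf{vn}(p)$, $\mathsf{pn}(p)$ of binding, variable and protected names and $\mathsf{fn}(p)=\mathsf{vn}(p)\cup\mathsf{pn}(p)$; they are well formed: the binding names are pairwise distinct and not free. A pattern is communicable if it has no binding and no protected names. Substitutions are finite partial functions from names to communicable patterns; $\mathsf{dom}(\sigma)$ is the domain and $\mathsf{fn}(\sigma)$ the set of names occurring in the values of $\sigma$; $\hat\sigma p$ replaces each $\lambda x$ in $p$ with $x\in\mathsf{dom}(\sigma)$ by $\sigma(x)$. Processes are $P ::= \mathbf 0 \mid P|P \mid {!P} \mid (\nu x)P \mid p\to P$, up to $\alpha$-conversion, where $(\nu x)$ binds $x$ and $p\to P$ binds $\mathsf{bn}(p)$ in $P$; $\sigma P$ is capture-avoiding substitution. *Unification* $\{p\|q\}=(\sigma,\rho)$: $x$ or $\ulcorner x\urcorner$ against $x$ or $\ulcorner x\urcorner$ gives $(\{\},\{\})$; $\{\lambda x\|q\}=(\{q/x\},\{\})$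 and $\{q\|\lambda x\}=(\{\},\{q/x\})$ for $q$ communicable; compounds unify componentwise, with the unions of the results; otherwise it is undefined. *Transitions* $P\xrightarrow{\mu}P'$, with $\mu=\tau$ or $\mu=(\nu\tilde n)p$, $\tilde n$ a finite set of names; the names of a label are none for $\tau$ and $\tilde n\cup\mathsf{fn}(p)\cup\mathsf{bn}(p)$ for $(\nu\tilde n)p$. They are generated by: $(p\to P)\xrightarrow{p}P$; if $P\xrightarrow{\mu}P'$ and $n$ is not a name of $\mu$ then $(\nu n)P\xrightarrow{\mu}(\nu n)P'$; if $P\xrightarrow{(\nu\tilde n)p}P'$ and $m\in\mathsf{vn}(p)\setminus(\tilde n\cup\mathsf{pn}(p)\cup\mathsf{bn}(p))$ then $(\nu m)P\xrightarrow{(\nu\tilde n\cup\{m\})p}P'$; if $P\xrightarrow{(\nu\tilde m)p}P'$, $Q\xrightarrow{(\nu\tilde n)q}Q'$, $\{p\|q\}=(\sigma,\rho)$, $\tilde m\cap\mathsf{fn}(Q)=\tilde n\cap\mathsf{fn}(P)=\tilde m\cap\tilde n=\emptyset$, then $P|Q\xrightarrow{\tau}(\nu\,\tilde m\cup\tilde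 n)(\sigma P'|\rho Q')$; if $P\xrightarrow{\tau}P'$ then $P|Q\xrightarrow{\tau}P'|Q$; if $P\xrightarrow{(\nu\tilde n)p}P'$ and $(\tilde n\cup\mathsf{bn}(p))\cap\mathsf{fn}(Q)=\emptyset$ then $P|Q\xrightarrow{(\nu\tilde n)p}P'|Q$; the symmetric versions of the last two rules; if ${!P}|P\xrightarrow{\mu}P'$ then ${!P}\xrightarrow{\mu}P'$. *Compatibility.* A match $(p,\sigma)$ is a pattern and a substitution with $\mathsf{dom}(\sigma)=\mathsf{bn}(p)$. The relation $p,\sigma\ll q,\rho$ on matches is generated by: $p,\sigma\ll\lambda y,\{\hat\sigma p/y\}$ if $\mathsf{fn}(p)=\emptyset$; $n,\{\}\ll n,\{\}$; $\ulcorner n\urcorner,\{\}\ll\ulcorner n\urcorner,\{\}$; $\ulcorner n\urcorner,\{\}\ll n,\{\}$; and $p_1\bullet p_2,\sigma_1\cup\sigma_2\ll q_1\bullet q_2,\rho_1\cup\rho_2$ if $p_i,\sigma_i\ll q_i,\rho_i$ for $i=1,2$. *Bisimilarity.* A symmetric relation $\mathcal R$ on processes is a bisimulation if, whenever $(P,Q)\in\mathcal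 R$ and $P\xrightarrow{\mu}P'$: if $\mu=\tau$, then $Q\xrightarrow{\tau}Q'$ for some $Q'$ with $(P',Q')\in\mathcal R$; if $\mu=(\nu\tilde n)p$ with $(\mathsf{bn}(p)\cup\tilde n)\cap\mathsf{fn}(Q)=\emptyset$, then for every match $(p,\sigma)$ with $\mathsf{fn}(\sigma)\cap\tilde n=\emptyset$ there are a match $(q,\rho)$ and $Q'$ with $p,\sigma\ll q,\rho$, $Q\xrightarrow{(\nu\tilde n)q}Q'$ and $(\sigma P',\rho Q')\in\mathcal R$. Bisimilarity $\sim$ is the largest bisimulation closed under all substitutions. **Proposition.** Let $p,q$ be well-formed patterns and $P',Q'$ processes; put $P = p\to P'\;|\;{!q\to Q'}$ and $Q={!q\to Q'}$, and let the bound names $\mathsf{bn}(p)$ be chosen so that $\mathsf{bn}(p)\cap\mathsf{fn}(Q)=\emptyset$. If there is a substitution $\rho$ such that $p,\mathrm{id}_{\mathsf{bn}(p)}\ll q,\rho$ and $P'\sim\rho Q'$, then $P\sim Q$. In particular: * $\ulcorner n\urcorner\to P\;|\;{!n\to P}\ \sim\ {!n\to P}$ for every name $n$ and process $P$; * $\lambda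 x\bullet\lambda y\to P\;|\;{!\lambda z\to Q}\ \sim\ {!\lambda z\to Q}$ whenever $x\neq y$, $x,y\notin\mathsf{fn}(\lambda z\to Q)$ and $P\sim\{x\bullet y/z\}Q$. -/

import Mathlib

/-!
Concurrent pattern calculus: patterns, processes up to alpha-conversion, unification,
labelled transitions, compatibility and bisimilarity.

Names are natural numbers (a countably infinite set).  Processes are considered up to
alpha-conversion throughout.  An alpha-equivalence class is represented by its unique nameless
(de Bruijn) term: under `k` binders, the indices `0, …, k - 1` are the bound names and the index
`i + k` is the free name `i`.  The nameless constructors `Proc.nuB` and `Proc.caseB` are used only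
to define renaming, substitution and free names; everything else is phrased with the named
constructors `Proc.res x P` (restriction of the name `x`) and `Proc.caseOf p P` (the case `p → P`).
The lemmas on the named constructors record that these satisfy the usual laws of the named
syntax (free names, alpha-conversion, capture-avoiding substitution, injectivity) and that they
generate all processes.
-/

namespace CPC

/-- Patterns whose binding atoms carry a tag in `β`.  Ordinary patterns have `β = ℕ`;
`β = Unit` gives the patterns of nameless terms, where a binder is known by its position. -/
inductive PatternOf (β : Type) : Type
  | lam (b : β) : PatternOf β
  | var (x : ℕ) : PatternOf β
  | pro (x : ℕ) : PatternOf β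
  | comp (p q : PatternOf β) : PatternOf β

/-- Patterns: `lam x` is the binding name `λx`, `var x` the variable name `x`,
`pro x` the protected name `⌜x⌝` and `comp p q` the compound `p • q`. -/
abbrev Pattern : Type := PatternOf ℕ

/-- Communicable patterns: those without protected or binding names. -/
inductive Comm : Type
  | name (x : ℕ) : Comm
  | comp (M N : Comm) : Comm

namespace Comm

/-- A communicable pattern, seen as a pattern. -/
def toPat {β : Type} : Comm → PatternOf β
  | name x => .var x
  | comp M N => .comp M.toPat N.toPat

/-- The protection `⌜M⌝` of a communicable pattern. -/
def protect {β : Type} : Comm → PatternOf β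
  | name x => .pro x
  | comp M N => .comp M.protect N.protect

/-- The free names of a communicable pattern. -/
def fn : Comm → Finset ℕ
  | name x => {x}
  | comp M N => M.fn ∪ N.fn

/-- Renaming. -/
def ren (f : ℕ → ℕ) : Comm → Comm
  | name x => name (f x)
  | comp M N => comp (M.ren f) (N.ren f)

end Comm

namespace PatternOf

/-- The binding names (tags of the binding atoms), from left to right. -/
def bnList {β : Type} : PatternOf β → List β
  | lam b => [b]
  | var _ => []
  | pro _ => []
  | comp p q => p.bnList ++ q.bnList

/-- The set of variable names. -/
def vn {β : Type} : PatternOf β → Finset ℕ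
  | lam _ => ∅
  | var x => {x}
  | pro _ => ∅
  | comp p q => p.vn ∪ q.vn

/-- The set of protected names. -/
def pn {β : Type} : PatternOf β → Finset ℕ
  | lam _ => ∅
  | var _ => ∅
  | pro x => {x}
  | comp p q => p.pn ∪ q.pn

/-- The set of free names. -/
def fn {β : Type} (p : PatternOf β) : Finset ℕ := p.vn ∪ p.pn

/-- The number of binding atoms. -/
def arity {β : Type} (p : PatternOf β) : ℕ := p.bnList.length

/-- Forget the tags of the binding atoms. -/
def erase {β : Type} : PatternOf β → PatternOf Unit
  | lam _ => lam ()
  | var x => var x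
  | pro x => pro x
  | comp p q => comp p.erase q.erase

/-- Renaming of the free names. -/
def ren {β : Type} (f : ℕ → ℕ) : PatternOf β → PatternOf β
  | lam b => lam b
  | var x => var (f x)
  | pro x => pro (f x)
  | comp p q => comp (p.ren f) (q.ren f)

/-- Substitution of communicable patterns for the free names. -/
def subst {β : Type} (f : ℕ → Comm) : PatternOf β → PatternOf β
  | lam b => lam b
  | var x => (f x).toPat
  | pro x => (f x).protect
  | comp p q => comp (p.subst f) (q.subst f)

/-- The set of binding names. -/
def bn (p : Pattern) : Finset ℕ := p.bnList.toFinset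

/-- Well-formed patterns: the binding names are pairwise distinct and different from
the free names. -/
def WF (p : Pattern) : Prop := p.bnList.Nodup ∧ Disjoint p.bn p.fn

end PatternOf

/-! ### Substitutions -/

/-- Partial functions from names to communicable patterns. -/
abbrev Subst : Type := ℕ → Option Comm

namespace Subst

/-- The empty substitution. -/
def empty : Subst := fun _ => none

/-- The substitution `{M/x}`. -/
def single (x : ℕ) (M : Comm) : Subst := fun y => if y = x then some M else none

/-- The union of two substitutions (used for disjoint domains). -/
def union (σ ρ : Subst) : Subst := fun x => (σ x).or (ρ x)

/-- The identity substitution on a finite set of names. -/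
def idOn (X : Finset ℕ) : Subst := fun x => if x ∈ X then some (Comm.name x) else none

/-- The domain. -/
def dom (σ : Subst) : Set ℕ := {x | ∃ M, σ x = some M}

/-- The free names: the union of the free names of all `σ x`, for `x` in the domain. -/
def fn (σ : Subst) : Set ℕ := {y | ∃ x M, σ x = some M ∧ y ∈ M.fn}

/-- The action on names: `σ x` if `x` is in the domain, and `x` otherwise. -/
def act (σ : Subst) (x : ℕ) : Comm := (σ x).getD (Comm.name x)

end Subst

/-- The action `σ̂ p` of a substitution on the binding names of a pattern. -/
def PatternOf.hat (σ : Subst) : Pattern → Pattern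
  | .lam x =>
    match σ x with
    | some M => M.toPat
    | none => .lam x
  | .var x => .var x
  | .pro x => .pro x
  | .comp p q => .comp (PatternOf.hat σ p) (PatternOf.hat σ q)

/-- `Unify p q σ ρ` means that the unification `{p ‖ q}` is defined and equal to `(σ, ρ)`. -/
inductive Unify : Pattern → Pattern → Subst → Subst → Prop
  | var_var (x : ℕ) : Unify (.var x) (.var x) Subst.empty Subst.empty
  | var_pro (x : ℕ) : Unify (.var x) (.pro x) Subst.empty Subst.empty
  | pro_var (x : ℕ) : Unify (.pro x) (.var x) Subst.empty Subst.empty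
  | pro_pro (x : ℕ) : Unify (.pro x) (.pro x) Subst.empty Subst.empty
  | lam_left (x : ℕ) (M : Comm) : Unify (.lam x) M.toPat (Subst.single x M) Subst.empty
  | lam_right (x : ℕ) (M : Comm) : Unify M.toPat (.lam x) Subst.empty (Subst.single x M)
  | comp (p₁ p₂ q₁ q₂ : Pattern) (σ₁ σ₂ ρ₁ ρ₂ : Subst) :
      Unify p₁ q₁ σ₁ ρ₁ → Unify p₂ q₂ σ₂ ρ₂ →
      Unify (.comp p₁ p₂) (.comp q₁ q₂) (σ₁.union σ₂) (ρ₁.union ρ₂)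

/-! ### Processes -/

/-- Processes up to alpha-conversion, as nameless terms. -/
inductive Proc : Type
  | nil : Proc
  | par (P Q : Proc) : Proc
  | rep (P : Proc) : Proc
  | nuB (P : Proc) : Proc
  | caseB (p : PatternOf Unit) (P : Proc) : Proc

/-- A renaming, lifted below `k` binders. -/
def upRen (k : ℕ) (f : ℕ → ℕ) : ℕ → ℕ :=
  fun i => if i < k then i else f (i - k) + k

/-- A substitution, lifted below `k` binders. -/
def upSubst (k : ℕ) (f : ℕ → Comm) : ℕ → Comm :=
  fun i => if i < k then Comm.name i else (f (i - k)).ren (· + k)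

/-- The renaming that turns the names `xs` into the indices `0, …, xs.length - 1`. -/
def absRen (xs : List ℕ) : ℕ → ℕ :=
  fun x => if x ∈ xs then xs.idxOf x else x + xs.length

namespace Proc

/-- Renaming of the free names. -/
def ren : (ℕ → ℕ) → Proc → Proc
  | _, nil => nil
  | f, par P Q => par (P.ren f) (Q.ren f)
  | f, rep P => rep (P.ren f)
  | f, nuB P => nuB (P.ren (upRen 1 f))
  | f, caseB p P => caseB (p.ren f) (P.ren (upRen p.arity f))

/-- Capture-avoiding substitution for the free names. -/
def subst : (ℕ → Comm) → Proc → Proc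
  | _, nil => nil
  | f, par P Q => par (P.subst f) (Q.subst f)
  | f, rep P => rep (P.subst f)
  | f, nuB P => nuB (P.subst (upSubst 1 f))
  | f, caseB p P => caseB (p.subst f) (P.subst (upSubst p.arity f))

/-- The set of free names. -/
def fn : Proc → Set ℕ
  | nil => ∅
  | par P Q => P.fn ∪ Q.fn
  | rep P => P.fn
  | nuB P => {x | x + 1 ∈ P.fn}
  | caseB p P => ↑p.fn ∪ {x | x + p.arity ∈ P.fn}

/-- The restriction `(ν x) P`. -/
def res (x : ℕ) (P : Proc) : Proc := nuB (P.ren (absRen [x]))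

/-- The case `p → P`, where the binding names of `p` bind their occurrences in `P`. -/
def caseOf (p : Pattern) (P : Proc) : Proc := caseB p.erase (P.ren (absRen p.bnList))

/-- The iterated restriction `(ν x₁) … (ν xₖ) P`. -/
def resList (xs : List ℕ) (P : Proc) : Proc := xs.foldr res P

end Proc

/-- The application `σ P` of a substitution to a process. -/
def Subst.app (σ : Subst) (P : Proc) : Proc := P.subst σ.act

/-! ### Laws of the named constructors -/

theorem upRen_comp (k : ℕ) (f g : ℕ → ℕ) (i : ℕ) :
    upRen k g (upRen k f i) = upRen k (fun j => g (f j)) i := by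
  unfold upRen
  by_cases h : i < k
  · simp [h]
  · simp [h]

theorem PatternOf.ren_ren {β : Type} (f g : ℕ → ℕ) (p : PatternOf β) :
    (p.ren f).ren g = p.ren (fun i => g (f i)) := by
  induction p <;> simp_all [PatternOf.ren]

theorem PatternOf.bnList_ren {β : Type} (f : ℕ → ℕ) (p : PatternOf β) :
    (p.ren f).bnList = p.bnList := by
  induction p <;> simp_all [PatternOf.ren, PatternOf.bnList]

theorem PatternOf.bnList_erase_length {β : Type} (p : PatternOf β) :
    p.erase.bnList.length = p.bnList.length := by
  induction p <;> simp_all [PatternOf.erase, PatternOf.bnList]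

theorem PatternOf.fn_erase {β : Type} (p : PatternOf β) : p.erase.fn = p.fn := by
  have h1 : p.erase.vn = p.vn := by
    induction p <;> simp_all [PatternOf.erase, PatternOf.vn]
  have h2 : p.erase.pn = p.pn := by
    clear h1
    induction p <;> simp_all [PatternOf.erase, PatternOf.pn]
  simp [PatternOf.fn, h1, h2]

theorem PatternOf.arity_ren {β : Type} (f : ℕ → ℕ) (p : PatternOf β) :
    (p.ren f).arity = p.arity := by
  simp [PatternOf.arity, PatternOf.bnList_ren]

theorem PatternOf.arity_erase {β : Type} (p : PatternOf β) : p.erase.arity = p.arity :=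
  p.bnList_erase_length

theorem PatternOf.ren_congr {β : Type} (p : PatternOf β) (f g : ℕ → ℕ)
    (h : ∀ x ∈ p.fn, f x = g x) : p.ren f = p.ren g := by
  induction p with
  | lam b => rfl
  | var x => simp [PatternOf.ren, h x (by simp [PatternOf.fn, PatternOf.vn])]
  | pro x => simp [PatternOf.ren, h x (by simp [PatternOf.fn, PatternOf.pn])]
  | comp p q hp hq =>
    simp only [PatternOf.ren]
    rw [hp, hq]
    all_goals
      intro x hx
      apply h
      simp only [PatternOf.fn, PatternOf.vn, PatternOf.pn, Finset.mem_union] at hx ⊢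
      tauto

namespace Proc

theorem ren_ren (P : Proc) : ∀ f g : ℕ → ℕ, (P.ren f).ren g = P.ren (fun i => g (f i)) := by
  induction P with
  | nil => intros; rfl
  | par P Q hP hQ => intro f g; simp [ren, hP, hQ]
  | rep P hP => intro f g; simp [ren, hP]
  | nuB P hP => intro f g; simp only [ren, hP, upRen_comp]
  | caseB p P hP =>
    intro f g; simp only [ren, hP, upRen_comp, PatternOf.ren_ren, PatternOf.arity_ren]

theorem ren_congr (P : Proc) : ∀ f g : ℕ → ℕ, (∀ x ∈ P.fn, f x = g x) →
    P.ren f = P.ren g := by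
  have key : ∀ (k : ℕ) (s : Set ℕ) (f g : ℕ → ℕ),
      (∀ x ∈ {x | x + k ∈ s}, f x = g x) → ∀ x ∈ s, upRen k f x = upRen k g x := by
    intro k s f g h x hx
    unfold upRen
    by_cases hk : x < k
    · simp [hk]
    · have : x - k + k = x := by omega
      simp [hk, h (x - k) (by simpa [this] using hx)]
  induction P with
  | nil => intros; rfl
  | par P Q hP hQ =>
    intro f g h
    simp only [ren]
    rw [hP f g (fun x hx => h x (Or.inl hx)), hQ f g (fun x hx => h x (Or.inr hx))]
  | rep P hP => intro f g h; simp only [ren]; rw [hP f g h]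
  | nuB P hP =>
    intro f g h; simp only [ren]; rw [hP _ _ (key 1 P.fn f g h)]
  | caseB p P hP =>
    intro f g h; simp only [ren]
    rw [hP _ _ (key p.arity P.fn f g (fun x hx => h x (Or.inr hx))),
      p.ren_congr f g (fun x hx => h x (Or.inl hx))]

theorem fn_finite (P : Proc) : P.fn.Finite := by
  induction P with
  | nil => exact Set.finite_empty
  | par P Q hP hQ => exact hP.union hQ
  | rep P hP => exact hP
  | nuB P hP => exact hP.preimage (fun a _ b _ h => Nat.add_right_cancel h)
  | caseB p P hP =>
    exact (Finset.finite_toSet _).union (hP.preimage (fun a _ b _ h => Nat.add_right_cancel h))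

end Proc

theorem PatternOf.mem_fn_comp {β : Type} (p q : PatternOf β) (x : ℕ) :
    x ∈ (p.comp q).fn ↔ x ∈ p.fn ∨ x ∈ q.fn := by
  simp only [PatternOf.fn, PatternOf.vn, PatternOf.pn, Finset.mem_union]
  exact or_or_or_comm

theorem PatternOf.mem_fn_ren {β : Type} (f : ℕ → ℕ) (p : PatternOf β) (x : ℕ) :
    x ∈ (p.ren f).fn ↔ ∃ y ∈ p.fn, f y = x := by
  induction p with
  | lam b => simp [PatternOf.fn, PatternOf.ren, PatternOf.vn, PatternOf.pn]
  | var z => simp [PatternOf.fn, PatternOf.ren, PatternOf.vn, PatternOf.pn, eq_comm]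
  | pro z => simp [PatternOf.fn, PatternOf.ren, PatternOf.vn, PatternOf.pn, eq_comm]
  | comp p q hp hq =>
    rw [PatternOf.ren, PatternOf.mem_fn_comp, hp, hq]
    simp only [PatternOf.mem_fn_comp]
    constructor
    · rintro (⟨y, h, e⟩ | ⟨y, h, e⟩)
      exacts [⟨y, Or.inl h, e⟩, ⟨y, Or.inr h, e⟩]
    · rintro ⟨y, h | h, e⟩
      exacts [Or.inl ⟨y, h, e⟩, Or.inr ⟨y, h, e⟩]

namespace Proc

theorem mem_fn_ren (P : Proc) : ∀ (f : ℕ → ℕ) (x : ℕ),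
    x ∈ (P.ren f).fn ↔ ∃ y ∈ P.fn, f y = x := by
  have key : ∀ (k : ℕ) (s : Set ℕ) (f : ℕ → ℕ) (x : ℕ),
      (∃ y ∈ s, upRen k f y = x + k) ↔ ∃ y, y + k ∈ s ∧ f y = x := by
    intro k s f x
    constructor
    · rintro ⟨y, hy, e⟩
      unfold upRen at e
      by_cases hk : y < k
      · simp [hk] at e; omega
      · have : y - k + k = y := by omega
        exact ⟨y - k, by simpa [this] using hy, by simpa [hk] using e⟩
    · rintro ⟨y, hy, e⟩
      exact ⟨y + k, hy, by simp [upRen, e]⟩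
  induction P with
  | nil => intro f x; simp [ren, fn]
  | par P Q hP hQ =>
    intro f x
    simp only [ren, fn, Set.mem_union, hP, hQ]
    constructor
    · rintro (⟨y, h, e⟩ | ⟨y, h, e⟩)
      exacts [⟨y, Or.inl h, e⟩, ⟨y, Or.inr h, e⟩]
    · rintro ⟨y, h | h, e⟩
      exacts [Or.inl ⟨y, h, e⟩, Or.inr ⟨y, h, e⟩]
  | rep P hP => intro f x; simpa [ren, fn] using hP f x
  | nuB P hP =>
    intro f x
    simp only [ren, fn, Set.mem_ofPred_eq, hP]
    exact key 1 P.fn f x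
  | caseB p P hP =>
    intro f x
    simp only [ren, fn, Set.mem_ofPred_eq, hP, Set.mem_union, Finset.mem_coe,
      PatternOf.arity_ren, PatternOf.mem_fn_ren, key]
    constructor
    · rintro (⟨y, h, e⟩ | ⟨y, h, e⟩)
      exacts [⟨y, Or.inl h, e⟩, ⟨y, Or.inr h, e⟩]
    · rintro ⟨y, h | h, e⟩
      exacts [Or.inl ⟨y, h, e⟩, Or.inr ⟨y, h, e⟩]

end Proc

theorem absRen_eq_add (xs : List ℕ) (x y : ℕ) :
    absRen xs x = y + xs.length ↔ x = y ∧ x ∉ xs := by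
  unfold absRen
  by_cases h : x ∈ xs
  · have := List.idxOf_lt_length_of_mem h
    simp [h]; omega
  · simp [h]

namespace Proc

/-- The free names of a restriction. -/
theorem fn_res (x : ℕ) (P : Proc) : (res x P).fn = P.fn \ {x} := by
  ext z
  have := absRen_eq_add [x]
  simp only [List.length_singleton] at this
  simp only [res, fn, Set.mem_ofPred_eq, mem_fn_ren, this, Set.mem_sdiff, Set.mem_singleton_iff,
    List.mem_singleton]
  constructor
  · rintro ⟨y, h, rfl, h'⟩; exact ⟨h, h'⟩
  · rintro ⟨h, h'⟩; exact ⟨z, h, rfl, h'⟩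

/-- The free names of a case. -/
theorem fn_caseOf (p : Pattern) (P : Proc) : (caseOf p P).fn = ↑p.fn ∪ (P.fn \ ↑p.bn) := by
  ext z
  simp only [caseOf, fn, Set.mem_ofPred_eq, mem_fn_ren, PatternOf.fn_erase, PatternOf.arity,
    PatternOf.bnList_erase_length, absRen_eq_add, Set.mem_union, Set.mem_sdiff, Finset.mem_coe, PatternOf.bn,
    List.mem_toFinset]
  refine or_congr Iff.rfl ⟨?_, ?_⟩
  · rintro ⟨y, h, rfl, h'⟩; exact ⟨h, h'⟩
  · rintro ⟨h, h'⟩; exact ⟨z, h, rfl, h'⟩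

end Proc

theorem PatternOf.subst_name {β : Type} (f : ℕ → ℕ) (p : PatternOf β) :
    p.subst (fun i => Comm.name (f i)) = p.ren f := by
  induction p <;> simp_all [PatternOf.ren, PatternOf.subst, Comm.toPat, Comm.protect]

theorem upSubst_name (k : ℕ) (f : ℕ → ℕ) :
    upSubst k (fun i => Comm.name (f i)) = fun i => Comm.name (upRen k f i) := by
  funext i
  unfold upSubst upRen
  by_cases h : i < k <;> simp [h, Comm.ren]

theorem Proc.subst_name (P : Proc) : ∀ f : ℕ → ℕ,
    P.subst (fun i => Comm.name (f i)) = P.ren f := by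
  induction P <;> intro f <;> simp_all [Proc.ren, Proc.subst, upSubst_name, PatternOf.subst_name]

/-- The substitution `{y/x}` acts as a renaming. -/
theorem Subst.app_single_name (x y : ℕ) (P : Proc) :
    (Subst.single x (Comm.name y)).app P = P.ren (fun z => if z = x then y else z) := by
  rw [← Proc.subst_name]
  unfold Subst.app
  congr 1
  funext z
  unfold Subst.act Subst.single
  by_cases h : z = x <;> simp [h]

namespace Proc

/-- Alpha-conversion of a restriction. -/
theorem res_alpha (x y : ℕ) (P : Proc) (h : y ∉ P.fn) :
    res x P = res y ((Subst.single x (Comm.name y)).app P) := by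
  unfold res
  rw [Subst.app_single_name, ren_ren]
  congr 1
  apply ren_congr
  intro z hz
  have : z ≠ y := fun e => h (e ▸ hz)
  by_cases hx : z = x <;> simp [absRen, hx, this]

end Proc

/-- Change of the binding names of a pattern. -/
def PatternOf.mapLam {β γ : Type} (f : β → γ) : PatternOf β → PatternOf γ
  | lam b => lam (f b)
  | var x => var x
  | pro x => pro x
  | comp p q => comp (p.mapLam f) (q.mapLam f)

theorem PatternOf.erase_mapLam {β γ : Type} (f : β → γ) (p : PatternOf β) :
    (p.mapLam f).erase = p.erase := by
  induction p <;> simp_all [PatternOf.mapLam, PatternOf.erase]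

theorem PatternOf.bnList_mapLam {β γ : Type} (f : β → γ) (p : PatternOf β) :
    (p.mapLam f).bnList = p.bnList.map f := by
  induction p <;> simp_all [PatternOf.mapLam, PatternOf.bnList]

theorem idxOf_map_of_inj (f : ℕ → ℕ) (z : ℕ) (xs : List ℕ) :
    (∀ w ∈ xs, f w = f z → w = z) → (xs.map f).idxOf (f z) = xs.idxOf z := by
  induction xs with
  | nil => intro _; rfl
  | cons a xs ih =>
    intro h
    by_cases ha : a = z
    · subst ha; simp
    · have : f a ≠ f z := fun e => ha (h a (by simp) e)
      simp [List.idxOf_cons_ne _ ha, List.idxOf_cons_ne _ this,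
        ih (fun w hw => h w (by simp [hw]))]

namespace Proc

/-- Alpha-conversion of a case. -/
theorem caseOf_alpha (p : Pattern) (x y : ℕ) (P : Proc) (hx : x ∈ p.bn)
    (h : y ∉ P.fn) (h' : y ∉ p.bn) :
    caseOf p P = caseOf (p.mapLam (fun z => if z = x then y else z))
      ((Subst.single x (Comm.name y)).app P) := by
  unfold caseOf
  rw [Subst.app_single_name, ren_ren, PatternOf.erase_mapLam, PatternOf.bnList_mapLam]
  congr 1
  apply ren_congr
  intro z hz
  simp only [PatternOf.bn, List.mem_toFinset] at hx h'
  set f : ℕ → ℕ := fun z => if z = x then y else z with hf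
  have hzy : z ≠ y := fun e => h (e ▸ hz)
  have inj : ∀ w ∈ p.bnList, f w = f z → w = z := by
    intro w hw e
    have : w ≠ y := fun e => h' (e ▸ hw)
    simp only [hf] at e
    split_ifs at e <;> simp_all
  have hmem : f z ∈ p.bnList.map f ↔ z ∈ p.bnList := by
    constructor
    · intro hm
      obtain ⟨w, hw, e⟩ := List.mem_map.1 hm
      exact inj w hw e ▸ hw
    · exact fun hm => List.mem_map_of_mem hm
  unfold absRen
  by_cases hm : z ∈ p.bnList
  · rw [if_pos hm, if_pos (hmem.2 hm), idxOf_map_of_inj f z _ inj]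
  · rw [if_neg hm, if_neg (fun h => hm (hmem.1 h))]
    have : z ≠ x := fun e => hm (e ▸ hx)
    simp [hf, this]

end Proc

theorem Comm.ren_ren (f g : ℕ → ℕ) (M : Comm) :
    (M.ren f).ren g = M.ren (fun i => g (f i)) := by
  induction M <;> simp_all [Comm.ren]

theorem Comm.ren_congr (f g : ℕ → ℕ) (M : Comm) (h : ∀ x ∈ M.fn, f x = g x) :
    M.ren f = M.ren g := by
  induction M with
  | name x => simp [Comm.ren, h x (by simp [Comm.fn])]
  | comp M N hM hN =>
    simp only [Comm.ren]
    rw [hM (fun x hx => h x (by simp [Comm.fn, hx])), hN (fun x hx => h x (by simp [Comm.fn, hx]))]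

theorem PatternOf.subst_ren {β : Type} (p : PatternOf β) (r : ℕ → ℕ) (f : ℕ → Comm) :
    (p.ren r).subst f = p.subst (fun i => f (r i)) := by
  induction p <;> simp_all [PatternOf.ren, PatternOf.subst]

theorem PatternOf.ren_subst {β : Type} (p : PatternOf β) (f : ℕ → Comm) (r : ℕ → ℕ) :
    (p.subst f).ren r = p.subst (fun i => (f i).ren r) := by
  have h1 : ∀ M : Comm, (M.toPat : PatternOf β).ren r = (M.ren r).toPat := by
    intro M; induction M <;> simp_all [Comm.toPat, Comm.ren, PatternOf.ren]
  have h2 : ∀ M : Comm, (M.protect : PatternOf β).ren r = (M.ren r).protect := by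
    intro M; induction M <;> simp_all [Comm.protect, Comm.ren, PatternOf.ren]
  induction p <;> simp_all [PatternOf.ren, PatternOf.subst]

theorem PatternOf.bnList_subst {β : Type} (f : ℕ → Comm) (p : PatternOf β) :
    (p.subst f).bnList = p.bnList := by
  have h1 : ∀ M : Comm, (M.toPat : PatternOf β).bnList = [] := by
    intro M; induction M <;> simp_all [Comm.toPat, PatternOf.bnList]
  have h2 : ∀ M : Comm, (M.protect : PatternOf β).bnList = [] := by
    intro M; induction M <;> simp_all [Comm.protect, PatternOf.bnList]
  induction p <;> simp_all [PatternOf.subst, PatternOf.bnList]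

theorem PatternOf.erase_subst {β : Type} (f : ℕ → Comm) (p : PatternOf β) :
    (p.subst f).erase = p.erase.subst f := by
  have h1 : ∀ M : Comm, (M.toPat : PatternOf β).erase = M.toPat := by
    intro M; induction M <;> simp_all [Comm.toPat, PatternOf.erase]
  have h2 : ∀ M : Comm, (M.protect : PatternOf β).erase = M.protect := by
    intro M; induction M <;> simp_all [Comm.protect, PatternOf.erase]
  induction p <;> simp_all [PatternOf.subst, PatternOf.erase]

theorem upSubst_upRen (k : ℕ) (r : ℕ → ℕ) (f : ℕ → Comm) (i : ℕ) :
    upSubst k f (upRen k r i) = upSubst k (fun j => f (r j)) i := by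
  unfold upSubst upRen
  by_cases h : i < k <;> simp [h]

theorem upRen_upSubst (k : ℕ) (f : ℕ → Comm) (r : ℕ → ℕ) (i : ℕ) :
    (upSubst k f i).ren (upRen k r) = upSubst k (fun j => (f j).ren r) i := by
  unfold upSubst
  by_cases h : i < k
  · simp [h, Comm.ren, upRen]
  · simp only [h, if_false, Comm.ren_ren]
    congr 1
    funext j
    simp [upRen]

namespace Proc

theorem subst_ren (P : Proc) : ∀ (r : ℕ → ℕ) (f : ℕ → Comm),
    (P.ren r).subst f = P.subst (fun i => f (r i)) := by
  induction P <;> intro r f <;>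
    simp_all [ren, subst, upSubst_upRen, PatternOf.subst_ren, PatternOf.arity_ren]

theorem ren_subst (P : Proc) : ∀ (f : ℕ → Comm) (r : ℕ → ℕ),
    (P.subst f).ren r = P.subst (fun i => (f i).ren r) := by
  induction P <;> intro f r <;>
    simp_all [ren, subst, upRen_upSubst, PatternOf.ren_subst, PatternOf.arity,
      PatternOf.bnList_subst]

end Proc

theorem Subst.absRen_act (σ : Subst) (xs : List ℕ) (h : ∀ x ∈ xs, x ∉ σ.dom ∧ x ∉ σ.fn)
    (z : ℕ) : upSubst xs.length σ.act (absRen xs z) = (σ.act z).ren (absRen xs) := by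
  unfold upSubst
  by_cases hz : z ∈ xs
  · have hd : σ z = none := by
      cases e : σ z with
      | none => rfl
      | some M => exact absurd ⟨M, e⟩ (h z hz).1
    have := List.idxOf_lt_length_of_mem hz
    simp [absRen, hz, Subst.act, hd, Comm.ren, this]
  · have : absRen xs z = z + xs.length := (absRen_eq_add xs z z).2 ⟨rfl, hz⟩
    simp only [this, Nat.add_sub_cancel]
    rw [if_neg (by omega)]
    apply Comm.ren_congr
    intro y hy
    refine ((absRen_eq_add xs y y).2 ⟨rfl, fun hm => ?_⟩).symm
    cases e : σ z with
    | none =>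
      simp only [Subst.act, e, Option.getD_none, Comm.fn, Finset.mem_singleton] at hy
      exact hz (hy ▸ hm)
    | some M =>
      simp only [Subst.act, e, Option.getD_some] at hy
      exact (h y hm).2 ⟨z, M, e, hy⟩

/-- Substitution into a restriction whose bound name is avoided by the substitution. -/
theorem Subst.app_res (σ : Subst) (x : ℕ) (P : Proc) (hd : x ∉ σ.dom) (hf : x ∉ σ.fn) :
    σ.app (Proc.res x P) = Proc.res x (σ.app P) := by
  simp only [Subst.app, Proc.res, Proc.subst, Proc.subst_ren, Proc.ren_subst]
  congr 2
  funext z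
  exact σ.absRen_act [x] (by simp [hd, hf]) z

/-- Substitution into a case whose binding names are avoided by the substitution. -/
theorem Subst.app_caseOf (σ : Subst) (p : Pattern) (P : Proc)
    (h : ∀ x ∈ p.bn, x ∉ σ.dom ∧ x ∉ σ.fn) :
    σ.app (Proc.caseOf p P) = Proc.caseOf (p.subst σ.act) (σ.app P) := by
  simp only [Subst.app, Proc.caseOf, Proc.subst, Proc.subst_ren, Proc.ren_subst,
    PatternOf.erase_subst, PatternOf.bnList_subst, PatternOf.bnList_erase_length, PatternOf.arity]
  congr 2
  funext z
  exact σ.absRen_act p.bnList (fun x hx => h x (by simpa [PatternOf.bn] using hx)) z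

theorem exists_label (q : PatternOf Unit) : ∀ m : ℕ, ∃ p : Pattern,
    p.erase = q ∧ p.bnList = List.range' m q.arity := by
  induction q with
  | lam b => intro m; exact ⟨.lam m, rfl, rfl⟩
  | var x => intro m; exact ⟨.var x, rfl, rfl⟩
  | pro x => intro m; exact ⟨.pro x, rfl, rfl⟩
  | comp q r hq hr =>
    intro m
    obtain ⟨p, hp, hp'⟩ := hq m
    obtain ⟨s, hs, hs'⟩ := hr (m + q.arity)
    refine ⟨.comp p s, by simp [PatternOf.erase, hp, hs], ?_⟩
    simp only [PatternOf.bnList, hp', hs', PatternOf.arity, List.length_append]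
    simp

theorem exists_unabs (P : Proc) (xs : List ℕ) (hn : xs.Nodup)
    (hf : ∀ x ∈ xs, ∀ y ∈ P.fn, y ≠ x + xs.length) :
    ∃ P' : Proc, P = P'.ren (absRen xs) := by
  refine ⟨P.ren (fun i => if h : i < xs.length then xs[i] else i - xs.length), ?_⟩
  rw [Proc.ren_ren]
  have hid : ∀ P : Proc, P.ren (fun i => i) = P := by
    have hp : ∀ p : PatternOf Unit, p.ren (fun i => i) = p := by
      intro p; induction p <;> simp_all [PatternOf.ren]
    have hu : ∀ k, upRen k (fun i => i) = fun i => i := by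
      intro k; funext i; unfold upRen; dsimp only; split_ifs <;> omega
    intro P
    induction P <;> simp_all only [Proc.ren]
  conv_lhs => rw [← hid P]
  apply Proc.ren_congr
  intro i hi
  by_cases h : i < xs.length
  · simp [h, absRen, hn.idxOf_getElem]
  · simp only [h, dite_false]
    symm
    have e := (absRen_eq_add xs (i - xs.length) (i - xs.length)).2
      ⟨rfl, fun hm => hf _ hm i hi (by omega)⟩
    omega

namespace Proc

/-- Every nameless restriction is of the form `(ν x) P'`, and `x` can be chosen outside any
finite set of names. -/
theorem exists_res (P : Proc) (s : Finset ℕ) : ∃ x P', x ∉ s ∧ nuB P = res x P' := by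
  obtain ⟨x, hx⟩ := Infinite.exists_notMem_finset (s ∪ P.fn_finite.toFinset.image (· - 1))
  simp only [Finset.mem_union, not_or, Finset.mem_image, Set.Finite.mem_toFinset] at hx
  obtain ⟨P', hP'⟩ := exists_unabs P [x] (List.nodup_singleton x) (by
    intro z hz y hy e
    rw [List.mem_singleton] at hz
    exact hx.2 ⟨y, hy, by simp [e, hz]⟩)
  exact ⟨x, P', hx.1, by rw [res, ← hP']⟩

/-- Every nameless case is of the form `p → P'` for a well-formed pattern `p`, and the binding
names of `p` can be chosen outside any finite set of names. -/
theorem exists_caseOf (q : PatternOf Unit) (P : Proc) (s : Finset ℕ) :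
    ∃ (p : Pattern) (P' : Proc), p.WF ∧ Disjoint p.bn s ∧ caseB q P = caseOf p P' := by
  obtain ⟨m, hm⟩ := (s ∪ q.fn ∪ P.fn_finite.toFinset).bddAbove
  obtain ⟨p, hp, hb⟩ := exists_label q (m + 1)
  have hge : ∀ x ∈ p.bnList, m < x := by
    intro x hx; rw [hb, List.mem_range'_1] at hx; omega
  have hs : ∀ x, (x ∈ s ∨ x ∈ q.fn ∨ x ∈ P.fn) → x ≤ m := by
    intro x hx; apply hm; simp; tauto
  have hnd : p.bnList.Nodup := hb ▸ List.nodup_range'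
  obtain ⟨P', hP'⟩ := exists_unabs P p.bnList hnd (by
    intro x hx y hy e
    have := hge x hx
    have := hs y (by tauto)
    omega)
  refine ⟨p, P', ⟨hnd, ?_⟩, ?_, by rw [caseOf, ← hP', hp]⟩
  · rw [Finset.disjoint_left]
    intro x hx hx'
    rw [PatternOf.bn, List.mem_toFinset] at hx
    rw [← PatternOf.fn_erase, hp] at hx'
    have := hge x hx
    have := hs x (by tauto)
    omega
  · rw [Finset.disjoint_left]
    intro x hx hx'
    rw [PatternOf.bn, List.mem_toFinset] at hx
    have := hge x hx
    have := hs x (by tauto)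
    omega

end Proc

theorem Proc.ren_injective (f g : ℕ → ℕ) (h : ∀ i, g (f i) = i) :
    Function.Injective (Proc.ren f) := by
  have hid : ∀ P : Proc, P.ren (fun i => i) = P := by
    have hp : ∀ p : PatternOf Unit, p.ren (fun i => i) = p := by
      intro p; induction p <;> simp_all [PatternOf.ren]
    have hu : ∀ k, upRen k (fun i => i) = fun i => i := by
      intro k; funext i; unfold upRen; dsimp only; split_ifs <;> omega
    intro P
    induction P <;> simp_all only [Proc.ren]
  intro P Q e
  have e' := congrArg (Proc.ren g) e
  simpa only [Proc.ren_ren, h, hid] using e'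

theorem unabs_absRen (xs : List ℕ) (i : ℕ) :
    (fun j => if h : j < xs.length then xs[j] else j - xs.length) (absRen xs i) = i := by
  unfold absRen
  by_cases h : i ∈ xs
  · have := List.idxOf_lt_length_of_mem h
    simp [h, this]
  · simp [h]

namespace Proc

/-- Restriction of a given name does not identify different processes. -/
theorem res_inj (x : ℕ) (P Q : Proc) : res x P = res x Q ↔ P = Q := by
  refine ⟨fun e => ?_, fun e => e ▸ rfl⟩
  rw [res, res, nuB.injEq] at e
  exact ren_injective _ (fun j => if h : j < [x].length then [x][j] else j - [x].length)
    (unabs_absRen [x]) e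

/-- The case with a given pattern does not identify different processes. -/
theorem caseOf_inj (p : Pattern) (P Q : Proc) : caseOf p P = caseOf p Q ↔ P = Q := by
  refine ⟨fun e => ?_, fun e => e ▸ rfl⟩
  rw [caseOf, caseOf, caseB.injEq] at e
  exact ren_injective _ (fun j => if h : j < p.bnList.length then p.bnList[j] else j - p.bnList.length)
    (unabs_absRen p.bnList) e.2

end Proc

/-! ### Labelled transitions -/

/-- Labels: `τ` and `(ν ns) p`, with a finite set `ns` of restricted names. -/
inductive Label : Type
  | tau : Label
  | out (ns : Finset ℕ) (p : Pattern) : Label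

/-- The names of a label. -/
def Label.names : Label → Finset ℕ
  | tau => ∅
  | out ns p => ns ∪ p.fn ∪ p.bn

/-- The labelled transition system.  In rule `unify`, the restriction of the set of names
`ms ∪ ns` is an iterated restriction in any order, without repetitions. -/
inductive Step : Proc → Label → Proc → Prop
  | caseOf (p : Pattern) (P : Proc) (hp : p.WF) :
      Step (Proc.caseOf p P) (.out ∅ p) P
  | resnon (n : ℕ) (P P' : Proc) (μ : Label) (hn : n ∉ μ.names) :
      Step P μ P' → Step (Proc.res n P) μ (Proc.res n P')
  | opn (m : ℕ) (P P' : Proc) (ns : Finset ℕ) (p : Pattern)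
      (hm : m ∈ p.vn) (hm' : m ∉ ns ∪ p.pn ∪ p.bn) :
      Step P (.out ns p) P' → Step (Proc.res m P) (.out (insert m ns) p) P'
  | unify (P P' Q Q' : Proc) (ms ns : Finset ℕ) (p q : Pattern) (σ ρ : Subst) (l : List ℕ)
      (hu : Unify p q σ ρ) (hm : ∀ x ∈ ms, x ∉ Q.fn) (hn : ∀ x ∈ ns, x ∉ P.fn)
      (hd : Disjoint ms ns) (hl : l.Nodup) (hl' : l.toFinset = ms ∪ ns) :
      Step P (.out ms p) P' → Step Q (.out ns q) Q' →
      Step (.par P Q) .tau (Proc.resList l (.par (σ.app P') (ρ.app Q')))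
  | parintL (P P' Q : Proc) :
      Step P .tau P' → Step (.par P Q) .tau (.par P' Q)
  | parintR (P Q Q' : Proc) :
      Step Q .tau Q' → Step (.par P Q) .tau (.par P Q')
  | parextL (P P' Q : Proc) (ns : Finset ℕ) (p : Pattern) (h : ∀ x ∈ ns ∪ p.bn, x ∉ Q.fn) :
      Step P (.out ns p) P' → Step (.par P Q) (.out ns p) (.par P' Q)
  | parextR (P Q Q' : Proc) (ns : Finset ℕ) (p : Pattern) (h : ∀ x ∈ ns ∪ p.bn, x ∉ P.fn) :
      Step Q (.out ns p) Q' → Step (.par P Q) (.out ns p) (.par P Q')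
  | rep (P P' : Proc) (μ : Label) :
      Step (.par (.rep P) P) μ P' → Step (.rep P) μ P'

/-! ### Compatibility and bisimilarity -/

/-- Matches: a pattern with a substitution whose domain is its set of binding names. -/
def IsMatch (p : Pattern) (σ : Subst) : Prop := σ.dom = ↑p.bn

/-- `Compat p σ q ρ`: the pattern `p` is compatible with `q` by `σ` and `ρ`, `p,σ ≪ q,ρ`.
In rule `lam`, the pattern `σ̂ p` is the communicable pattern `M`. -/
inductive Compat : Pattern → Subst → Pattern → Subst → Prop
  | lam (p : Pattern) (σ : Subst) (y : ℕ) (M : Comm) (hσ : IsMatch p σ) (hp : p.fn = ∅)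
      (hM : p.hat σ = M.toPat) : Compat p σ (.lam y) (Subst.single y M)
  | var_var (n : ℕ) : Compat (.var n) Subst.empty (.var n) Subst.empty
  | pro_pro (n : ℕ) : Compat (.pro n) Subst.empty (.pro n) Subst.empty
  | pro_var (n : ℕ) : Compat (.pro n) Subst.empty (.var n) Subst.empty
  | comp (p₁ p₂ q₁ q₂ : Pattern) (σ₁ σ₂ ρ₁ ρ₂ : Subst) :
      Compat p₁ σ₁ q₁ ρ₁ → Compat p₂ σ₂ q₂ ρ₂ →
      Compat (.comp p₁ p₂) (σ₁.union σ₂) (.comp q₁ q₂) (ρ₁.union ρ₂)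

/-- Bisimulations. -/
structure IsBisimulation (R : Proc → Proc → Prop) : Prop where
  symm : ∀ P Q, R P Q → R Q P
  tau : ∀ P Q P', R P Q → Step P .tau P' → ∃ Q', Step Q .tau Q' ∧ R P' Q'
  out : ∀ P Q P' ns p, R P Q → Step P (.out ns p) P' → (∀ x ∈ p.bn ∪ ns, x ∉ Q.fn) →
    ∀ σ : Subst, IsMatch p σ → (∀ x ∈ ns, x ∉ σ.fn) →
      ∃ q ρ Q', IsMatch q ρ ∧ Compat p σ q ρ ∧ Step Q (.out ns q) Q' ∧ R (σ.app P') (ρ.app Q')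

/-- Closure under all substitutions (with finite domain). -/
def ClosedUnderSubst (R : Proc → Proc → Prop) : Prop :=
  ∀ P Q, R P Q → ∀ σ : Subst, σ.dom.Finite → R (σ.app P) (σ.app Q)

/-- Bisimilarity: the largest bisimulation closed under substitutions, i.e. the union of all
bisimulations that are closed under substitutions. -/
def Bisimilar (P Q : Proc) : Prop :=
  ∃ R : Proc → Proc → Prop, IsBisimulation R ∧ ClosedUnderSubst R ∧ R P Q

/-- Bisimilarity is itself a bisimulation. -/
theorem isBisimulation_bisimilar : IsBisimulation Bisimilar where
  symm := fun P Q ⟨R, hR, hS, h⟩ => ⟨R, hR, hS, hR.symm P Q h⟩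
  tau := by
    rintro P Q P' ⟨R, hR, hS, h⟩ hT
    obtain ⟨Q', hQ', h'⟩ := hR.tau P Q P' h hT
    exact ⟨Q', hQ', R, hR, hS, h'⟩
  out := by
    rintro P Q P' ns p ⟨R, hR, hS, h⟩ hT hf σ hσ hn
    obtain ⟨q, ρ, Q', h1, h2, h3, h4⟩ := hR.out P Q P' ns p h hT hf σ hσ hn
    exact ⟨q, ρ, Q', h1, h2, h3, R, hR, hS, h4⟩

/-- Bisimilarity is closed under substitutions. -/
theorem closedUnderSubst_bisimilar : ClosedUnderSubst Bisimilar :=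
  fun P Q ⟨R, hR, hS, h⟩ σ hσ => ⟨R, hR, hS, hS P Q h σ hσ⟩

end CPC

open CPC

/-! The case `p → P'` has only one kind of move, and each of its moves can be made by a copy of `q →
Q'` instead. The hypothesis gives this for the identity match. That match is the most general one:
under a substitution `f`, any instance of `p` arises from its identity instance by substituting `f`
for the free names and `h` inside the received values, where `h` is the instantiation on `bn(p)` and
`f` elsewhere. Compatibility and bisimilarity are stable under substitution (`CompatN.subst`,
`Bisimilar.subst`), so `p → P'` is `Dominated` by `q → Q'` (`dominated_caseOf`).

It remains to show that `A | !B ∼ !B` whenever `A` is dominated by `B`. A move of `A` is answered by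
a copy of `B` unfolded from `!B`. A synchronisation of `A` with `!B` is answered by one inside `!B |
B`, because a compatible pattern unifies with at least as many patterns (`CompatN.unifyN`). If `!B`
moves alone, then `A` is left beside a derivative of `!B`; up to structural laws that derivative
still contains `!B` (`Step.rep_target`), which absorbs `A`.

The coinduction therefore needs a relation that contains bisimilarity and absorption and is closed
under parallel composition, restriction and the structural laws. This is `Cong`, an equivalence by
construction. Induction on its generation shows that related processes simulate each other under
every substitution (`Cong.sim`), so `Cong` is a bisimulation closed under substitutions.

Two devices keep names under control. Transitions are invariant under permutations of names
(`Step.perm`), so bound names of labels can be taken fresh. Binding names of labels are removed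
altogether by passing to early transitions (`EStep`), whose labels carry the received values in
place of the binders. Compatibility and unification become the relations `CompatN` and `UnifyN` on
such instances, and bisimulations are recovered from early simulations by `isBisimulation_of_sim`.
-/

namespace CPC

/-! ### Renaming by permutations of the names -/

namespace PatternOf

variable {β γ δ : Type}

theorem mapLam_mapLam (f : β → γ) (g : γ → δ) (p : PatternOf β) :
    (p.mapLam f).mapLam g = p.mapLam (fun b => g (f b)) := by
  induction p <;> simp_all [mapLam]

theorem mapLam_congr (p : PatternOf β) (f g : β → γ) (h : ∀ b ∈ p.bnList, f b = g b) :
    p.mapLam f = p.mapLam g := by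
  induction p with
  | lam b => simp [mapLam, h b (by simp [bnList])]
  | var x => rfl
  | pro x => rfl
  | comp p q hp hq =>
    simp only [mapLam]
    rw [hp (fun b hb => h b (by simp [bnList, hb])), hq (fun b hb => h b (by simp [bnList, hb]))]

theorem ren_mapLam (f : β → γ) (r : ℕ → ℕ) (p : PatternOf β) :
    (p.mapLam f).ren r = (p.ren r).mapLam f := by
  induction p <;> simp_all [mapLam, ren]

theorem vn_mapLam (f : β → γ) (p : PatternOf β) : (p.mapLam f).vn = p.vn := by
  induction p <;> simp_all [mapLam, vn]

theorem pn_mapLam (f : β → γ) (p : PatternOf β) : (p.mapLam f).pn = p.pn := by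
  induction p <;> simp_all [mapLam, pn]

theorem fn_mapLam (f : β → γ) (p : PatternOf β) : (p.mapLam f).fn = p.fn := by
  simp [fn, vn_mapLam, pn_mapLam]

theorem vn_ren (r : ℕ → ℕ) (p : PatternOf β) : (p.ren r).vn = p.vn.image r := by
  induction p <;> simp_all [ren, vn, Finset.image_union]

theorem pn_ren (r : ℕ → ℕ) (p : PatternOf β) : (p.ren r).pn = p.pn.image r := by
  induction p <;> simp_all [ren, pn, Finset.image_union]

theorem fn_ren (r : ℕ → ℕ) (p : PatternOf β) : (p.ren r).fn = p.fn.image r := by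
  simp [fn, vn_ren, pn_ren, Finset.image_union]

theorem erase_ren (r : ℕ → ℕ) (p : PatternOf β) : (p.ren r).erase = p.erase.ren r := by
  induction p <;> simp_all [ren, erase]

theorem ren_id (p : PatternOf β) : p.ren (fun i => i) = p := by
  induction p <;> simp_all [ren]

/-- Renaming of all names of a pattern, the binding names included. -/
def perm (f : ℕ → ℕ) (p : Pattern) : Pattern := (p.ren f).mapLam f

theorem bnList_perm (f : ℕ → ℕ) (p : Pattern) : (p.perm f).bnList = p.bnList.map f := by
  rw [perm, bnList_mapLam, bnList_ren]

theorem bn_perm (f : ℕ → ℕ) (p : Pattern) : (p.perm f).bn = p.bn.image f := by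
  ext x; simp [bn, bnList_perm]

theorem vn_perm (f : ℕ → ℕ) (p : Pattern) : (p.perm f).vn = p.vn.image f := by
  rw [perm, vn_mapLam, vn_ren]

theorem pn_perm (f : ℕ → ℕ) (p : Pattern) : (p.perm f).pn = p.pn.image f := by
  rw [perm, pn_mapLam, pn_ren]

theorem fn_perm (f : ℕ → ℕ) (p : Pattern) : (p.perm f).fn = p.fn.image f := by
  rw [perm, fn_mapLam, fn_ren]

theorem erase_perm (f : ℕ → ℕ) (p : Pattern) : (p.perm f).erase = p.erase.ren f := by
  rw [perm, erase_mapLam, erase_ren]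

theorem WF.perm {p : Pattern} (h : p.WF) (f : Equiv.Perm ℕ) : (p.perm f).WF := by
  refine ⟨?_, ?_⟩
  · rw [bnList_perm]; exact h.1.map f.injective
  · rw [bn_perm, fn_perm]
    exact (Finset.disjoint_image f.injective).2 h.2

theorem mem_bn (p : Pattern) (x : ℕ) : x ∈ p.bn ↔ x ∈ p.bnList := by simp [bn]

end PatternOf

/-- An injective renaming preserves positions in a list. This is why the named binders commute with
permutations. -/
theorem absRen_map (f : ℕ → ℕ) (hf : Function.Injective f) (xs : List ℕ) (z : ℕ) :
    absRen (xs.map f) (f z) = upRen xs.length f (absRen xs z) := by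
  unfold absRen upRen
  by_cases h : z ∈ xs
  · have := List.idxOf_lt_length_of_mem h
    simp [h, this, idxOf_map_of_inj f z xs (fun w _ e => hf e), hf.eq_iff]
  · simp [h, hf.eq_iff]

namespace Proc

theorem ren_id (P : Proc) : P.ren (fun i => i) = P := by
  have hu : ∀ k, upRen k (fun i => i) = fun i => i := by
    intro k; funext i; unfold upRen; dsimp only; split_ifs <;> omega
  induction P <;> simp_all only [ren, PatternOf.ren_id]

theorem ren_eq_self (P : Proc) (f : ℕ → ℕ) (h : ∀ x ∈ P.fn, f x = x) : P.ren f = P := by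
  rw [P.ren_congr f (fun i => i) h, ren_id]

theorem res_ren (f : Equiv.Perm ℕ) (x : ℕ) (P : Proc) :
    (res x P).ren f = res (f x) (P.ren f) := by
  simp only [res, ren, ren_ren]
  congr 1
  apply ren_congr
  intro z _
  exact (absRen_map f f.injective [x] z).symm

theorem caseOf_ren (f : Equiv.Perm ℕ) (p : Pattern) (P : Proc) :
    (caseOf p P).ren f = caseOf (p.perm f) (P.ren f) := by
  simp only [caseOf, ren, ren_ren, PatternOf.erase_perm, PatternOf.bnList_perm,
    PatternOf.arity_erase]
  congr 1
  apply ren_congr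
  intro z _
  exact (absRen_map f f.injective p.bnList z).symm

theorem resList_ren (f : Equiv.Perm ℕ) (l : List ℕ) (P : Proc) :
    (resList l P).ren f = resList (l.map f) (P.ren f) := by
  induction l with
  | nil => rfl
  | cons x l ih =>
    simp only [resList, List.foldr_cons, List.map_cons, res_ren] at ih ⊢
    rw [ih]

theorem fn_resList (l : List ℕ) (P : Proc) : (resList l P).fn = P.fn \ {x | x ∈ l} := by
  induction l with
  | nil => simp [resList]
  | cons x l ih =>
    simp only [resList, List.foldr_cons, fn_res] at ih ⊢
    rw [ih]; ext z; simp; tauto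

theorem mem_fn_subst (P : Proc) : ∀ (f : ℕ → Comm) (x : ℕ),
    x ∈ (P.subst f).fn ↔ ∃ y ∈ P.fn, x ∈ (f y).fn := by
  have hren : ∀ (M : Comm) (k x : ℕ), x + k ∈ (M.ren (· + k)).fn ↔ x ∈ M.fn := by
    intro M k x
    induction M <;> simp_all [Comm.ren, Comm.fn]
  have key : ∀ (k : ℕ) (s : Set ℕ) (f : ℕ → Comm) (x : ℕ),
      (∃ y ∈ s, x + k ∈ (upSubst k f y).fn) ↔ ∃ y, y + k ∈ s ∧ x ∈ (f y).fn := by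
    intro k s f x
    constructor
    · rintro ⟨y, hy, e⟩
      unfold upSubst at e
      by_cases hk : y < k
      · simp [hk, Comm.fn] at e; omega
      · have : y - k + k = y := by omega
        rw [if_neg hk, hren] at e
        exact ⟨y - k, by simpa [this] using hy, e⟩
    · rintro ⟨y, hy, e⟩
      refine ⟨y + k, hy, ?_⟩
      simpa [upSubst, hren] using e
  have hpat : ∀ {β : Type} (p : PatternOf β) (f : ℕ → Comm) (x : ℕ),
      x ∈ (p.subst f).fn ↔ ∃ y ∈ p.fn, x ∈ (f y).fn := by
    intro β p f x
    have h1 : ∀ M : Comm, x ∈ (M.toPat : PatternOf β).fn ↔ x ∈ M.fn := by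
      intro M
      induction M with
      | name z => simp [Comm.toPat, PatternOf.fn, PatternOf.vn, PatternOf.pn, Comm.fn]
      | comp M N hM hN => simp [Comm.toPat, PatternOf.mem_fn_comp, Comm.fn, hM, hN]
    have h2 : ∀ M : Comm, x ∈ (M.protect : PatternOf β).fn ↔ x ∈ M.fn := by
      intro M
      induction M with
      | name z => simp [Comm.protect, PatternOf.fn, PatternOf.vn, PatternOf.pn, Comm.fn]
      | comp M N hM hN => simp [Comm.protect, PatternOf.mem_fn_comp, Comm.fn, hM, hN]
    induction p with
    | lam b => simp [PatternOf.fn, PatternOf.subst, PatternOf.vn, PatternOf.pn]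
    | var z => rw [PatternOf.subst, h1]; simp [PatternOf.fn, PatternOf.vn, PatternOf.pn]
    | pro z => rw [PatternOf.subst, h2]; simp [PatternOf.fn, PatternOf.vn, PatternOf.pn]
    | comp p q hp hq =>
      simp only [PatternOf.subst, PatternOf.mem_fn_comp, hp, hq]
      constructor
      · rintro (⟨y, h, e⟩ | ⟨y, h, e⟩)
        exacts [⟨y, Or.inl h, e⟩, ⟨y, Or.inr h, e⟩]
      · rintro ⟨y, h | h, e⟩
        exacts [Or.inl ⟨y, h, e⟩, Or.inr ⟨y, h, e⟩]
  induction P with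
  | nil => intro f x; simp [subst, fn]
  | par P Q hP hQ =>
    intro f x
    simp only [subst, fn, Set.mem_union, hP, hQ]
    constructor
    · rintro (⟨y, h, e⟩ | ⟨y, h, e⟩)
      exacts [⟨y, Or.inl h, e⟩, ⟨y, Or.inr h, e⟩]
    · rintro ⟨y, h | h, e⟩
      exacts [Or.inl ⟨y, h, e⟩, Or.inr ⟨y, h, e⟩]
  | rep P hP => intro f x; simpa [subst, fn] using hP f x
  | nuB P hP =>
    intro f x
    simp only [subst, fn, Set.mem_ofPred_eq, hP]
    exact key 1 P.fn f x
  | caseB p P hP =>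
    intro f x
    have ha : (p.subst f).arity = p.arity := by simp [PatternOf.arity, PatternOf.bnList_subst]
    simp only [subst, fn, Set.mem_ofPred_eq, hP, Set.mem_union, Finset.mem_coe, ha, hpat, key]
    constructor
    · rintro (⟨y, h, e⟩ | ⟨y, h, e⟩)
      exacts [⟨y, Or.inl h, e⟩, ⟨y, Or.inr h, e⟩]
    · rintro ⟨y, h | h, e⟩
      exacts [Or.inl ⟨y, h, e⟩, Or.inr ⟨y, h, e⟩]

theorem subst_congr (P : Proc) : ∀ f g : ℕ → Comm, (∀ x ∈ P.fn, f x = g x) →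
    P.subst f = P.subst g := by
  have key : ∀ (k : ℕ) (s : Set ℕ) (f g : ℕ → Comm),
      (∀ x ∈ {x | x + k ∈ s}, f x = g x) → ∀ x ∈ s, upSubst k f x = upSubst k g x := by
    intro k s f g h x hx
    unfold upSubst
    by_cases hk : x < k
    · simp [hk]
    · have : x - k + k = x := by omega
      simp [hk, h (x - k) (by simpa [this] using hx)]
  have hpat : ∀ {β : Type} (p : PatternOf β) (f g : ℕ → Comm), (∀ x ∈ p.fn, f x = g x) →
      p.subst f = p.subst g := by
    intro β p f g h
    induction p with
    | lam b => rfl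
    | var x => simp [PatternOf.subst, h x (by simp [PatternOf.fn, PatternOf.vn])]
    | pro x => simp [PatternOf.subst, h x (by simp [PatternOf.fn, PatternOf.pn])]
    | comp p q hp hq =>
      simp only [PatternOf.subst]
      rw [hp (fun x hx => h x ((PatternOf.mem_fn_comp p q x).2 (Or.inl hx))),
        hq (fun x hx => h x ((PatternOf.mem_fn_comp p q x).2 (Or.inr hx)))]
  induction P with
  | nil => intros; rfl
  | par P Q hP hQ =>
    intro f g h
    simp only [subst]
    rw [hP f g (fun x hx => h x (Or.inl hx)), hQ f g (fun x hx => h x (Or.inr hx))]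
  | rep P hP => intro f g h; simp only [subst]; rw [hP f g h]
  | nuB P hP =>
    intro f g h; simp only [subst]; rw [hP _ _ (key 1 P.fn f g h)]
  | caseB p P hP =>
    intro f g h; simp only [subst]
    rw [hP _ _ (key p.arity P.fn f g (fun x hx => h x (Or.inr hx))),
      hpat p f g (fun x hx => h x (Or.inl hx))]

end Proc

/-! ### Conjugation of substitutions and invariance of transitions -/

namespace Subst

/-- The conjugate of a substitution by a permutation of the names. -/
def conj (f : Equiv.Perm ℕ) (σ : Subst) : Subst := fun x => (σ (f.symm x)).map (Comm.ren f)

theorem conj_single (f : Equiv.Perm ℕ) (x : ℕ) (M : Comm) :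
    (single x M).conj f = single (f x) (M.ren f) := by
  funext y
  unfold conj single
  by_cases h : y = f x
  · simp [h]
  · simp [h, Equiv.symm_apply_eq]

theorem conj_union (f : Equiv.Perm ℕ) (σ ρ : Subst) :
    (σ.union ρ).conj f = (σ.conj f).union (ρ.conj f) := by
  funext y
  unfold conj union
  dsimp only
  cases σ (f.symm y) <;> simp

theorem act_conj (f : Equiv.Perm ℕ) (σ : Subst) (x : ℕ) :
    (σ.conj f).act (f x) = (σ.act x).ren f := by
  unfold conj act
  dsimp only
  rw [f.symm_apply_apply]
  cases σ x <;> simp [Comm.ren]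

theorem app_ren (f : Equiv.Perm ℕ) (σ : Subst) (P : Proc) :
    (σ.app P).ren f = (σ.conj f).app (P.ren f) := by
  simp only [app, Proc.ren_subst, Proc.subst_ren, act_conj]

theorem mem_dom_conj (f : Equiv.Perm ℕ) (σ : Subst) (x : ℕ) :
    f x ∈ (σ.conj f).dom ↔ x ∈ σ.dom := by
  simp [dom, conj]

theorem mem_dom (σ : Subst) (x : ℕ) : x ∈ σ.dom ↔ ∃ M, σ x = some M := Iff.rfl

theorem eq_none_of_notMem_dom {σ : Subst} {x : ℕ} (h : x ∉ σ.dom) : σ x = none := by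
  cases e : σ x with
  | none => rfl
  | some M => exact absurd ⟨M, e⟩ h

theorem act_of_notMem_dom {σ : Subst} {x : ℕ} (h : x ∉ σ.dom) : σ.act x = .name x := by
  simp [act, eq_none_of_notMem_dom h]

theorem fn_act_subset {σ : Subst} {x y : ℕ} (h : x ∈ σ.dom) (hy : y ∈ (σ.act x).fn) :
    y ∈ σ.fn := by
  obtain ⟨M, hM⟩ := h
  exact ⟨x, M, hM, by simpa [act, hM] using hy⟩

theorem mem_fn_iff {σ : Subst} {y : ℕ} : y ∈ σ.fn ↔ ∃ x ∈ σ.dom, y ∈ (σ.act x).fn := by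
  constructor
  · rintro ⟨x, M, hM, hy⟩
    exact ⟨x, ⟨M, hM⟩, by simpa [act, hM] using hy⟩
  · rintro ⟨x, hx, hy⟩
    exact fn_act_subset hx hy

theorem app_eq_self {σ : Subst} {P : Proc} (h : ∀ x ∈ P.fn, x ∉ σ.dom) : σ.app P = P := by
  rw [app, P.subst_congr σ.act (fun i => .name i) (fun x hx => act_of_notMem_dom (h x hx)),
    Proc.subst_name P (fun i => i), Proc.ren_id]

theorem mem_fn_app {σ : Subst} {P : Proc} {x : ℕ} (h : x ∈ (σ.app P).fn) :
    (x ∈ P.fn ∧ x ∉ σ.dom) ∨ x ∈ σ.fn := by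
  obtain ⟨y, hy, hx⟩ := (Proc.mem_fn_subst P _ x).1 h
  by_cases hd : y ∈ σ.dom
  · exact Or.inr (fn_act_subset hd hx)
  · rw [act_of_notMem_dom hd, Comm.fn, Finset.mem_singleton] at hx
    exact Or.inl (hx ▸ ⟨hy, hd⟩)

end Subst

theorem Comm.toPat_perm (f : ℕ → ℕ) (M : Comm) : (M.toPat : Pattern).perm f = (M.ren f).toPat := by
  induction M <;> simp_all [toPat, ren, PatternOf.perm, PatternOf.ren, PatternOf.mapLam]

theorem Unify.perm {p q : Pattern} {σ ρ : Subst} (f : Equiv.Perm ℕ) (h : Unify p q σ ρ) :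
    Unify (p.perm f) (q.perm f) (σ.conj f) (ρ.conj f) := by
  induction h with
  | var_var x => exact .var_var (f x)
  | var_pro x => exact .var_pro (f x)
  | pro_var x => exact .pro_var (f x)
  | pro_pro x => exact .pro_pro (f x)
  | lam_left x M =>
    rw [Subst.conj_single, Comm.toPat_perm]; exact .lam_left (f x) (M.ren f)
  | lam_right x M =>
    rw [Subst.conj_single, Comm.toPat_perm]; exact .lam_right (f x) (M.ren f)
  | comp p₁ p₂ q₁ q₂ σ₁ σ₂ ρ₁ ρ₂ _ _ h₁ h₂ =>
    rw [Subst.conj_union, Subst.conj_union]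
    exact .comp _ _ _ _ _ _ _ _ h₁ h₂

/-- Renaming of the names of a label. -/
def Label.perm (f : ℕ → ℕ) : Label → Label
  | tau => tau
  | out ns p => out (ns.image f) (p.perm f)

theorem Label.names_perm (f : ℕ → ℕ) (μ : Label) : (μ.perm f).names = μ.names.image f := by
  cases μ <;> simp [perm, names, PatternOf.fn_perm, PatternOf.bn_perm, Finset.image_union]

/-- Transitions are invariant under permutations of the names. -/
theorem Step.perm {P P' : Proc} {μ : Label} (f : Equiv.Perm ℕ) (h : Step P μ P') :
    Step (P.ren f) (μ.perm f) (P'.ren f) := by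
  have hfn : ∀ {ns : Finset ℕ} {Q : Proc}, (∀ x ∈ ns, x ∉ Q.fn) →
      ∀ x ∈ ns.image f, x ∉ (Q.ren f).fn := by
    intro ns Q h x hx hx'
    obtain ⟨y, hy, rfl⟩ := Finset.mem_image.1 hx
    obtain ⟨z, hz, e⟩ := (Proc.mem_fn_ren _ _ _).1 hx'
    exact h y hy (f.injective e ▸ hz)
  induction h with
  | caseOf p P hp => rw [Proc.caseOf_ren]; exact .caseOf _ _ (hp.perm f)
  | resnon n P P' μ hn _ ih =>
    rw [Proc.res_ren, Proc.res_ren]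
    refine .resnon _ _ _ _ ?_ ih
    rw [Label.names_perm, Finset.mem_image]
    rintro ⟨y, hy, e⟩
    exact hn (f.injective e ▸ hy)
  | opn m P P' ns p hm hm' _ ih =>
    rw [Proc.res_ren]
    have := Step.opn (f m) _ _ (ns.image f) (p.perm f) ?_ ?_ ih
    · rwa [← Finset.image_insert] at this
    · rw [PatternOf.vn_perm]; exact Finset.mem_image_of_mem _ hm
    · rw [PatternOf.pn_perm, PatternOf.bn_perm, ← Finset.image_union, ← Finset.image_union,
        Finset.mem_image]
      rintro ⟨y, hy, e⟩
      exact hm' (f.injective e ▸ hy)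
  | unify P P' Q Q' ms ns p q σ ρ l hu hm hn hd hl hl' _ _ ihP ihQ =>
    rw [Proc.resList_ren, Proc.ren, Proc.ren, Subst.app_ren, Subst.app_ren]
    refine .unify _ _ _ _ _ _ _ _ _ _ _ (hu.perm f) (hfn hm) (hfn hn) ?_ ?_ ?_ ihP ihQ
    · exact (Finset.disjoint_image f.injective).2 hd
    · exact hl.map f.injective
    · rw [← Finset.image_union, ← hl']; ext; simp
  | parintL P P' Q _ ih => exact .parintL _ _ _ ih
  | parintR P Q Q' _ ih => exact .parintR _ _ _ ih
  | parextL P P' Q ns p h _ ih =>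
    refine .parextL _ _ _ _ _ ?_ ih
    rw [PatternOf.bn_perm, ← Finset.image_union]; exact hfn h
  | parextR P Q Q' ns p h _ ih =>
    refine .parextR _ _ _ _ _ ?_ ih
    rw [PatternOf.bn_perm, ← Finset.image_union]; exact hfn h
  | rep P P' μ _ ih => exact .rep _ _ _ ih

/-! ### Names of transitions -/

theorem Comm.fn_toPat {β : Type} (M : Comm) : (M.toPat : PatternOf β).fn = M.fn := by
  ext x
  induction M with
  | name z => simp [toPat, PatternOf.fn, PatternOf.vn, PatternOf.pn, fn]
  | comp M N hM hN => simp [toPat, PatternOf.mem_fn_comp, fn, hM, hN]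

theorem Subst.mem_fn_union {σ ρ : Subst} {x : ℕ} (h : x ∈ (σ.union ρ).fn) :
    x ∈ σ.fn ∨ x ∈ ρ.fn := by
  obtain ⟨y, M, hM, hx⟩ := h
  unfold Subst.union at hM
  cases e : σ y with
  | none => exact Or.inr ⟨y, M, by simpa [e] using hM, hx⟩
  | some N =>
    have : N = M := by simpa [e] using hM
    exact Or.inl ⟨y, M, by rw [e, this], hx⟩

theorem Subst.dom_union (σ ρ : Subst) : (σ.union ρ).dom = σ.dom ∪ ρ.dom := by
  ext x
  simp only [mem_dom, union, Set.mem_union]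
  cases σ x <;> simp

theorem Subst.dom_single (x : ℕ) (M : Comm) : (single x M).dom = {x} := by
  ext y; by_cases h : y = x <;> simp [dom, single, h]

theorem Subst.dom_empty : empty.dom = ∅ := by ext y; simp [dom, empty]

theorem Subst.fn_empty : empty.fn = ∅ := by ext y; simp [fn, empty]

theorem Subst.mem_fn_single {x y : ℕ} {M : Comm} (h : y ∈ (single x M).fn) : y ∈ M.fn := by
  obtain ⟨z, N, e, hy⟩ := h
  unfold single at e
  split_ifs at e
  cases e; exact hy

theorem PatternOf.bn_comp (p q : Pattern) : (p.comp q).bn = p.bn ∪ q.bn := by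
  ext x; simp [mem_bn, bnList]

theorem PatternOf.bn_toPat (M : Comm) : (M.toPat : Pattern).bn = ∅ := by
  induction M with
  | name x => rfl
  | comp M N hM hN => rw [Comm.toPat, bn_comp, hM, hN]; rfl

theorem Unify.symm {p q : Pattern} {σ ρ : Subst} (h : Unify p q σ ρ) : Unify q p ρ σ := by
  induction h with
  | var_var x => exact .var_var x
  | var_pro x => exact .pro_var x
  | pro_var x => exact .var_pro x
  | pro_pro x => exact .pro_pro x
  | lam_left x M => exact .lam_right x M
  | lam_right x M => exact .lam_left x M
  | comp _ _ _ _ _ _ _ _ _ _ h₁ h₂ => exact .comp _ _ _ _ _ _ _ _ h₁ h₂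

theorem Unify.isMatch {p q : Pattern} {σ ρ : Subst} (h : Unify p q σ ρ) : IsMatch p σ := by
  unfold IsMatch
  induction h with
  | lam_left x M => rw [Subst.dom_single]; simp [PatternOf.bn, PatternOf.bnList]
  | lam_right x M => rw [Subst.dom_empty, PatternOf.bn_toPat]; simp
  | comp _ _ _ _ _ _ _ _ _ _ h₁ h₂ => rw [Subst.dom_union, PatternOf.bn_comp, h₁, h₂]; simp
  | _ => rw [Subst.dom_empty]; simp [PatternOf.bn, PatternOf.bnList]

theorem Unify.fn_subset {p q : Pattern} {σ ρ : Subst} (h : Unify p q σ ρ) {x : ℕ}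
    (hx : x ∈ σ.fn) : x ∈ q.fn := by
  induction h with
  | lam_left y M => rw [Comm.fn_toPat]; exact Subst.mem_fn_single hx
  | comp _ _ _ _ _ _ _ _ _ _ h₁ h₂ =>
    rw [PatternOf.mem_fn_comp]
    exact (Subst.mem_fn_union hx).imp h₁ h₂
  | _ => rw [Subst.fn_empty] at hx; exact absurd hx (Set.notMem_empty x)

theorem Step.wf {P P' : Proc} {ns : Finset ℕ} {p : Pattern} (h : Step P (.out ns p) P') :
    p.WF := by
  generalize e : Label.out ns p = μ at h
  induction h generalizing ns with
  | caseOf p P hp => cases e; exact hp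
  | opn m P P' ns p hm hm' _ ih => cases e; exact ih rfl
  | unify => cases e
  | parintL => cases e
  | parintR => cases e
  | resnon n P P' μ hn _ ih => exact ih e
  | parextL P P' Q ns p h _ ih => exact ih e
  | parextR P Q Q' ns p h _ ih => exact ih e
  | rep P P' μ _ ih => exact ih e

/-- Freshness for the source is automatic: it comes from well-formedness at a case, from the
restriction at an opening, and from the side conditions at a parallel composition. -/
theorem Step.notMem_fn {P P' : Proc} {ns : Finset ℕ} {p : Pattern} (h : Step P (.out ns p) P') :
    ∀ x ∈ ns ∪ p.bn, x ∉ P.fn := by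
  generalize e : Label.out ns p = μ at h
  induction h generalizing ns with
  | caseOf p P hp =>
    cases e
    intro x hx
    rw [Proc.fn_caseOf]
    simp only [Finset.empty_union] at hx
    have := Finset.disjoint_left.1 hp.2 hx
    simp [hx, this]
  | resnon n P P' μ hn _ ih =>
    intro x hx
    rw [Proc.fn_res]
    exact fun h => ih e x hx h.1
  | opn m P P' ns p hm hm' _ ih =>
    cases e
    intro x hx
    rw [Proc.fn_res]
    rintro ⟨h1, h2⟩
    simp only [Finset.mem_union, Finset.mem_insert, Set.mem_singleton_iff] at hx h2
    exact ih rfl x (by simp only [Finset.mem_union]; tauto) h1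
  | unify => cases e
  | parintL => cases e
  | parintR => cases e
  | parextL P P' Q ns p h _ ih =>
    cases e
    intro x hx
    rintro (h1 | h1)
    exacts [ih rfl x hx h1, h x hx h1]
  | parextR P Q Q' ns p h _ ih =>
    cases e
    intro x hx
    rintro (h1 | h1)
    exacts [h x hx h1, ih rfl x hx h1]
  | rep P P' μ _ ih =>
    intro x hx hx'
    exact ih e x hx (Or.inl hx')

theorem Step.disjoint {P P' : Proc} {ns : Finset ℕ} {p : Pattern} (h : Step P (.out ns p) P') :
    ∀ x ∈ ns, x ∈ p.vn ∧ x ∉ p.pn ∧ x ∉ p.bn := by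
  generalize e : Label.out ns p = μ at h
  induction h generalizing ns with
  | caseOf p P hp => cases e; simp
  | opn m P P' ns p hm hm' _ ih =>
    cases e
    intro x hx
    simp only [Finset.mem_union, not_or] at hm'
    rcases Finset.mem_insert.1 hx with rfl | hx
    exacts [⟨hm, hm'.1.2, hm'.2⟩, ih rfl x hx]
  | unify => cases e
  | parintL => cases e
  | parintR => cases e
  | resnon n P P' μ hn _ ih => exact ih e
  | parextL P P' Q ns p h _ ih => exact ih e
  | parextR P Q Q' ns p h _ ih => exact ih e
  | rep P P' μ _ ih => exact ih e

theorem Step.fn_label {P P' : Proc} {ns : Finset ℕ} {p : Pattern} (h : Step P (.out ns p) P') :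
    ∀ x ∈ p.fn, x ∈ P.fn ∨ x ∈ ns := by
  generalize e : Label.out ns p = μ at h
  induction h generalizing ns with
  | caseOf p P hp =>
    cases e
    intro x hx
    rw [Proc.fn_caseOf]; exact Or.inl (Or.inl hx)
  | resnon n P P' μ hn _ ih =>
    subst e
    intro x hx
    rw [Proc.fn_res]
    refine (ih rfl x hx).imp_left fun h => ⟨h, ?_⟩
    rintro rfl
    simp [Label.names, hx] at hn
  | opn m P P' ns p hm hm' _ ih =>
    cases e
    intro x hx
    rw [Proc.fn_res]
    by_cases hxm : x = m
    · simp [hxm]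
    · have := ih rfl x hx
      simp only [Finset.mem_insert, Set.mem_sdiff, Set.mem_singleton_iff]; tauto
  | unify => cases e
  | parintL => cases e
  | parintR => cases e
  | parextL P P' Q ns p h _ ih => intro x hx; exact (ih e x hx).imp_left Or.inl
  | parextR P Q Q' ns p h _ ih => intro x hx; exact (ih e x hx).imp_left Or.inr
  | rep P P' μ _ ih => intro x hx; exact (ih e x hx).imp_left fun h => h.elim id id

/-- The names bound by a label in the target of a transition. -/
def Label.bound : Label → Finset ℕ
  | tau => ∅
  | out ns p => ns ∪ p.bn

/-- In a synchronisation the received names occur in the partner's label, so they are free in the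
partner or extruded by it; the extruded ones are restricted again by `l`. The binding names
disappear because they are the domain of the unifier. -/
theorem Step.fn_target {P P' : Proc} {μ : Label} (h : Step P μ P') :
    ∀ x ∈ P'.fn, x ∈ P.fn ∨ x ∈ μ.bound := by
  induction h with
  | caseOf p P hp =>
    intro x hx
    simp only [Label.bound, Proc.fn_caseOf, Set.mem_union, Set.mem_sdiff, Finset.mem_coe,
      Finset.mem_union, Finset.notMem_empty, false_or]
    tauto
  | resnon n P P' μ hn _ ih =>
    intro x hx
    rw [Proc.fn_res] at hx ⊢
    exact (ih x hx.1).imp_left fun h => ⟨h, hx.2⟩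
  | opn m P P' ns p hm hm' _ ih =>
    intro x hx
    have := ih x hx
    rw [Proc.fn_res]
    by_cases hxm : x = m
    · simp [Label.bound, hxm]
    · simp only [Label.bound, Finset.mem_insert, Finset.mem_union, Set.mem_sdiff,
        Set.mem_singleton_iff] at this ⊢
      tauto
  | unify P P' Q Q' ms ns p q σ ρ l hu hm hn hd hl hl' hP hQ ihP ihQ =>
    intro x hx
    refine Or.inl ?_
    rw [Proc.fn_resList] at hx
    obtain ⟨hx, hxl⟩ := hx
    have hxl : x ∉ ms ∪ ns := by rw [← hl']; simpa using hxl
    simp only [Finset.mem_union, not_or] at hxl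
    have aux : ∀ {P P' Q : Proc} {ms ns : Finset ℕ} {p q : Pattern} {σ ρ : Subst}
        (_ : Unify p q σ ρ) (_ : ∀ x ∈ P'.fn, x ∈ P.fn ∨ x ∈ (Label.out ms p).bound)
        (_ : ∀ x ∈ q.fn, x ∈ Q.fn ∨ x ∈ ns), x ∉ ms → x ∉ ns → x ∈ (σ.app P').fn →
        x ∈ P.fn ∨ x ∈ Q.fn := by
      intro P P' Q ms ns p q σ ρ hu ih hq hms hns hx
      rcases Subst.mem_fn_app hx with ⟨h, hd⟩ | h
      · rw [hu.isMatch] at hd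
        rcases ih x h with h | h
        · exact Or.inl h
        · simp only [Label.bound, Finset.mem_union] at h
          exact absurd (h.resolve_left hms) hd
      · exact Or.inr ((hq x (hu.fn_subset h)).resolve_right hns)
    rcases hx with hx | hx
    · exact aux hu ihP hQ.fn_label hxl.1 hxl.2 hx
    · exact (aux hu.symm ihQ hP.fn_label hxl.2 hxl.1 hx).symm
  | parintL P P' Q _ ih =>
    rintro x (hx | hx)
    exacts [(ih x hx).imp_left Or.inl, Or.inl (Or.inr hx)]
  | parintR P Q Q' _ ih =>
    rintro x (hx | hx)
    exacts [Or.inl (Or.inl hx), (ih x hx).imp_left Or.inr]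
  | parextL P P' Q ns p h _ ih =>
    rintro x (hx | hx)
    exacts [(ih x hx).imp_left Or.inl, Or.inl (Or.inr hx)]
  | parextR P Q Q' ns p h _ ih =>
    rintro x (hx | hx)
    exacts [Or.inl (Or.inl hx), (ih x hx).imp_left Or.inr]
  | rep P P' μ _ ih => intro x hx; exact (ih x hx).imp_left fun h => h.elim id id

/-! ### Choice of fresh names -/

/-- A permutation that moves a given finite set of names away from a second one, and fixes the
other names of the second set. -/
theorem exists_fresh_perm (X s : Finset ℕ) : ∃ f : Equiv.Perm ℕ,
    (∀ x ∈ X, f x ∉ s ∧ f x ∉ X) ∧ ∀ x ∈ s, x ∉ X → f x = x := by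
  obtain ⟨m, hm⟩ := (X ∪ s).bddAbove
  have hX : ∀ x ∈ X, x ≤ m := fun x hx => hm (by simp [hx])
  have hs : ∀ x ∈ s, x ≤ m := fun x hx => hm (by simp [hx])
  -- The involution exchanges each `x ∈ X` with `x + (m + 1)`, which lies above both sets.
  let g : ℕ → ℕ := fun x => if x ∈ X then x + (m + 1) else
    if m + 1 ≤ x ∧ x - (m + 1) ∈ X then x - (m + 1) else x
  have hg : ∀ x, g (g x) = x := by
    intro x
    by_cases h1 : x ∈ X
    · have : x + (m + 1) ∉ X := fun h => by have := hX _ h; omega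
      simp [g, h1, this]; omega
    · by_cases h2 : m + 1 ≤ x ∧ x - (m + 1) ∈ X
      · have : x - (m + 1) + (m + 1) = x := by omega
        simp only [g, h1, h2, if_false, and_self, if_true, this]
      · simp only [g, h1, h2, if_false]
  refine ⟨⟨g, g, hg, hg⟩, ?_, ?_⟩
  · intro x hx
    have e : g x = x + (m + 1) := by simp [g, hx]
    simp only [Equiv.coe_fn_mk, e]
    exact ⟨fun h => by have := hs _ h; omega, fun h => by have := hX _ h; omega⟩
  · intro x hx hx'
    have := hs x hx
    have : ¬(m + 1 ≤ x ∧ x - (m + 1) ∈ X) := by omega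
    simp only [Equiv.coe_fn_mk, g, hx', this, if_false]

/-! ### Instantiated patterns

The instance of a pattern `p` under a match `σ` is `p.mapLam σ.act`: each binding name is replaced
by the communicable pattern which it receives. -/

namespace PatternOf

/-- The names of the communicable patterns at the binding positions. -/
def tfn : PatternOf Comm → Finset ℕ
  | lam M => M.fn
  | var _ => ∅
  | pro _ => ∅
  | comp p q => p.tfn ∪ q.tfn

/-- Renaming of all names of an instantiated pattern. -/
def iren (f : ℕ → ℕ) (π : PatternOf Comm) : PatternOf Comm := (π.ren f).mapLam (Comm.ren f)

theorem mem_tfn_mapLam {p : Pattern} {σ : Subst} (h : IsMatch p σ) (x : ℕ) :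
    x ∈ (p.mapLam σ.act).tfn ↔ x ∈ σ.fn := by
  have key : ∀ p : Pattern, x ∈ (p.mapLam σ.act).tfn ↔ ∃ b ∈ p.bnList, x ∈ (σ.act b).fn := by
    intro p
    induction p with
    | lam b => simp [mapLam, tfn, bnList]
    | var z => simp [mapLam, tfn, bnList]
    | pro z => simp [mapLam, tfn, bnList]
    | comp p q hp hq => simp [mapLam, tfn, bnList, hp, hq, or_and_right, exists_or]
  rw [key, Subst.mem_fn_iff, h]
  simp [bn]

theorem iren_mapLam {p : Pattern} (f : Equiv.Perm ℕ) (σ : Subst) :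
    (p.mapLam σ.act).iren f = (p.perm f).mapLam (σ.conj f).act := by
  rw [iren, perm, ren_mapLam, mapLam_mapLam, mapLam_mapLam]
  simp only [Subst.act_conj]

theorem iren_eq_self (f : ℕ → ℕ) (π : PatternOf Comm) (h : ∀ x ∈ π.fn, f x = x)
    (h' : ∀ x ∈ π.tfn, f x = x) : π.iren f = π := by
  have hc : ∀ M : Comm, (∀ x ∈ M.fn, f x = x) → M.ren f = M := by
    intro M hM
    induction M with
    | name x => simp [Comm.ren, hM x (by simp [Comm.fn])]
    | comp M N h1 h2 =>
      simp only [Comm.ren]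
      rw [h1 fun x hx => hM x (by simp [Comm.fn, hx]), h2 fun x hx => hM x (by simp [Comm.fn, hx])]
  induction π with
  | lam M => simp [iren, ren, mapLam, hc M h']
  | var x => simp [iren, ren, mapLam, h x (by simp [fn, vn])]
  | pro x => simp [iren, ren, mapLam, h x (by simp [fn, pn])]
  | comp p q hp hq =>
    have h1 := hp (fun x hx => h x ((mem_fn_comp p q x).2 (Or.inl hx)))
      (fun x hx => h' x (by simp [tfn, hx]))
    have h2 := hq (fun x hx => h x ((mem_fn_comp p q x).2 (Or.inr hx)))
      (fun x hx => h' x (by simp [tfn, hx]))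
    simp only [iren, ren, mapLam] at h1 h2 ⊢
    rw [h1, h2]

theorem iren_iren (f g : ℕ → ℕ) (π : PatternOf Comm) :
    (π.iren f).iren g = π.iren (fun i => g (f i)) := by
  simp only [iren, ren_mapLam, mapLam_mapLam, ren_ren, Comm.ren_ren]

end PatternOf

/-! ### Compatibility and unification of instances -/

/-- `IsVal π M`: the pattern `π` has binding atoms only, and it is instantiated to `M`. -/
def IsVal : PatternOf Comm → Comm → Prop
  | .lam N, M => N = M
  | .comp p q, .comp M N => IsVal p M ∧ IsVal q N
  | _, _ => False

/-- Compatibility of instantiated patterns. -/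
inductive CompatN : PatternOf Comm → PatternOf Comm → Prop
  | lam (π : PatternOf Comm) (M : Comm) (h : IsVal π M) : CompatN π (.lam M)
  | var_var (n : ℕ) : CompatN (.var n) (.var n)
  | pro_pro (n : ℕ) : CompatN (.pro n) (.pro n)
  | pro_var (n : ℕ) : CompatN (.pro n) (.var n)
  | comp (π₁ π₂ θ₁ θ₂ : PatternOf Comm) : CompatN π₁ θ₁ → CompatN π₂ θ₂ →
      CompatN (.comp π₁ π₂) (.comp θ₁ θ₂)

/-- Unification of instantiated patterns. -/
inductive UnifyN : PatternOf Comm → PatternOf Comm → Prop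
  | var_var (x : ℕ) : UnifyN (.var x) (.var x)
  | var_pro (x : ℕ) : UnifyN (.var x) (.pro x)
  | pro_var (x : ℕ) : UnifyN (.pro x) (.var x)
  | pro_pro (x : ℕ) : UnifyN (.pro x) (.pro x)
  | lam_left (M : Comm) (θ : PatternOf Comm) (h : θ = M.toPat) : UnifyN (.lam M) θ
  | lam_right (M : Comm) (θ : PatternOf Comm) (h : θ = M.toPat) : UnifyN θ (.lam M)
  | comp (π₁ π₂ θ₁ θ₂ : PatternOf Comm) : UnifyN π₁ θ₁ → UnifyN π₂ θ₂ →
      UnifyN (.comp π₁ π₂) (.comp θ₁ θ₂)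

theorem not_isVal_toPat (M N : Comm) : ¬ IsVal M.toPat N := by
  induction M generalizing N with
  | name x => cases N <;> simp [Comm.toPat, IsVal]
  | comp M M' h _ =>
    cases N with
    | name x => simp [Comm.toPat, IsVal]
    | comp N N' => exact fun h' => h N h'.1

theorem CompatN.refl (π : PatternOf Comm) : CompatN π π := by
  induction π with
  | lam M => exact .lam _ _ rfl
  | var x => exact .var_var x
  | pro x => exact .pro_pro x
  | comp p q hp hq => exact .comp _ _ _ _ hp hq

theorem CompatN.isVal {π θ : PatternOf Comm} (h : CompatN π θ) {M : Comm} (hθ : IsVal θ M) :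
    IsVal π M := by
  induction h generalizing M with
  | lam π N h => cases hθ; exact h
  | var_var n => cases M <;> exact hθ
  | pro_pro n => cases M <;> exact hθ
  | pro_var n => cases M <;> exact hθ
  | comp _ _ _ _ _ _ h₁ h₂ =>
    cases M with
    | name x => exact hθ
    | comp M N => exact ⟨h₁ hθ.1, h₂ hθ.2⟩

/-- If the last pattern is a single binder, the middle one consists of binders only, and by
`CompatN.isVal` so does the first, with the same value. Transitivity is what lets simulations
compose. -/
theorem CompatN.trans {π θ ξ : PatternOf Comm} (h : CompatN π θ) (h' : CompatN θ ξ) :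
    CompatN π ξ := by
  induction h' generalizing π with
  | lam θ M hM => exact .lam _ _ (h.isVal hM)
  | var_var n => exact h
  | pro_pro n => exact h
  | pro_var n => cases h; exact .pro_var n
  | comp _ _ _ _ _ _ h₁ h₂ =>
    cases h with
    | comp _ _ _ _ k₁ k₂ => exact .comp _ _ _ _ (h₁ k₁) (h₂ k₂)

theorem UnifyN.symm {π θ : PatternOf Comm} (h : UnifyN π θ) : UnifyN θ π := by
  induction h with
  | var_var x => exact .var_var x
  | var_pro x => exact .pro_var x
  | pro_var x => exact .var_pro x
  | pro_pro x => exact .pro_pro x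
  | lam_left M θ h => exact .lam_right M θ h
  | lam_right M θ h => exact .lam_left M θ h
  | comp _ _ _ _ _ _ h₁ h₂ => exact .comp _ _ _ _ h₁ h₂

/-- Two binders never unify, so each binder of `π` faces exactly the communicable pattern that it
receives. -/
theorem UnifyN.eq_toPat {π θ : PatternOf Comm} (h : UnifyN π θ) {M : Comm} (hπ : IsVal π M) :
    θ = M.toPat := by
  induction h generalizing M with
  | lam_left N θ h => cases hπ; exact h
  | lam_right N θ h => subst h; exact absurd hπ (not_isVal_toPat N M)
  | comp _ _ _ _ _ _ h₁ h₂ =>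
    cases M with
    | name x => exact hπ.elim
    | comp M N => rw [h₁ hπ.1, h₂ hπ.2]; rfl
  | _ => cases M <;> exact hπ.elim

/-- A communicable pattern has variables at all leaves. The rule for a binder needs binders on its
left, and the rule from protected to variable needs a protected name, so neither applies. -/
theorem CompatN.eq_of_toPat {π θ : PatternOf Comm} (h : CompatN π θ) {M : Comm}
    (hπ : π = M.toPat) : θ = M.toPat := by
  induction h generalizing M with
  | lam π N h => subst hπ; exact absurd h (not_isVal_toPat M N)
  | comp _ _ _ _ _ _ h₁ h₂ =>
    cases M with
    | name x => cases hπ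
    | comp M N => cases hπ; rw [h₁ rfl, h₂ rfl]; rfl
  | var_var n => exact hπ
  | pro_pro n => exact hπ
  | pro_var n => cases M <;> cases hπ

/-- A compatible pattern unifies with at least as many patterns. -/
theorem CompatN.unifyN {π θ ξ : PatternOf Comm} (h : CompatN π θ) (hu : UnifyN π ξ) :
    UnifyN θ ξ := by
  induction h generalizing ξ with
  | lam π M h => exact .lam_left _ _ (hu.eq_toPat h)
  | var_var n => exact hu
  | pro_pro n => exact hu
  | pro_var n =>
    cases hu with
    | pro_var => exact .var_var n
    | pro_pro => exact .var_pro n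
    -- A protected name is not communicable, so no binder of the partner can receive it.
    | lam_right M _ h => cases M <;> cases h
  | comp π₁ π₂ θ₁ θ₂ k₁ k₂ h₁ h₂ =>
    cases hu with
    | comp _ _ _ _ u₁ u₂ => exact .comp _ _ _ _ (h₁ u₁) (h₂ u₂)
    | lam_right M _ h => exact .lam_right _ _ ((CompatN.comp _ _ _ _ k₁ k₂).eq_of_toPat h)

theorem Comm.iren_toPat (f : ℕ → ℕ) (M : Comm) :
    (M.toPat : PatternOf Comm).iren f = (M.ren f).toPat := by
  induction M <;> simp_all [toPat, ren, PatternOf.iren, PatternOf.ren, PatternOf.mapLam]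

theorem UnifyN.iren {π θ : PatternOf Comm} (h : UnifyN π θ) (f : ℕ → ℕ) :
    UnifyN (π.iren f) (θ.iren f) := by
  induction h with
  | var_var x => exact .var_var _
  | var_pro x => exact .var_pro _
  | pro_var x => exact .pro_var _
  | pro_pro x => exact .pro_pro _
  | lam_left M θ h => exact .lam_left _ _ (by rw [h, Comm.iren_toPat])
  | lam_right M θ h => exact .lam_right _ _ (by rw [h, Comm.iren_toPat])
  | comp _ _ _ _ _ _ h₁ h₂ => exact .comp _ _ _ _ h₁ h₂

theorem IsVal.fn {π : PatternOf Comm} {M : Comm} (h : IsVal π M) : π.fn = ∅ ∧ π.tfn = M.fn := by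
  induction π generalizing M with
  | lam N => cases h; exact ⟨rfl, rfl⟩
  | var x => cases M <;> exact h.elim
  | pro x => cases M <;> exact h.elim
  | comp p q hp hq =>
    cases M with
    | name x => exact h.elim
    | comp M N =>
      obtain ⟨h1, h2⟩ := hp h.1
      obtain ⟨h3, h4⟩ := hq h.2
      refine ⟨?_, by rw [PatternOf.tfn, h2, h4, Comm.fn]⟩
      ext x
      rw [PatternOf.mem_fn_comp, h1, h3]; simp

/-- The received names do not grow, so the answering match avoids every extruded name that the
original match avoids. -/
theorem CompatN.tfn {π θ : PatternOf Comm} (h : CompatN π θ) : θ.tfn ⊆ π.tfn := by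
  induction h with
  | lam π M h => rw [h.fn.2]; rfl
  | comp _ _ _ _ _ _ h₁ h₂ => exact Finset.union_subset_union h₁ h₂
  | _ => rfl

theorem CompatN.iren {π θ : PatternOf Comm} (h : CompatN π θ) (f : ℕ → ℕ) :
    CompatN (π.iren f) (θ.iren f) := by
  have hv : ∀ (π : PatternOf Comm) (M : Comm), IsVal π M → IsVal (π.iren f) (M.ren f) := by
    intro π
    induction π with
    | lam N => intro M h; exact congrArg _ h
    | var x => intro M h; cases M <;> exact h.elim
    | pro x => intro M h; cases M <;> exact h.elim
    | comp p q hp hq =>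
      intro M h
      cases M with
      | name x => exact h.elim
      | comp M N => exact ⟨hp _ h.1, hq _ h.2⟩
  induction h with
  | lam π M h => exact .lam _ _ (hv π M h)
  | var_var x => exact .var_var _
  | pro_var x => exact .pro_var _
  | pro_pro x => exact .pro_pro _
  | comp _ _ _ _ _ _ h₁ h₂ => exact .comp _ _ _ _ h₁ h₂

theorem UnifyN.tfn_subset {π θ : PatternOf Comm} (h : UnifyN π θ) : π.tfn ⊆ θ.fn := by
  induction h with
  | lam_left M θ h => subst h; rw [Comm.fn_toPat]; rfl
  | lam_right M θ h =>
    subst h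
    have : ∀ M : Comm, (M.toPat : PatternOf Comm).tfn = ∅ := by
      intro M; induction M <;> simp_all [Comm.toPat, PatternOf.tfn]
    simp [this]
  | comp _ _ _ _ _ _ h₁ h₂ =>
    intro x hx
    rw [PatternOf.mem_fn_comp]
    exact (Finset.mem_union.1 hx).imp (fun h => h₁ h) (fun h => h₂ h)
  | _ => exact Finset.empty_subset _

/-- A protected name must meet the same name on the other side, since it cannot be received. Hence a
name unknown to the partner can occur in a synchronising label only as a variable, which is the
condition for opening its scope. -/
theorem UnifyN.pn_subset {π θ : PatternOf Comm} (h : UnifyN π θ) : π.pn ⊆ θ.fn := by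
  induction h with
  | lam_left M θ h => exact Finset.empty_subset _
  | lam_right M θ h =>
    subst h
    have : ∀ M : Comm, (M.toPat : PatternOf Comm).pn = ∅ := by
      intro M; induction M <;> simp_all [Comm.toPat, PatternOf.pn]
    simp [this]
  | comp _ _ _ _ _ _ h₁ h₂ =>
    intro x hx
    rw [PatternOf.mem_fn_comp]
    exact (Finset.mem_union.1 hx).imp (fun h => h₁ h) (fun h => h₂ h)
  | _ => simp [PatternOf.pn, PatternOf.fn, PatternOf.vn]

/-! ### Matches and instances -/

namespace Subst

/-- The restriction of a substitution to a set of names. -/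
def restrict (σ : Subst) (X : Finset ℕ) : Subst := fun x => if x ∈ X then σ x else none

theorem act_restrict {σ : Subst} {X : Finset ℕ} {x : ℕ} (h : x ∈ X) :
    (σ.restrict X).act x = σ.act x := by
  simp [act, restrict, h]

theorem eq_empty {σ : Subst} (h : σ.dom = ∅) : σ = empty := by
  funext x
  exact eq_none_of_notMem_dom (by simp [h])

theorem eq_single {σ : Subst} {x : ℕ} (h : σ.dom = {x}) : σ = single x (σ.act x) := by
  funext y
  by_cases hy : y = x
  · subst hy
    have : y ∈ σ.dom := by simp [h]
    obtain ⟨M, hM⟩ := this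
    simp [single, act, hM]
  · have h0 : y ∉ σ.dom := by simpa [h] using hy
    rw [eq_none_of_notMem_dom h0]; simp [single, hy]

theorem act_union_left {σ ρ : Subst} {x : ℕ} (h : x ∈ σ.dom) :
    (σ.union ρ).act x = σ.act x := by
  obtain ⟨M, hM⟩ := h
  simp [act, union, hM]

theorem act_union_right {σ ρ : Subst} {x : ℕ} (h : x ∉ σ.dom) :
    (σ.union ρ).act x = ρ.act x := by
  simp [act, union, eq_none_of_notMem_dom h]

end Subst

theorem IsMatch.restrict_left {p q : Pattern} {σ : Subst} (h : IsMatch (p.comp q) σ) :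
    IsMatch p (σ.restrict p.bn) := by
  unfold IsMatch at h ⊢
  ext x
  have hx : x ∈ σ.dom ↔ x ∈ p.bn ∪ q.bn := by rw [h, PatternOf.bn_comp]; simp
  simp only [Subst.mem_dom, Subst.restrict, Finset.mem_coe] at hx ⊢
  by_cases hp : x ∈ p.bn
  · simpa [hp] using hx
  · simp [hp]

theorem IsMatch.restrict_right {p q : Pattern} {σ : Subst} (h : IsMatch (p.comp q) σ) :
    IsMatch q (σ.restrict q.bn) := by
  refine IsMatch.restrict_left (q := p) ?_
  rw [IsMatch, h, PatternOf.bn_comp, PatternOf.bn_comp, Finset.union_comm]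

theorem IsMatch.eq_union {p q : Pattern} {σ : Subst} (h : IsMatch (p.comp q) σ) :
    σ = (σ.restrict p.bn).union (σ.restrict q.bn) := by
  funext x
  have hx : x ∈ σ.dom ↔ x ∈ p.bn ∪ q.bn := by rw [h, PatternOf.bn_comp]; simp
  unfold Subst.union Subst.restrict
  by_cases hp : x ∈ p.bn
  · by_cases hq : x ∈ q.bn <;> simp [hp, hq]
  · by_cases hq : x ∈ q.bn
    · simp [hp, hq]
    · simp [hp, hq, Subst.eq_none_of_notMem_dom (fun h => by simp [hp, hq] at hx; exact hx h)]

theorem PatternOf.mapLam_restrict (p : Pattern) (σ : Subst) :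
    p.mapLam (σ.restrict p.bn).act = p.mapLam σ.act :=
  p.mapLam_congr _ _ fun _ hb => Subst.act_restrict (by simpa [bn] using hb)

/-- The union prefers its left member, so distinctness of the binding names is needed to keep `σ`
from overriding `ρ` on `q`. -/
theorem PatternOf.mapLam_union {p q : Pattern} {σ ρ : Subst} (hn : (p.comp q).bnList.Nodup)
    (hp : IsMatch p σ) :
    (p.comp q).mapLam (σ.union ρ).act = (p.mapLam σ.act).comp (q.mapLam ρ.act) := by
  rw [mapLam]
  congr 1
  · refine p.mapLam_congr _ _ fun b hb => Subst.act_union_left ?_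
    rw [hp]; simpa [bn] using hb
  · refine q.mapLam_congr _ _ fun b hb => Subst.act_union_right ?_
    rw [hp]
    simp only [bn, List.coe_toFinset, Set.mem_ofPred_eq]
    exact fun h => List.disjoint_of_nodup_append hn h hb

theorem Compat.isMatch {p q : Pattern} {σ ρ : Subst} (h : Compat p σ q ρ) :
    IsMatch p σ ∧ IsMatch q ρ := by
  unfold IsMatch
  induction h with
  | lam p σ y M hσ hp hM =>
    refine ⟨hσ, ?_⟩
    rw [Subst.dom_single]; simp [PatternOf.bn, PatternOf.bnList]
  | comp _ _ _ _ _ _ _ _ _ _ h₁ h₂ =>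
    simp [Subst.dom_union, PatternOf.bn_comp, h₁.1, h₁.2, h₂.1, h₂.2]
  | _ => simp [Subst.dom_empty, PatternOf.bn, PatternOf.bnList]

/-- This translates the side conditions of `Compat.lam`: without free names every atom of `p` is a
binder, and `σ̂ p` assembles the values that those binders receive. -/
theorem isVal_mapLam {p : Pattern} {σ : Subst} {M : Comm} (hd : ∀ x ∈ p.bnList, x ∈ σ.dom) :
    IsVal (p.mapLam σ.act) M ↔ p.fn = ∅ ∧ p.hat σ = M.toPat := by
  have hinj : ∀ M N : Comm, (M.toPat : Pattern) = N.toPat → M = N := by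
    intro M
    induction M with
    | name x => intro N h; cases N <;> simp_all [Comm.toPat]
    | comp M M' h₁ h₂ =>
      intro N h
      cases N with
      | name x => cases h
      | comp N N' =>
        simp only [Comm.toPat, PatternOf.comp.injEq] at h
        rw [h₁ _ h.1, h₂ _ h.2]
  induction p generalizing M with
  | lam b =>
    obtain ⟨N, hN⟩ := hd b (by simp [PatternOf.bnList])
    have h1 : σ.act b = N := by simp [Subst.act, hN]
    simp only [PatternOf.mapLam, IsVal, h1, PatternOf.hat, hN, PatternOf.fn, PatternOf.vn,
      PatternOf.pn, Finset.empty_union, true_and]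
    exact ⟨fun h => h ▸ rfl, hinj N M⟩
  | var x => cases M <;> simp [PatternOf.mapLam, IsVal, PatternOf.fn, PatternOf.vn]
  | pro x => cases M <;> simp [PatternOf.mapLam, IsVal, PatternOf.fn, PatternOf.pn]
  | comp p q hp hq =>
    have hf : (p.comp q).fn = ∅ ↔ p.fn = ∅ ∧ q.fn = ∅ := by
      simp only [Finset.eq_empty_iff_forall_notMem, PatternOf.mem_fn_comp, not_or, forall_and]
    rw [hf]
    cases M with
    | name x => simp [PatternOf.mapLam, IsVal, PatternOf.hat, Comm.toPat]
    | comp M N =>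
      simp only [PatternOf.mapLam, IsVal, PatternOf.hat, Comm.toPat, PatternOf.comp.injEq]
      have h1 := hp (M := M) fun x hx => hd x (by simp [PatternOf.bnList, hx])
      have h2 := hq (M := N) fun x hx => hd x (by simp [PatternOf.bnList, hx])
      tauto

theorem Compat.compatN {p q : Pattern} {σ ρ : Subst} (h : Compat p σ q ρ)
    (hp : p.bnList.Nodup) (hq : q.bnList.Nodup) :
    CompatN (p.mapLam σ.act) (q.mapLam ρ.act) := by
  induction h with
  | lam p σ y M hσ hf hM =>
    have : (Subst.single y M).act y = M := by simp [Subst.act, Subst.single]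
    rw [PatternOf.mapLam, this]
    exact .lam _ _ ((isVal_mapLam (fun x hx => by rw [hσ]; simpa [PatternOf.bn] using hx)).2
      ⟨hf, hM⟩)
  | var_var n => exact .var_var n
  | pro_pro n => exact .pro_pro n
  | pro_var n => exact .pro_var n
  | comp p₁ p₂ q₁ q₂ σ₁ σ₂ ρ₁ ρ₂ k₁ k₂ h₁ h₂ =>
    rw [PatternOf.mapLam_union hp k₁.isMatch.1, PatternOf.mapLam_union hq k₁.isMatch.2]
    exact .comp _ _ _ _ (h₁ hp.of_append_left hq.of_append_left)
      (h₂ hp.of_append_right hq.of_append_right)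

/-- In the compound case a match is the union of its restrictions to the two halves, whether or not
their binding names overlap; no distinctness is needed in this direction. -/
theorem CompatN.compat {p q : Pattern} {σ ρ : Subst} (h : CompatN (p.mapLam σ.act) (q.mapLam ρ.act))
    (hp : IsMatch p σ) (hq : IsMatch q ρ) : Compat p σ q ρ := by
  induction q generalizing p σ ρ with
  | lam y =>
    have hy : ρ = .single y (ρ.act y) := Subst.eq_single (hq.trans (by simp [PatternOf.bn, PatternOf.bnList]))
    rw [hy]
    generalize e : p.mapLam σ.act = π at h
    cases h with
    | lam _ _ h =>
      subst e
      have := (isVal_mapLam (fun x hx => by rw [hp]; simpa [PatternOf.bn] using hx)).1 h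
      exact .lam _ _ _ _ hp this.1 this.2
  | var n =>
    cases Subst.eq_empty (hq.trans (by simp [PatternOf.bn, PatternOf.bnList]))
    cases p with
    | var m =>
      cases Subst.eq_empty (hp.trans (by simp [PatternOf.bn, PatternOf.bnList]))
      cases h; exact .var_var n
    | pro m =>
      cases Subst.eq_empty (hp.trans (by simp [PatternOf.bn, PatternOf.bnList]))
      cases h; exact .pro_var n
    | lam b => cases h
    | comp p₁ p₂ => cases h
  | pro n =>
    cases Subst.eq_empty (hq.trans (by simp [PatternOf.bn, PatternOf.bnList]))
    cases p with
    | var m => cases h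
    | pro m =>
      cases Subst.eq_empty (hp.trans (by simp [PatternOf.bn, PatternOf.bnList]))
      cases h; exact .pro_pro n
    | lam b => cases h
    | comp p₁ p₂ => cases h
  | comp q₁ q₂ h₁ h₂ =>
    cases p with
    | var m => cases h
    | pro m => cases h
    | lam b => cases h
    | comp p₁ p₂ =>
      rw [hp.eq_union, hq.eq_union]
      simp only [PatternOf.mapLam] at h
      cases h with
      | comp _ _ _ _ k₁ k₂ =>
        refine .comp _ _ _ _ _ _ _ _ (h₁ ?_ hp.restrict_left hq.restrict_left)
          (h₂ ?_ hp.restrict_right hq.restrict_right)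
        · rwa [PatternOf.mapLam_restrict, PatternOf.mapLam_restrict]
        · rwa [PatternOf.mapLam_restrict, PatternOf.mapLam_restrict]

theorem Comm.mapLam_toPat {β γ : Type} (f : β → γ) (M : Comm) :
    (M.toPat : PatternOf β).mapLam f = M.toPat := by
  induction M <;> simp_all [toPat, PatternOf.mapLam]

theorem Unify.unifyN {p q : Pattern} {σ ρ : Subst} (h : Unify p q σ ρ)
    (hp : p.bnList.Nodup) (hq : q.bnList.Nodup) :
    UnifyN (p.mapLam σ.act) (q.mapLam ρ.act) := by
  have hs : ∀ (y : ℕ) (M : Comm), (Subst.single y M).act y = M := by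
    simp [Subst.act, Subst.single]
  induction h with
  | var_var x => exact .var_var x
  | var_pro x => exact .var_pro x
  | pro_var x => exact .pro_var x
  | pro_pro x => exact .pro_pro x
  | lam_left x M =>
    rw [PatternOf.mapLam, hs]; exact .lam_left _ _ (Comm.mapLam_toPat _ _)
  | lam_right x M =>
    rw [PatternOf.mapLam, hs]; exact .lam_right _ _ (Comm.mapLam_toPat _ _)
  | comp p₁ p₂ q₁ q₂ σ₁ σ₂ ρ₁ ρ₂ k₁ k₂ h₁ h₂ =>
    rw [PatternOf.mapLam_union hp k₁.isMatch, PatternOf.mapLam_union hq k₁.symm.isMatch]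
    exact .comp _ _ _ _ (h₁ hp.of_append_left hq.of_append_left)
      (h₂ hp.of_append_right hq.of_append_right)

theorem PatternOf.mapLam_eq_toPat {β γ : Type} {f : β → γ} {p : PatternOf β} {M : Comm}
    (h : p.mapLam f = M.toPat) : p = M.toPat := by
  induction p generalizing M with
  | lam b => cases M <;> cases h
  | var x => cases M <;> cases h; rfl
  | pro x => cases M <;> cases h
  | comp p q hp hq =>
    cases M with
    | name x => cases h
    | comp M N =>
      simp only [mapLam, Comm.toPat, comp.injEq] at h ⊢
      exact ⟨hp h.1, hq h.2⟩

theorem UnifyN.unify {p q : Pattern} {σ ρ : Subst} (h : UnifyN (p.mapLam σ.act) (q.mapLam ρ.act))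
    (hp : IsMatch p σ) (hq : IsMatch q ρ) : Unify p q σ ρ := by
  -- A binder on one side forces the instance on the other side to be communicable. The underlying
  -- pattern then has no binders, and its match is empty.
  have hl : ∀ {y : ℕ} {p : Pattern} {σ ρ : Subst}, p.mapLam σ.act = (ρ.act y).toPat →
      IsMatch p σ → IsMatch (.lam y) ρ → Unify p (.lam y) σ ρ := by
    intro y p σ ρ h hp hq
    have hy : ρ = .single y (ρ.act y) := Subst.eq_single (hq.trans (by simp [PatternOf.bn, PatternOf.bnList]))
    have := PatternOf.mapLam_eq_toPat h
    rw [hy, this, Subst.eq_empty (hp.trans (by simp [this, PatternOf.bn_toPat]))]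
    exact .lam_right _ _
  induction q generalizing p σ ρ with
  | lam y =>
    generalize e : p.mapLam σ.act = π at h
    cases h with
    | lam_right _ _ h => exact hl (e.trans h) hp hq
    | lam_left M _ h => cases M <;> cases h
  | comp q₁ q₂ h₁ h₂ =>
    cases p with
    | var m => cases h
    | pro m => cases h
    | lam b =>
      simp only [PatternOf.mapLam] at h
      cases h with
      | lam_left _ _ h => exact (hl (p := .comp q₁ q₂) h hq hp).symm
    | comp p₁ p₂ =>
      rw [hp.eq_union, hq.eq_union]
      simp only [PatternOf.mapLam] at h
      cases h with
      | comp _ _ _ _ k₁ k₂ =>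
        refine .comp _ _ _ _ _ _ _ _ (h₁ ?_ hp.restrict_left hq.restrict_left)
          (h₂ ?_ hp.restrict_right hq.restrict_right)
        · rwa [PatternOf.mapLam_restrict, PatternOf.mapLam_restrict]
        · rwa [PatternOf.mapLam_restrict, PatternOf.mapLam_restrict]
  | var n =>
    cases p with
    | lam b =>
      simp only [PatternOf.mapLam] at h
      cases h with
      | lam_left _ _ h => exact (hl (p := .var n) h hq hp).symm
    | comp p₁ p₂ => cases h
    | _ =>
      cases Subst.eq_empty (hp.trans (by simp [PatternOf.bn, PatternOf.bnList]))
      cases Subst.eq_empty (hq.trans (by simp [PatternOf.bn, PatternOf.bnList]))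
      simp only [PatternOf.mapLam] at h
      cases h
      constructor
  | pro n =>
    cases p with
    | lam b =>
      simp only [PatternOf.mapLam] at h
      cases h with
      | lam_left _ _ h => exact (hl (p := .pro n) h hq hp).symm
    | comp p₁ p₂ => cases h
    | _ =>
      cases Subst.eq_empty (hp.trans (by simp [PatternOf.bn, PatternOf.bnList]))
      cases Subst.eq_empty (hq.trans (by simp [PatternOf.bn, PatternOf.bnList]))
      simp only [PatternOf.mapLam] at h
      cases h
      constructor

/-! ### Composition of substitutions -/

namespace Comm

/-- Substitution of communicable patterns for the names. -/
def subst (f : ℕ → Comm) : Comm → Comm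
  | name x => f x
  | comp M N => comp (M.subst f) (N.subst f)

theorem mem_fn_ren (f : ℕ → ℕ) (M : Comm) (y : ℕ) : y ∈ (M.ren f).fn ↔ ∃ z ∈ M.fn, f z = y := by
  induction M with
  | name x => simp [ren, fn, eq_comm]
  | comp M N hM hN => simp [ren, fn, hM, hN, or_and_right, exists_or]

theorem ren_subst (f : ℕ → ℕ) (g : ℕ → Comm) (M : Comm) :
    (M.ren f).subst g = M.subst (fun i => g (f i)) := by
  induction M <;> simp_all [ren, subst]

theorem subst_ren (f : ℕ → Comm) (g : ℕ → ℕ) (M : Comm) :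
    (M.subst f).ren g = M.subst (fun i => (f i).ren g) := by
  induction M <;> simp_all [ren, subst]

theorem toPat_subst {β : Type} (f : ℕ → Comm) (M : Comm) :
    (M.toPat : PatternOf β).subst f = (M.subst f).toPat := by
  induction M <;> simp_all [toPat, subst, PatternOf.subst]

theorem protect_subst {β : Type} (f : ℕ → Comm) (M : Comm) :
    (M.protect : PatternOf β).subst f = (M.subst f).protect := by
  induction M <;> simp_all [protect, subst, PatternOf.subst]

end Comm

theorem PatternOf.subst_subst {β : Type} (f g : ℕ → Comm) (p : PatternOf β) :
    (p.subst f).subst g = p.subst (fun i => (f i).subst g) := by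
  induction p <;> simp_all [subst, Comm.toPat_subst, Comm.protect_subst]

theorem upSubst_subst (k : ℕ) (f g : ℕ → Comm) (i : ℕ) :
    (upSubst k f i).subst (upSubst k g) = upSubst k (fun j => (f j).subst g) i := by
  unfold upSubst
  by_cases h : i < k
  · simp [h, Comm.subst]
  · simp [h, Comm.ren_subst, Comm.subst_ren]

theorem PatternOf.arity_subst {β : Type} (f : ℕ → Comm) (p : PatternOf β) :
    (p.subst f).arity = p.arity := by
  simp [arity, bnList_subst]

theorem Proc.subst_subst (P : Proc) : ∀ f g : ℕ → Comm,
    (P.subst f).subst g = P.subst (fun i => (f i).subst g) := by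
  induction P <;> intro f g <;>
    simp_all [subst, upSubst_subst, PatternOf.subst_subst, PatternOf.arity_subst]

/-! ### Early transitions -/

/-- Transitions in which the binding names of the label are instantiated at once. -/
def EStep (P : Proc) (ns : Finset ℕ) (π : PatternOf Comm) (P' : Proc) : Prop :=
  ∃ (p : Pattern) (σ : Subst) (P₀ : Proc), Step P (.out ns p) P₀ ∧ IsMatch p σ ∧
    (∀ x ∈ ns, x ∉ σ.fn) ∧ π = p.mapLam σ.act ∧ P' = σ.app P₀

theorem PatternOf.perm_eq_self (f : ℕ → ℕ) (p : Pattern) (h : ∀ x ∈ p.fn, f x = x)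
    (h' : ∀ x ∈ p.bn, f x = x) : p.perm f = p := by
  rw [perm, p.ren_congr f (fun i => i) h, ren_id, p.mapLam_congr f (fun i => i)]
  · clear h h'
    induction p <;> simp_all [mapLam]
  · intro b hb
    exact h' b ((mem_bn p b).2 hb)

theorem Finset.image_eq_self_of_forall {f : ℕ → ℕ} {s : Finset ℕ} (h : ∀ x ∈ s, f x = x) :
    s.image f = s := by
  rw [Finset.image_congr (g := id) (fun x hx => h x hx), Finset.image_id]

theorem Label.perm_eq_self (f : ℕ → ℕ) (μ : Label) (h : ∀ x ∈ μ.names, f x = x) :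
    μ.perm f = μ := by
  cases μ with
  | tau => rfl
  | out ns p =>
    rw [perm, PatternOf.perm_eq_self f p (fun x hx => h x (by simp [names, hx]))
      (fun x hx => h x (by simp [names, hx])),
      Finset.image_eq_self_of_forall (fun x hx => h x (by simp [names, hx]))]

namespace EStep

variable {P P' : Proc} {ns : Finset ℕ} {π : PatternOf Comm}

/-- The binding names of the label underlying an early transition can be chosen outside any
finite set of names. -/
theorem exists_fresh (h : EStep P ns π P') (s : Finset ℕ) :
    ∃ (p : Pattern) (σ : Subst) (P₀ : Proc), Step P (.out ns p) P₀ ∧ IsMatch p σ ∧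
      (∀ x ∈ ns, x ∉ σ.fn) ∧ π = p.mapLam σ.act ∧ P' = σ.app P₀ ∧ ∀ x ∈ p.bn, x ∉ s := by
  obtain ⟨p, σ, P₀, hs, hm, hf, rfl, rfl⟩ := h
  obtain ⟨f, hf1, hf2⟩ := exists_fresh_perm p.bn
    (s ∪ P.fn_finite.toFinset ∪ ns ∪ p.fn ∪ P₀.fn_finite.toFinset)
  simp only [Finset.mem_union, Set.Finite.mem_toFinset, not_or] at hf1 hf2
  have hP : P.ren f = P := Proc.ren_eq_self _ _ fun x hx =>
    hf2 x (by tauto) fun hb => hs.notMem_fn x (by simp [hb]) hx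
  have hns : ns.image f = ns := Finset.image_eq_self_of_forall fun x hx =>
    hf2 x (by tauto) (hs.disjoint x hx).2.2
  have hp : p.ren f = p := by
    rw [p.ren_congr f (fun i => i), PatternOf.ren_id]
    exact fun x hx => hf2 x (by tauto) fun hb => Finset.disjoint_left.1 hs.wf.2 hb hx
  have hs' := hs.perm f
  rw [hP, Label.perm, hns] at hs'
  -- Only the domain of the match is transported along `f`. In contrast to `Subst.conj`, its values
  -- are kept, so the instance `π` and the target do not change.
  have hact : ∀ x ∈ p.bn, Subst.act (fun x => σ (f.symm x)) (f x) = σ.act x := by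
    intro x hx
    have : x ∈ σ.dom := by rw [hm]; exact hx
    obtain ⟨M, hM⟩ := this
    simp [Subst.act, hM]
  refine ⟨p.perm f, fun x => σ (f.symm x), P₀.ren f, hs', ?_, ?_, ?_, ?_, ?_⟩
  · ext x
    have : f.symm x ∈ σ.dom ↔ f.symm x ∈ p.bn := by rw [hm]; simp
    rw [PatternOf.bn_perm, Finset.mem_coe, Finset.mem_image]
    refine this.trans ⟨fun h => ⟨_, h, by simp⟩, ?_⟩
    rintro ⟨y, hy, rfl⟩
    simpa using hy
  · rintro x hx ⟨y, M, hM, hy⟩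
    exact hf x hx ⟨_, M, hM, hy⟩
  · rw [PatternOf.perm, hp, PatternOf.mapLam_mapLam]
    exact p.mapLam_congr _ _ fun b hb => (hact b ((p.mem_bn b).2 hb)).symm
  · rw [Subst.app, Subst.app, Proc.subst_ren]
    refine Proc.subst_congr _ _ _ fun x hx => ?_
    by_cases hb : x ∈ p.bn
    · exact (hact x hb).symm
    · have hd : σ x = none := Subst.eq_none_of_notMem_dom (by rw [hm]; exact hb)
      have e := hf2 x (by tauto) hb
      have e' : f.symm x = x := by rw [Equiv.symm_apply_eq, e]
      simp [Subst.act, hd, e, e']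
  · intro x hx
    rw [PatternOf.bn_perm, Finset.mem_image] at hx
    obtain ⟨y, hy, rfl⟩ := hx
    have := hf1 y hy
    tauto

theorem perm (h : EStep P ns π P') (f : Equiv.Perm ℕ) :
    EStep (P.ren f) (ns.image f) (π.iren f) (P'.ren f) := by
  obtain ⟨p, σ, P₀, hs, hm, hf, rfl, rfl⟩ := h
  refine ⟨p.perm f, σ.conj f, P₀.ren f, hs.perm f, ?_, ?_, PatternOf.iren_mapLam f σ,
    Subst.app_ren f σ P₀⟩
  · ext x
    obtain ⟨x, rfl⟩ := f.surjective x
    rw [Subst.mem_dom_conj, hm, PatternOf.bn_perm]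
    simp
  · intro x hx
    obtain ⟨x, hx', rfl⟩ := Finset.mem_image.1 hx
    rw [Subst.mem_fn_iff]
    rintro ⟨z, hz, hxz⟩
    obtain ⟨z, rfl⟩ := f.surjective z
    rw [Subst.act_conj, Comm.mem_fn_ren] at hxz
    obtain ⟨w, hw, e⟩ := hxz
    rw [f.injective e] at hw
    exact hf x hx' (Subst.fn_act_subset ((Subst.mem_dom_conj f σ z).1 hz) hw)

theorem notMem_fn (h : EStep P ns π P') : ∀ x ∈ ns, x ∉ P.fn := by
  obtain ⟨p, σ, P₀, hs, hm, hf, rfl, rfl⟩ := h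
  exact fun x hx => hs.notMem_fn x (by simp [hx])

theorem fn_label (h : EStep P ns π P') : ∀ x ∈ π.fn, x ∈ P.fn ∨ x ∈ ns := by
  obtain ⟨p, σ, P₀, hs, hm, hf, rfl, rfl⟩ := h
  rw [PatternOf.fn_mapLam]
  exact hs.fn_label

theorem fn_target (h : EStep P ns π P') : ∀ x ∈ P'.fn, x ∈ P.fn ∨ x ∈ ns ∨ x ∈ π.tfn := by
  obtain ⟨p, σ, P₀, hs, hm, hf, rfl, rfl⟩ := h
  intro x hx
  rw [PatternOf.mem_tfn_mapLam hm]
  rcases Subst.mem_fn_app hx with ⟨h1, h2⟩ | h1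
  · have := hs.fn_target x h1
    rw [hm] at h2
    simp only [Label.bound, Finset.mem_union, Finset.mem_coe] at this h2
    tauto
  · exact Or.inr (Or.inr h1)

/-- The binders of the underlying label can be chosen fresh for `B`, so only the extruded names keep
a side condition, and the instantiation leaves `B` alone. -/
theorem parL {A A' B : Proc} (h : EStep A ns π A') (hB : ∀ x ∈ ns, x ∉ B.fn) :
    EStep (.par A B) ns π (.par A' B) := by
  obtain ⟨p, σ, P₀, hs, hm, hf, rfl, rfl, hb⟩ := h.exists_fresh B.fn_finite.toFinset
  simp only [Set.Finite.mem_toFinset] at hb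
  refine ⟨p, σ, .par P₀ B, .parextL _ _ _ _ _ ?_ hs, hm, hf, rfl, ?_⟩
  · intro x hx
    exact (Finset.mem_union.1 hx).elim (hB x) (hb x)
  · have : σ.app B = B := Subst.app_eq_self fun x hx hd => by rw [hm] at hd; exact hb x hd hx
    conv_lhs => rw [← this]
    rfl

theorem parR {A B B' : Proc} (h : EStep B ns π B') (hA : ∀ x ∈ ns, x ∉ A.fn) :
    EStep (.par A B) ns π (.par A B') := by
  obtain ⟨p, σ, P₀, hs, hm, hf, rfl, rfl, hb⟩ := h.exists_fresh A.fn_finite.toFinset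
  simp only [Set.Finite.mem_toFinset] at hb
  refine ⟨p, σ, .par A P₀, .parextR _ _ _ _ _ ?_ hs, hm, hf, rfl, ?_⟩
  · intro x hx
    exact (Finset.mem_union.1 hx).elim (hA x) (hb x)
  · have : σ.app A = A := Subst.app_eq_self fun x hx hd => by rw [hm] at hd; exact hb x hd hx
    conv_lhs => rw [← this]
    rfl

theorem par_inv {A B X : Proc} (h : EStep (.par A B) ns π X) :
    (∃ A', EStep A ns π A' ∧ (∀ x ∈ ns, x ∉ B.fn) ∧ X = .par A' B) ∨
    ∃ B', EStep B ns π B' ∧ (∀ x ∈ ns, x ∉ A.fn) ∧ X = .par A B' := by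
  obtain ⟨p, σ, P₀, hs, hm, hf, rfl, rfl⟩ := h
  have hid : ∀ T : Proc, (∀ x ∈ ns ∪ p.bn, x ∉ T.fn) → σ.app T = T := fun T hT =>
    Subst.app_eq_self fun x hx hd => hT x (Finset.mem_union_right _ (by rw [hm] at hd; exact hd)) hx
  cases hs with
  | parextL _ A' _ _ _ hd hs =>
    refine Or.inl ⟨_, ⟨p, σ, A', hs, hm, hf, rfl, rfl⟩,
      fun x hx => hd x (Finset.mem_union_left _ hx), ?_⟩
    conv_rhs => rw [← hid B hd]
    rfl
  | parextR _ _ B' _ _ hd hs =>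
    refine Or.inr ⟨_, ⟨p, σ, B', hs, hm, hf, rfl, rfl⟩,
      fun x hx => hd x (Finset.mem_union_left _ hx), ?_⟩
    conv_rhs => rw [← hid A hd]
    rfl

theorem rep_iff {X : Proc} : EStep (.rep P) ns π X ↔ EStep (.par (.rep P) P) ns π X := by
  constructor
  · rintro ⟨p, σ, P₀, hs, h⟩
    cases hs with
    | rep _ _ _ hs => exact ⟨p, σ, P₀, hs, h⟩
  · rintro ⟨p, σ, P₀, hs, h⟩
    exact ⟨p, σ, P₀, .rep _ _ _ hs, h⟩

theorem res {n : ℕ} (h : EStep P ns π P') (hn : n ∉ ns) (hf : n ∉ π.fn) (ht : n ∉ π.tfn) :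
    EStep (.res n P) ns π (.res n P') := by
  obtain ⟨p, σ, P₀, hs, hm, hσ, rfl, rfl, hb⟩ := h.exists_fresh {n}
  have hb : n ∉ p.bn := fun h => hb n h (by simp)
  rw [PatternOf.mem_tfn_mapLam hm] at ht
  rw [PatternOf.fn_mapLam] at hf
  refine ⟨p, σ, .res n P₀, .resnon _ _ _ _ ?_ hs, hm, hσ, rfl, ?_⟩
  · simp [Label.names, hn, hf, hb]
  · exact (Subst.app_res σ n P₀ (by rw [hm]; exact hb) ht).symm

theorem opn {m : ℕ} (h : EStep P ns π P') (hm : m ∉ ns) (hv : m ∈ π.vn) (hp : m ∉ π.pn)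
    (ht : m ∉ π.tfn) : EStep (.res m P) (insert m ns) π P' := by
  obtain ⟨p, σ, P₀, hs, hd, hσ, rfl, rfl, hb⟩ := h.exists_fresh {m}
  have hb : m ∉ p.bn := fun h => hb m h (by simp)
  rw [PatternOf.mem_tfn_mapLam hd] at ht
  rw [PatternOf.vn_mapLam] at hv
  rw [PatternOf.pn_mapLam] at hp
  refine ⟨p, σ, P₀, .opn _ _ _ _ _ hv (by simp [hm, hp, hb]) hs, hd, ?_, rfl, rfl⟩
  intro x hx
  rcases Finset.mem_insert.1 hx with rfl | hx
  exacts [ht, hσ x hx]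

end EStep

/-! ### Restriction -/

/-- Alpha-conversion as a transposition: it moves no free name of the restriction. A permutation,
unlike a substitution, can also be carried through transitions. -/
theorem Proc.res_swap (m n : ℕ) (A : Proc) (hn : n ∉ (res m A).fn) :
    res m A = res n (A.ren (Equiv.swap m n)) := by
  have h := (res m A).ren_eq_self (Equiv.swap m n) fun x hx => by
    have hm : x ≠ m := fun e => by rw [fn_res] at hx; exact hx.2 e
    have : x ≠ n := fun e => hn (e ▸ hx)
    exact Equiv.swap_apply_of_ne_of_ne hm this
  rw [← h, res_ren, Equiv.swap_apply_left]

theorem Proc.ren_swap_swap (m n : ℕ) (A : Proc) :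
    (A.ren (Equiv.swap m n)).ren (Equiv.swap m n) = A := by
  rw [ren_ren]
  simp [ren_id]

/-- Processes are taken up to alpha-conversion, so the last rule of a derivation may have used
another name `n` for the restriction. -/
theorem Step.res_inv {m : ℕ} {A X : Proc} {μ : Label} (h : Step (.res m A) μ X) :
    ∃ n B, Proc.res m A = .res n B ∧ ((∃ B', n ∉ μ.names ∧ Step B μ B' ∧ X = .res n B') ∨
      ∃ ns p, μ = .out (insert n ns) p ∧ n ∈ p.vn ∧ n ∉ ns ∪ p.pn ∪ p.bn ∧
        Step B (.out ns p) X) := by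
  generalize e : Proc.res m A = R at h
  cases h with
  | resnon n P P' _ hn h => exact ⟨n, P, rfl, Or.inl ⟨P', hn, h, rfl⟩⟩
  | opn n P P' ns p hm hm' h => exact ⟨n, P, rfl, Or.inr ⟨ns, p, rfl, hm, hm', h⟩⟩
  | _ => cases e

/-- The transposition of `m` and `n` turns `B` into `A` and fixes the label, which mentions neither
name. -/
theorem Step.resnon_inv {m n : ℕ} {A B B' : Proc} {μ : Label} (e : Proc.res m A = .res n B)
    (hn : n ∉ μ.names) (hm : m ∉ μ.names) (h : Step B μ B') :
    ∃ A', Step A μ A' ∧ Proc.res n B' = .res m A' := by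
  have hnf : n ∉ (Proc.res m A).fn := by rw [e, Proc.fn_res]; simp
  have hB : A.ren (Equiv.swap m n) = B := by
    rw [Proc.res_swap m n A hnf, Proc.res_inj] at e; exact e
  have hA : B.ren (Equiv.swap m n) = A := by rw [← hB, Proc.ren_swap_swap]
  have h' := h.perm (Equiv.swap m n)
  have hμ : μ.perm (Equiv.swap m n) = μ := Label.perm_eq_self _ _ fun x hx =>
    Equiv.swap_apply_of_ne_of_ne (fun e => hm (e ▸ hx)) (fun e => hn (e ▸ hx))
  rw [hA, hμ] at h'
  refine ⟨_, h', ?_⟩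
  rw [Equiv.swap_comm]
  apply Proc.res_swap
  intro hx
  -- The name `m` is neither free in the source nor bound by the label, so it is not free in the
  -- target, as the alpha-conversion back to `m` requires.
  have h1 := (Step.resnon n B B' μ hn h).fn_target m hx
  rw [← e, Proc.fn_res] at h1
  rcases h1 with h1 | h1
  · exact h1.2 rfl
  · apply hm
    cases μ with
    | tau => simp [Label.bound] at h1
    | out ns p => simp only [Label.bound, Label.names, Finset.mem_union] at h1 ⊢; tauto

theorem Step.res_tau_inv {m : ℕ} {A X : Proc} (h : Step (.res m A) .tau X) :
    ∃ A', Step A .tau A' ∧ X = .res m A' := by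
  obtain ⟨n, B, e, ⟨B', hn, hs, rfl⟩ | ⟨ns, p, e', _⟩⟩ := h.res_inv
  · exact Step.resnon_inv e hn (by simp [Label.names]) hs
  · cases e'

theorem Step.res_tau {A A' : Proc} (m : ℕ) (h : Step A .tau A') :
    Step (.res m A) .tau (.res m A') :=
  .resnon _ _ _ _ (by simp [Label.names]) h

/-- Since `m` avoids the label, the restriction either stays in place or is extruded under the
different name `n` occurring in the label. In the second case `A` must be renamed before it moves.
-/
theorem EStep.res_inv {m : ℕ} {A X : Proc} {ns : Finset ℕ} {π : PatternOf Comm}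
    (h : EStep (.res m A) ns π X) (hm : m ∉ ns) (hf : m ∉ π.fn) (ht : m ∉ π.tfn) :
    (∃ X', EStep A ns π X' ∧ X = .res m X') ∨
    ∃ n ns', n ∉ ns' ∧ n ≠ m ∧ ns = insert n ns' ∧ n ∈ π.vn ∧ n ∉ π.pn ∧ n ∉ π.tfn ∧
      n ∉ (Proc.res m A).fn ∧ EStep (A.ren (Equiv.swap m n)) ns' π X := by
  obtain ⟨p, σ, P₀, hs, hd, hσ, rfl, rfl, hb⟩ := h.exists_fresh {m}
  have hb : m ∉ p.bn := fun h => hb m h (by simp)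
  obtain ⟨n, B, e, ⟨B', hn, hs', rfl⟩ | ⟨ns', p', e', hv, hn, hs'⟩⟩ := hs.res_inv
  · left
    rw [PatternOf.fn_mapLam] at hf
    rw [PatternOf.mem_tfn_mapLam hd] at ht
    obtain ⟨A', hA', e'⟩ := Step.resnon_inv e hn (by simp [Label.names, hm, hf, hb]) hs'
    refine ⟨σ.app A', ⟨p, σ, A', hA', hd, hσ, rfl, rfl⟩, ?_⟩
    rw [e', Subst.app_res σ m A' (by rw [hd]; exact hb) ht]
  · right
    cases e'
    have hnf : n ∉ (Proc.res m A).fn := by rw [e, Proc.fn_res]; simp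
    have hB : A.ren (Equiv.swap m n) = B := by
      rw [Proc.res_swap m n A hnf, Proc.res_inj] at e; exact e
    simp only [Finset.mem_union, not_or] at hn
    refine ⟨n, ns', hn.1.1, ?_, rfl, ?_, ?_, ?_, hnf, ?_⟩
    · rintro rfl; simp at hm
    · rwa [PatternOf.vn_mapLam]
    · rw [PatternOf.pn_mapLam]; exact hn.1.2
    · rw [PatternOf.mem_tfn_mapLam hd]; exact hσ n (by simp)
    · rw [hB]
      exact ⟨p, σ, P₀, hs', hd, fun x hx => hσ x (by simp [hx]), rfl, rfl⟩

/-! ### Synchronisation -/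

/-- A synchronisation of two processes. -/
structure Sync (A B : Proc) (ms ns : Finset ℕ) (π θ : PatternOf Comm) (A' B' : Proc)
    (l : List ℕ) : Prop where
  left : EStep A ms π A'
  right : EStep B ns θ B'
  unify : UnifyN π θ
  left_fresh : ∀ x ∈ ms, x ∉ B.fn
  right_fresh : ∀ x ∈ ns, x ∉ A.fn
  disjoint : Disjoint ms ns
  nodup : l.Nodup
  toFinset : l.toFinset = ms ∪ ns

theorem Sync.step {A B : Proc} {ms ns : Finset ℕ} {π θ : PatternOf Comm} {A' B' : Proc}
    {l : List ℕ} (h : Sync A B ms ns π θ A' B' l) :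
    Step (.par A B) .tau (.resList l (.par A' B')) := by
  obtain ⟨⟨p, σ, A₀, hA, hp, -, rfl, rfl⟩, ⟨q, ρ, B₀, hB, hq, -, rfl, rfl⟩, hu, h1, h2, h3, h4, h5⟩ := h
  exact .unify _ _ _ _ _ _ _ _ _ _ _ (hu.unify hp hq) h1 h2 h3 h4 h5 hA hB

theorem Sync.symm {A B : Proc} {ms ns : Finset ℕ} {π θ : PatternOf Comm} {A' B' : Proc}
    {l : List ℕ} (h : Sync A B ms ns π θ A' B' l) : Sync B A ns ms θ π B' A' l :=
  ⟨h.right, h.left, h.unify.symm, h.right_fresh, h.left_fresh, h.disjoint.symm, h.nodup,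
    by rw [h.toFinset, Finset.union_comm]⟩

/-- Inversion of the silent transitions of a parallel composition.  The restricted names of a
synchronisation can be chosen outside any finite set of names. -/
theorem Step.par_tau_inv {A B X : Proc} (h : Step (.par A B) .tau X) (s : Finset ℕ) :
    (∃ A', Step A .tau A' ∧ X = .par A' B) ∨ (∃ B', Step B .tau B' ∧ X = .par A B') ∨
    ∃ ms ns π θ A' B' l, Sync A B ms ns π θ A' B' l ∧ (∀ x ∈ ms, x ∉ s) ∧ (∀ x ∈ ns, x ∉ s) ∧
      X = .resList l (.par A' B') := by
  have h0 := h
  cases h with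
  | parintL _ A' _ h => exact Or.inl ⟨A', h, rfl⟩
  | parintR _ _ B' h => exact Or.inr (Or.inl ⟨B', h, rfl⟩)
  | unify _ A₀ _ B₀ ms ns p q σ ρ l hu hm hn hd hl hl' hA hB =>
    refine Or.inr (Or.inr ?_)
    have hmA : ∀ x ∈ ms, x ∉ A.fn := fun x hx => hA.notMem_fn x (by simp [hx])
    have hnB : ∀ x ∈ ns, x ∉ B.fn := fun x hx => hB.notMem_fn x (by simp [hx])
    obtain ⟨f, hf1, hf2⟩ := exists_fresh_perm (ms ∪ ns)
      (s ∪ A.fn_finite.toFinset ∪ B.fn_finite.toFinset)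
    simp only [Finset.mem_union, Set.Finite.mem_toFinset, not_or] at hf1 hf2
    have hfA : ∀ x ∈ A.fn, f x = x := fun x hx =>
      hf2 x (by tauto) ⟨fun h => hmA x h hx, fun h => hn x h hx⟩
    have hfB : ∀ x ∈ B.fn, f x = x := fun x hx =>
      hf2 x (by tauto) ⟨fun h => hm x h hx, fun h => hnB x h hx⟩
    -- The values of `σ` come from the free names of `q`, which are free in `B` or lie in `ns`; both
    -- are disjoint from `ms`, so the freshness condition of an early transition holds.
    have eA : EStep A ms (p.mapLam σ.act) (σ.app A₀) := by
      refine ⟨p, σ, A₀, hA, hu.isMatch, fun x hx hx' => ?_, rfl, rfl⟩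
      rcases hB.fn_label x (hu.fn_subset hx') with h | h
      exacts [hm x hx h, Finset.disjoint_left.1 hd hx h]
    have eB : EStep B ns (q.mapLam ρ.act) (ρ.app B₀) := by
      refine ⟨q, ρ, B₀, hB, hu.symm.isMatch, fun x hx hx' => ?_, rfl, rfl⟩
      rcases hA.fn_label x (hu.symm.fn_subset hx') with h | h
      exacts [hn x hx h, Finset.disjoint_left.1 hd h hx]
    have eA' := eA.perm f
    have eB' := eB.perm f
    rw [A.ren_eq_self f hfA] at eA'
    rw [B.ren_eq_self f hfB] at eB'
    refine ⟨_, _, _, _, _, _, l.map f, ⟨eA', eB',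
      (hu.unifyN hA.wf.1 hB.wf.1).iren f, ?_, ?_, ?_, hl.map f.injective, ?_⟩, ?_, ?_, ?_⟩
    · intro x hx
      obtain ⟨y, hy, rfl⟩ := Finset.mem_image.1 hx
      have := hf1 y (Or.inl hy); tauto
    · intro x hx
      obtain ⟨y, hy, rfl⟩ := Finset.mem_image.1 hx
      have := hf1 y (Or.inr hy); tauto
    · exact (Finset.disjoint_image f.injective).2 hd
    · rw [← Finset.image_union, ← hl']; ext; simp
    · intro x hx
      obtain ⟨y, hy, rfl⟩ := Finset.mem_image.1 hx
      have := hf1 y (Or.inl hy); tauto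
    · intro x hx
      obtain ⟨y, hy, rfl⟩ := Finset.mem_image.1 hx
      have := hf1 y (Or.inr hy); tauto
    -- The renamed names are restricted in the target, so `f` fixes every free name of the target
    -- and hence the target itself.
    · rw [← Proc.ren, ← Proc.resList_ren]
      refine (Proc.ren_eq_self _ _ fun x hx => ?_).symm
      rcases h0.fn_target x hx with (h | h) | h
      · exact hfA x h
      · exact hfB x h
      · simp [Label.bound] at h

/-! ### Cases -/

/-- The substitution that replaces the lowest indices by the members of a list. -/
def instSubst (L : List Comm) : ℕ → Comm := fun i => L.getD i (.name (i - L.length))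

theorem instSubst_absRen (xs : List ℕ) (g : ℕ → Comm) (z : ℕ) :
    instSubst (xs.map g) (absRen xs z) = if z ∈ xs then g z else .name z := by
  unfold instSubst absRen
  by_cases h : z ∈ xs
  · have := List.idxOf_lt_length_of_mem h
    simp [h, this]
  · simp [h]

theorem PatternOf.eq_mapLam {β γ : Type} {p : PatternOf β} {π : PatternOf γ} {g : β → γ}
    (he : π.erase = p.erase) (hg : p.bnList.map g = π.bnList) : π = p.mapLam g := by
  induction p generalizing π with
  | lam b =>
    cases π <;> simp_all [erase, bnList, mapLam]
  | var x => cases π <;> simp_all [erase, mapLam]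
  | pro x => cases π <;> simp_all [erase, mapLam]
  | comp p q hp hq =>
    cases π with
    | comp π₁ π₂ =>
      simp only [erase, comp.injEq] at he
      have hlen : (p.bnList.map g).length = π₁.bnList.length := by
        rw [List.length_map, ← p.bnList_erase_length, ← he.1, bnList_erase_length]
      simp only [bnList, List.map_append] at hg
      obtain ⟨h1, h2⟩ := List.append_inj hg hlen
      rw [hp he.1 h1, hq he.2 h2, mapLam]
    | _ => cases he

/-- The residual of a case depends on its match only through the list of received values, so it can
be described on nameless terms. -/
theorem Subst.app_eq_instSubst {p : Pattern} {σ : Subst} (h : IsMatch p σ) (P : Proc) :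
    σ.app P = (P.ren (absRen p.bnList)).subst (instSubst (p.mapLam σ.act).bnList) := by
  rw [PatternOf.bnList_mapLam, Proc.subst_ren, Subst.app]
  congr 1
  funext z
  rw [instSubst_absRen]
  split_ifs with hz
  · rfl
  · refine Subst.act_of_notMem_dom ?_
    rw [h]; simpa [PatternOf.bn] using hz

/-- The early transitions of a case. -/
theorem EStep.caseB_iff {p₀ : PatternOf Unit} {P₀ X : Proc} {ns : Finset ℕ} {π : PatternOf Comm} :
    EStep (.caseB p₀ P₀) ns π X ↔
      ns = ∅ ∧ π.erase = p₀ ∧ X = P₀.subst (instSubst π.bnList) := by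
  constructor
  · rintro ⟨p, σ, P₁, hs, hm, -, rfl, rfl⟩
    generalize e : Proc.caseB p₀ P₀ = R at hs
    cases hs with
    | caseOf p P hp =>
      simp only [Proc.caseOf, Proc.caseB.injEq] at e
      rw [e.1, e.2, PatternOf.erase_mapLam]
      exact ⟨rfl, rfl, Subst.app_eq_instSubst hm _⟩
    | _ => cases e
  · rintro ⟨rfl, rfl, rfl⟩
    obtain ⟨p, P₁, hp, -, e⟩ := Proc.exists_caseOf π.erase P₀ ∅
    rw [e]
    simp only [Proc.caseOf, Proc.caseB.injEq] at e
    -- The default is never used on `bn(p)`, since the two lists have equal length.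
    let g : ℕ → Comm := fun x => π.bnList.getD (p.bnList.idxOf x) (.name 0)
    have hlen : p.bnList.length = π.bnList.length := by
      rw [← p.bnList_erase_length, ← e.1, π.bnList_erase_length]
    have hg : p.bnList.map g = π.bnList := by
      refine List.ext_getElem (by simp [hlen]) fun i h1 h2 => ?_
      have : i < p.bnList.length := by simpa using h1
      simp [g, hp.1.idxOf_getElem i this, h2]
    have hm : IsMatch p (fun x => if x ∈ p.bn then some (g x) else none) := by
      ext x
      by_cases hx : x ∈ p.bn <;> simp [Subst.dom, hx]
    have hπ : π = p.mapLam (Subst.act fun x => if x ∈ p.bn then some (g x) else none) := by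
      rw [← PatternOf.mapLam_congr p g]
      · exact PatternOf.eq_mapLam e.1 hg
      · intro b hb
        simp [Subst.act, (p.mem_bn b).2 hb]
    refine ⟨p, _, P₁, .caseOf p P₁ hp, hm, by simp, hπ, ?_⟩
    rw [Subst.app_eq_instSubst hm, ← hπ, e.2]

/-! ### Simulations for early transitions -/

/-- The moves of `P` are simulated by moves of `Q`, with targets related by `R`. -/
structure Sim (R : Proc → Proc → Prop) (P Q : Proc) : Prop where
  tau : ∀ P', Step P .tau P' → ∃ Q', Step Q .tau Q' ∧ R P' Q'
  out : ∀ ns π P', EStep P ns π P' → (∀ x ∈ ns, x ∉ Q.fn) →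
    ∃ θ Q', CompatN π θ ∧ EStep Q ns θ Q' ∧ R P' Q'

/-- A bisimulation answers only labels whose binding names are not free in `Q`; in an early
transition they may be chosen so. By `CompatN.tfn` the answering match still avoids the extruded
names. -/
theorem IsBisimulation.sim {R : Proc → Proc → Prop} (hR : IsBisimulation R) {P Q : Proc}
    (h : R P Q) : Sim R P Q where
  tau P' hs := hR.tau P Q P' h hs
  out := by
    intro ns π P' hP hns
    obtain ⟨p, σ, P₀, hs, hm, hf, rfl, rfl, hb⟩ := hP.exists_fresh Q.fn_finite.toFinset
    simp only [Set.Finite.mem_toFinset] at hb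
    obtain ⟨q, ρ, Q', hq, hc, hQ, hr⟩ := hR.out P Q P₀ ns p h hs
      (fun x hx => (Finset.mem_union.1 hx).elim (hb x) (hns x)) σ hm hf
    have hc' := hc.compatN hs.wf.1 hQ.wf.1
    refine ⟨_, _, hc', ⟨q, ρ, Q', hQ, hq, fun x hx hx' => hf x hx ?_, rfl, rfl⟩, hr⟩
    rw [← PatternOf.mem_tfn_mapLam hm]
    exact hc'.tfn ((PatternOf.mem_tfn_mapLam hq x).2 hx')

theorem isBisimulation_of_sim {R : Proc → Proc → Prop} (hs : ∀ P Q, R P Q → R Q P)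
    (hR : ∀ P Q, R P Q → Sim R P Q) : IsBisimulation R where
  symm := hs
  tau P Q P' h hP := (hR P Q h).tau P' hP
  out := by
    intro P Q P' ns p h hP hns σ hσ hf
    obtain ⟨θ, Q', hc, ⟨q, ρ, Q₀, hQ, hq, -, rfl, rfl⟩, hr⟩ :=
      (hR P Q h).out ns _ _ ⟨p, σ, P', hP, hσ, hf, rfl, rfl⟩
        (fun x hx => hns x (Finset.mem_union_right _ hx))
    exact ⟨q, ρ, Q₀, hq, hc.compat hσ hq, hQ, hr⟩

/-- Only finitely many names are free, so a total map may be cut down to a substitution with finite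
domain. Total maps are needed because substitutions are lifted below binders. -/
theorem Bisimilar.subst {P Q : Proc} (h : Bisimilar P Q) (f : ℕ → Comm) :
    Bisimilar (P.subst f) (Q.subst f) := by
  set X := P.fn_finite.toFinset ∪ Q.fn_finite.toFinset with hX
  let σ : Subst := fun x => if x ∈ X then some (f x) else none
  have hd : σ.dom.Finite := X.finite_toSet.subset fun x ⟨M, hM⟩ => by
    by_contra hx
    simp only [Finset.mem_coe] at hx
    simp [σ, hx] at hM
  have hσ : ∀ x ∈ X, σ.act x = f x := fun x hx => by simp [Subst.act, σ, hx]
  have := closedUnderSubst_bisimilar P Q h σ hd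
  rwa [Subst.app, Subst.app, P.subst_congr _ f fun x hx => hσ x (by simp [X, hx]),
    Q.subst_congr _ f fun x hx => hσ x (by simp [X, hx])] at this

/-! ### The congruence generated by absorption and structural laws -/

/-- All substitution instances of `A` are simulated by those of `B`, up to bisimilarity of
the targets. -/
def Dominated (A B : Proc) : Prop := ∀ f : ℕ → Comm, Sim Bisimilar (A.subst f) (B.subst f)

/-- The exchange of the two lowest indices. -/
def swapRen : ℕ → ℕ := fun i => if i = 0 then 1 else if i = 1 then 0 else i

/-- The equivalence generated by bisimilarity, absorption of dominated components into a
replication, structural laws, and closure under parallel composition and restriction. -/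
inductive Cong : Proc → Proc → Prop
  | bisimilar {P Q : Proc} : Bisimilar P Q → Cong P Q
  | absorb {A B : Proc} : Dominated A B → Cong (.par A (.rep B)) (.rep B)
  | refl (P : Proc) : Cong P P
  | symm {P Q : Proc} : Cong P Q → Cong Q P
  | trans {P Q S : Proc} : Cong P Q → Cong Q S → Cong P S
  | par {P Q : Proc} (T : Proc) : Cong P Q → Cong (.par P T) (.par Q T)
  | nu {P Q : Proc} : Cong P Q → Cong (.nuB P) (.nuB Q)
  | comm (P Q : Proc) : Cong (.par P Q) (.par Q P)
  | assoc (P Q S : Proc) : Cong (.par (.par P Q) S) (.par P (.par Q S))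
  | scope (P Q : Proc) : Cong (.par (.nuB P) Q) (.nuB (.par P (Q.ren Nat.succ)))
  | swap (P : Proc) : Cong (.nuB (.nuB P)) (.nuB (.nuB (P.ren swapRen)))

theorem scope_subst (Q : Proc) (f : ℕ → Comm) :
    (Q.ren Nat.succ).subst (upSubst 1 f) = (Q.subst f).ren Nat.succ := by
  rw [Proc.subst_ren, Proc.ren_subst]
  rfl

theorem swap_subst (P : Proc) (f : ℕ → Comm) :
    (P.ren swapRen).subst (upSubst 1 (upSubst 1 f)) =
      (P.subst (upSubst 1 (upSubst 1 f))).ren swapRen := by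
  rw [Proc.subst_ren, Proc.ren_subst]
  congr 1
  funext i
  match i with
  | 0 => rfl
  | 1 => rfl
  | i + 2 =>
    have h : swapRen (i + 2) = i + 2 := by simp [swapRen]
    have h2 : upSubst 1 (upSubst 1 f) (i + 2) = ((f i).ren (· + 1)).ren (· + 1) := by
      simp [upSubst]
    rw [h, h2, Comm.ren_ren, Comm.ren_ren]
    apply Comm.ren_congr
    intro x _
    simp [swapRen]

theorem Dominated.subst {A B : Proc} (h : Dominated A B) (f : ℕ → Comm) :
    Dominated (A.subst f) (B.subst f) := by
  intro g
  rw [Proc.subst_subst, Proc.subst_subst]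
  exact h _

namespace Cong

theorem subst {P Q : Proc} (h : Cong P Q) : ∀ f : ℕ → Comm, Cong (P.subst f) (Q.subst f) := by
  induction h with
  | bisimilar h => exact fun f => .bisimilar (h.subst f)
  | absorb h => exact fun f => .absorb (h.subst f)
  | refl P => exact fun f => .refl _
  | symm _ ih => exact fun f => (ih f).symm
  | trans _ _ ih₁ ih₂ => exact fun f => (ih₁ f).trans (ih₂ f)
  | par T _ ih => exact fun f => (ih f).par _
  | nu _ ih => exact fun f => (ih _).nu
  | comm P Q => exact fun f => .comm _ _
  | assoc P Q S => exact fun f => .assoc _ _ _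
  | scope P Q =>
    intro f
    simp only [Proc.subst, scope_subst]
    exact .scope _ _
  | swap P =>
    intro f
    simp only [Proc.subst, swap_subst]
    exact .swap _

theorem ren {P Q : Proc} (h : Cong P Q) (f : ℕ → ℕ) : Cong (P.ren f) (Q.ren f) := by
  rw [← Proc.subst_name, ← Proc.subst_name]
  exact h.subst _

theorem res {P Q : Proc} (x : ℕ) (h : Cong P Q) : Cong (.res x P) (.res x Q) := (h.ren _).nu

theorem resList {P Q : Proc} (l : List ℕ) (h : Cong P Q) : Cong (.resList l P) (.resList l Q) := by
  induction l with
  | nil => exact h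
  | cons x l ih => exact ih.res x

theorem parR {P Q : Proc} (T : Proc) (h : Cong P Q) : Cong (.par T P) (.par T Q) :=
  (comm _ _).trans ((h.par T).trans (comm _ _))

theorem res_scope {x : ℕ} {Q : Proc} (P : Proc) (h : x ∉ Q.fn) :
    Cong (.par (.res x P) Q) (.res x (.par P Q)) := by
  have e : Q.ren (absRen [x]) = Q.ren Nat.succ := Q.ren_congr _ _ fun z hz =>
    (absRen_eq_add [x] z z).2 ⟨rfl, by simpa using fun e : z = x => h (e ▸ hz)⟩
  rw [Proc.res, Proc.res, Proc.ren, e]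
  exact scope _ _

theorem resList_scope {l : List ℕ} {Q : Proc} (P : Proc) (h : ∀ x ∈ l, x ∉ Q.fn) :
    Cong (.par (.resList l P) Q) (.resList l (.par P Q)) := by
  induction l with
  | nil => exact .refl _
  | cons x l ih =>
    exact (res_scope _ (h x (by simp))).trans ((ih fun y hy => h y (by simp [hy])).res x)

end Cong

/-- The inner restriction owns index 0, hence the order `[y, x]`. -/
theorem Proc.res_res {x y : ℕ} (P : Proc) (h : x ≠ y) :
    res x (res y P) = nuB (nuB (P.ren (absRen [y, x]))) := by
  rw [res, res, ren, ren_ren]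
  congr 2
  apply ren_congr
  intro z _
  by_cases hy : z = y
  · subst hy; simp [absRen, upRen]
  · by_cases hx : z = x
    · subst hx; simp [absRen, upRen, hy, Ne.symm h]
    · simp [absRen, upRen, hy, hx]

theorem swapRen_absRen {x y : ℕ} (h : x ≠ y) (z : ℕ) :
    swapRen (absRen [y, x] z) = absRen [x, y] z := by
  by_cases hy : z = y
  · subst hy; simp [absRen, swapRen, h]
  · by_cases hx : z = x
    · subst hx; simp [absRen, swapRen, hy, Ne.symm h]
    · simp [absRen, swapRen, hy, hx]

namespace Cong

theorem res_swap (x y : ℕ) (P : Proc) : Cong (.res x (.res y P)) (.res y (.res x P)) := by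
  by_cases h : x = y
  · subst h; exact .refl _
  · have := swap (P.ren (absRen [y, x]))
    rw [Proc.ren_ren, ← Proc.res_res P h] at this
    simp only [swapRen_absRen h] at this
    rwa [← Proc.res_res P (Ne.symm h)] at this

theorem resList_perm {l l' : List ℕ} (P : Proc) (h : l.Perm l') :
    Cong (.resList l P) (.resList l' P) := by
  induction h with
  | nil => exact .refl _
  | cons x _ ih => exact ih.res x
  | swap x y l => exact res_swap _ _ _
  | trans _ _ ih₁ ih₂ => exact ih₁.trans ih₂

end Cong

/-! ### Simulation up to congruence -/

theorem CompatN.names {π θ : PatternOf Comm} (h : CompatN π θ) :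
    π.vn ⊆ θ.vn ∧ θ.pn ⊆ π.pn ∧ θ.fn ⊆ π.fn := by
  induction h with
  | lam π M h =>
    refine ⟨?_, Finset.empty_subset _, Finset.empty_subset _⟩
    have := h.fn.1
    intro x hx
    have : x ∈ π.fn := Finset.mem_union_left _ hx
    simp_all
  | comp π₁ π₂ θ₁ θ₂ _ _ h₁ h₂ =>
    refine ⟨Finset.union_subset_union h₁.1 h₂.1, Finset.union_subset_union h₁.2.1 h₂.2.1, ?_⟩
    intro x
    rw [PatternOf.mem_fn_comp, PatternOf.mem_fn_comp]
    exact Or.imp (fun h => h₁.2.2 h) fun h => h₂.2.2 h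
  | _ => simp [PatternOf.vn, PatternOf.pn, PatternOf.fn]

/-- In a proof of a simulation, the restricted names of the labels can be chosen outside any
finite set of names. -/
theorem Sim.of_fresh {R : Proc → Proc → Prop} {P Q : Proc} (s : Finset ℕ)
    (hR : ∀ (P Q : Proc) (f : ℕ → ℕ), R P Q → R (P.ren f) (Q.ren f))
    (tau : ∀ P', Step P .tau P' → ∃ Q', Step Q .tau Q' ∧ R P' Q')
    (out : ∀ ns π P', EStep P ns π P' → (∀ x ∈ ns, x ∉ Q.fn) → (∀ x ∈ ns, x ∉ s) →
      ∃ θ Q', CompatN π θ ∧ EStep Q ns θ Q' ∧ R P' Q') : Sim R P Q where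
  tau := tau
  out := by
    intro ns π P' hP hns
    obtain ⟨f, hf1, hf2⟩ := exists_fresh_perm ns (s ∪ P.fn_finite.toFinset ∪ Q.fn_finite.toFinset)
    simp only [Finset.mem_union, Set.Finite.mem_toFinset, not_or] at hf1 hf2
    have hP' := hP.perm f
    rw [P.ren_eq_self f fun x hx => hf2 x (by tauto) fun h => hP.notMem_fn x h hx] at hP'
    obtain ⟨θ, Q', hc, hQ, hr⟩ := out _ _ _ hP' (fun x hx => by
      obtain ⟨y, hy, rfl⟩ := Finset.mem_image.1 hx
      exact (hf1 y hy).1.2) fun x hx => by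
      obtain ⟨y, hy, rfl⟩ := Finset.mem_image.1 hx
      exact (hf1 y hy).1.1.1
    have hQ' := hQ.perm f.symm
    rw [Q.ren_eq_self f.symm fun x hx => by
      rw [Equiv.symm_apply_eq, hf2 x (by tauto) fun h => hns x h hx]] at hQ'
    have e : (ns.image f).image f.symm = ns := by
      rw [Finset.image_image]; simp
    rw [e] at hQ'
    refine ⟨_, _, ?_, hQ', ?_⟩
    · have := hc.iren f.symm
      rw [PatternOf.iren_iren] at this
      rwa [PatternOf.iren_eq_self _ π (by simp) (by simp)] at this
    · have := hR _ _ f.symm hr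
      rw [Proc.ren_ren] at this
      rwa [Proc.ren_eq_self P' _ (by simp)] at this

/-! ### Simulations for composition and the parallel laws -/

namespace Sim

theorem refl (P : Proc) : Sim Cong P P where
  tau P' h := ⟨P', h, .refl _⟩
  out _ π P' h _ := ⟨π, P', .refl π, h, .refl _⟩

/-- The first simulation needs the extruded names fresh for the intermediate process `Q`, about
which the goal says nothing; `of_fresh` supplies this. -/
theorem trans {P Q S : Proc} (h : Sim Cong P Q) (h' : Sim Cong Q S) : Sim Cong P S := by
  refine of_fresh Q.fn_finite.toFinset (fun _ _ f h => h.ren f) ?_ ?_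
  · intro P' hP
    obtain ⟨Q', hQ, h₁⟩ := h.tau P' hP
    obtain ⟨S', hS, h₂⟩ := h'.tau Q' hQ
    exact ⟨S', hS, h₁.trans h₂⟩
  · intro ns π P' hP hnS hnQ
    obtain ⟨θ, Q', hc, hQ, h₁⟩ := h.out ns π P' hP (by simpa using hnQ)
    obtain ⟨ξ, S', hc', hS, h₂⟩ := h'.out ns θ Q' hQ hnS
    exact ⟨ξ, S', hc.trans hc', hS, h₁.trans h₂⟩

/-- A synchronisation of `P` with `T` survives the replacement of `P` by `Q`, since the answering
label is compatible and so unifies with the same label of `T`. -/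
theorem par {P Q : Proc} (T : Proc) (h : Cong P Q) (hs : Sim Cong P Q) :
    Sim Cong (.par P T) (.par Q T) where
  tau := by
    intro X hX
    rcases hX.par_tau_inv Q.fn_finite.toFinset with ⟨P', hP, rfl⟩ | ⟨T', hT, rfl⟩ |
      ⟨ms, ns, π, θ, P', T', l, hy, hm, hn, rfl⟩
    · obtain ⟨Q', hQ, h'⟩ := hs.tau P' hP
      exact ⟨_, .parintL _ _ _ hQ, h'.par T⟩
    · exact ⟨_, .parintR _ _ _ hT, h.par T'⟩
    · simp only [Set.Finite.mem_toFinset] at hm hn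
      obtain ⟨ξ, Q', hc, hQ, h'⟩ := hs.out _ _ _ hy.left hm
      exact ⟨_, Sync.step ⟨hQ, hy.right, hc.unifyN hy.unify, hy.left_fresh, hn, hy.disjoint,
        hy.nodup, hy.toFinset⟩, (h'.par T').resList l⟩
  out := by
    intro ns π X hX hns
    rcases hX.par_inv with ⟨P', hP, hT, rfl⟩ | ⟨T', hT, hP, rfl⟩
    · obtain ⟨θ, Q', hc, hQ, h'⟩ := hs.out ns π P' hP fun x hx hx' => hns x hx (Or.inl hx')
      exact ⟨θ, _, hc, hQ.parL hT, h'.par T⟩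
    · exact ⟨π, _, .refl π, hT.parR fun x hx hx' => hns x hx (Or.inl hx'), h.par T'⟩

theorem comm (P Q : Proc) : Sim Cong (.par P Q) (.par Q P) where
  tau := by
    intro X hX
    rcases hX.par_tau_inv ∅ with ⟨P', hP, rfl⟩ | ⟨T', hT, rfl⟩ |
      ⟨ms, ns, π, θ, P', T', l, hy, hm, hn, rfl⟩
    · exact ⟨_, .parintR _ _ _ hP, .comm _ _⟩
    · exact ⟨_, .parintL _ _ _ hT, .comm _ _⟩
    · exact ⟨_, hy.symm.step, (Cong.comm _ _).resList l⟩
  out := by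
    intro ns π X hX _
    rcases hX.par_inv with ⟨P', hP, hT, rfl⟩ | ⟨T', hT, hP, rfl⟩
    · exact ⟨π, _, .refl π, hP.parR hT, .comm _ _⟩
    · exact ⟨π, _, .refl π, hT.parL hP, .comm _ _⟩

theorem assoc (P Q S : Proc) : Sim Cong (.par (.par P Q) S) (.par P (.par Q S)) where
  tau := by
    intro X hX
    rcases hX.par_tau_inv ∅ with ⟨Y, hY, rfl⟩ | ⟨S', hS, rfl⟩ |
      ⟨ms, ns, π, θ, Y, S', l, hy, hm, hn, rfl⟩
    · rcases hY.par_tau_inv S.fn_finite.toFinset with ⟨P', hP, rfl⟩ | ⟨Q', hQ, rfl⟩ |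
        ⟨ms, ns, π, θ, P', Q', l, hy, hm, hn, rfl⟩
      · exact ⟨_, .parintL _ _ _ hP, .assoc _ _ _⟩
      · exact ⟨_, .parintR _ _ _ (.parintL _ _ _ hQ), .assoc _ _ _⟩
      · simp only [Set.Finite.mem_toFinset] at hm hn
        refine ⟨_, Sync.step ⟨hy.left, hy.right.parL hn, hy.unify, ?_, hy.right_fresh,
          hy.disjoint, hy.nodup, hy.toFinset⟩,
          (Cong.resList_scope _ ?_).trans ((Cong.assoc _ _ _).resList l)⟩
        · rintro x hx (h | h)
          exacts [hy.left_fresh x hx h, hm x hx h]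
        · intro x hx
          have : x ∈ ms ∪ ns := hy.toFinset ▸ List.mem_toFinset.2 hx
          exact (Finset.mem_union.1 this).elim (hm x) (hn x)
    · exact ⟨_, .parintR _ _ _ (.parintR _ _ _ hS), .assoc _ _ _⟩
    · have hnP : ∀ x ∈ ns, x ∉ P.fn := fun x hx h => hy.right_fresh x hx (Or.inl h)
      have hnQ : ∀ x ∈ ns, x ∉ Q.fn := fun x hx h => hy.right_fresh x hx (Or.inr h)
      rcases hy.left.par_inv with ⟨P', hP, hmQ, rfl⟩ | ⟨Q', hQ, hmP, rfl⟩
      · refine ⟨_, Sync.step ⟨hP, hy.right.parR hnQ, hy.unify, ?_, hnP,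
          hy.disjoint, hy.nodup, hy.toFinset⟩, (Cong.assoc _ _ _).resList l⟩
        rintro x hx (h | h)
        exacts [hmQ x hx h, hy.left_fresh x hx h]
      · refine ⟨_, .parintR _ _ _ (Sync.step ⟨hQ, hy.right, hy.unify, hy.left_fresh, hnQ,
          hy.disjoint, hy.nodup, hy.toFinset⟩), ?_⟩
        -- Here `Q` and `S` synchronise without `P`; scope extension moves `P` below the new
        -- restrictions, whose names are not free in it.
        refine ((Cong.assoc _ _ _).resList l).trans (Cong.symm ?_)
        refine (Cong.comm _ _).trans ((Cong.resList_scope _ ?_).trans ((Cong.comm _ _).resList l))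
        intro x hx
        have : x ∈ ms ∪ ns := hy.toFinset ▸ List.mem_toFinset.2 hx
        exact (Finset.mem_union.1 this).elim (hmP x) (hnP x)
  out := by
    intro ns π X hX hns
    have hnS : ∀ x ∈ ns, x ∉ S.fn := fun x hx h => hns x hx (Or.inr (Or.inr h))
    rcases hX.par_inv with ⟨Y, hY, hT, rfl⟩ | ⟨S', hS, hPQ, rfl⟩
    · rcases hY.par_inv with ⟨P', hP, hQ, rfl⟩ | ⟨Q', hQ, hP, rfl⟩
      · exact ⟨π, _, .refl π, hP.parL fun x hx h => h.elim (hQ x hx) (hnS x hx), .assoc _ _ _⟩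
      · exact ⟨π, _, .refl π, (hQ.parL hnS).parR hP, .assoc _ _ _⟩
    · exact ⟨π, _, .refl π, (hS.parR fun x hx h => hPQ x hx (Or.inr h)).parR
        fun x hx h => hPQ x hx (Or.inl h), .assoc _ _ _⟩

theorem assoc' (P Q S : Proc) : Sim Cong (.par P (.par Q S)) (.par (.par P Q) S) :=
  (comm _ _).trans <| (assoc _ _ _).trans <| (comm _ _).trans <| (assoc _ _ _).trans (comm _ _)

end Sim

/-- The renaming that turns the lowest index into a given name. -/
def openRen (x : ℕ) : ℕ → ℕ := fun i => if i = 0 then x else i - 1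

theorem Proc.ren_openRen {x : ℕ} {P : Proc} (h : x + 1 ∉ P.fn) :
    (P.ren (openRen x)).ren (absRen [x]) = P := by
  rw [ren_ren]
  apply ren_eq_self
  intro i hi
  match i with
  | 0 => simp [absRen, openRen]
  | i + 1 =>
    have : i ≠ x := fun e => h (e ▸ hi)
    simp [absRen, openRen, this]

theorem Proc.nuB_eq_res {x : ℕ} {P : Proc} (h : x + 1 ∉ P.fn) :
    nuB P = res x (P.ren (openRen x)) := by
  rw [res, ren_openRen h]

theorem Finset.exists_forall_lt (s : Finset ℕ) : ∃ x, ∀ y ∈ s, y < x := by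
  obtain ⟨m, hm⟩ := s.bddAbove
  exact ⟨m + 1, fun y hy => Nat.lt_succ_of_le (hm hy)⟩

theorem Proc.ren_swap_eq_self {m n : ℕ} {Q : Proc} (hm : m ∉ Q.fn) (hn : n ∉ Q.fn) :
    Q.ren (Equiv.swap m n) = Q :=
  Q.ren_eq_self _ fun _ hx =>
    Equiv.swap_apply_of_ne_of_ne (fun e => hm (e ▸ hx)) (fun e => hn (e ▸ hx))

theorem Proc.mem_fn_res {x y : ℕ} {P : Proc} : y ∈ (res x P).fn ↔ y ∈ P.fn ∧ y ≠ x := by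
  rw [fn_res]; simp

namespace Sim

/-! ### Restriction -/

/-- All renamings are required because the bound index is replaced by a name depending on the move,
and by a second one when the label extrudes it. -/
theorem nu {P Q : Proc} (h : ∀ f : ℕ → ℕ, Sim Cong (P.ren f) (Q.ren f)) :
    Sim Cong (.nuB P) (.nuB Q) where
  tau := by
    intro X hX
    obtain ⟨x, hx⟩ := Finset.exists_forall_lt (P.fn_finite.toFinset ∪ Q.fn_finite.toFinset)
    simp only [Finset.mem_union, Set.Finite.mem_toFinset] at hx
    rw [Proc.nuB_eq_res (x := x) fun h => by have := hx _ (Or.inl h); omega] at hX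
    rw [Proc.nuB_eq_res (x := x) fun h => by have := hx _ (Or.inr h); omega]
    obtain ⟨P', hP, rfl⟩ := hX.res_tau_inv
    obtain ⟨Q', hQ, h'⟩ := (h _).tau _ hP
    exact ⟨_, hQ.res_tau x, h'.res x⟩
  out := by
    intro ns π X hX hns
    obtain ⟨x, hx⟩ := Finset.exists_forall_lt
      (P.fn_finite.toFinset ∪ Q.fn_finite.toFinset ∪ ns ∪ π.fn ∪ π.tfn)
    simp only [Finset.mem_union, Set.Finite.mem_toFinset] at hx
    have hxn : x ∉ ns := fun h => lt_irrefl _ (hx x (by tauto))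
    have hxf : x ∉ π.fn := fun h => lt_irrefl _ (hx x (by tauto))
    have hxt : x ∉ π.tfn := fun h => lt_irrefl _ (hx x (by tauto))
    rw [Proc.nuB_eq_res (x := x) fun h => by have := hx (x + 1) (by tauto); omega] at hX
    rw [Proc.nuB_eq_res (x := x) fun h => by have := hx (x + 1) (by tauto); omega] at hns ⊢
    rcases hX.res_inv hxn hxf hxt with ⟨P', hP, rfl⟩ |
      ⟨n, ns', hn, hnx, rfl, hv, hp, ht, hnf, hP⟩
    · obtain ⟨θ, Q', hc, hQ, h'⟩ := (h _).out ns π P' hP fun y hy hy' =>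
        hns y hy (Proc.mem_fn_res.2 ⟨hy', fun e => hxn (e ▸ hy)⟩)
      exact ⟨θ, _, hc, hQ.res hxn (fun h => hxf (hc.names.2.2 h)) (fun h => hxt (hc.tfn h)),
        h'.res x⟩
    · have hnQ := hns n (Finset.mem_insert_self _ _)
      -- The restriction on the side of `Q` is alpha-converted so that it opens under the same name
      -- `n`.
      rw [Proc.res_swap x n _ hnQ] at hns ⊢
      rw [Proc.ren_ren] at hP hns ⊢
      obtain ⟨θ, Q', hc, hQ, h'⟩ := (h _).out ns' π X hP fun y hy hy' =>
        hns y (Finset.mem_insert_of_mem hy) (Proc.mem_fn_res.2 ⟨hy', fun e => hn (e ▸ hy)⟩)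
      exact ⟨θ, Q', hc, hQ.opn hn (hc.names.1 hv) (fun h => hp (hc.names.2.1 h))
        (fun h => ht (hc.tfn h)), h'⟩

end Sim

/-! ### Scope extension -/

section Scope

variable {x : ℕ} {P Q X : Proc} {ns : Finset ℕ} {π : PatternOf Comm}

theorem Proc.resList_res (l : List ℕ) (x : ℕ) (P : Proc) :
    resList l (res x P) = resList (l ++ [x]) P := by simp [resList]

theorem Proc.res_par_swap {n : ℕ} (hx : x ∉ Q.fn) (hn : n ∉ Q.fn) (hn' : n ∉ (res x P).fn) :
    res x (.par P Q) = res n (.par (P.ren (Equiv.swap x n)) Q) := by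
  rw [res_swap x n, ren, ren_swap_eq_self hx hn]
  rw [mem_fn_res] at hn' ⊢
  rintro ⟨h | h, hne⟩
  exacts [hn' ⟨h, hne⟩, hn h]

theorem Step.scope_tau (hx : x ∉ Q.fn) (h : Step (.par (.res x P) Q) .tau X) :
    ∃ X', Step (.res x (.par P Q)) .tau X' ∧ Cong X X' := by
  rcases h.par_tau_inv {x} with ⟨P', hP, rfl⟩ | ⟨Q', hQ, rfl⟩ |
    ⟨ms, ns, π, θ, P', Q', l, hy, hm, hn, rfl⟩
  · obtain ⟨P', hP', rfl⟩ := hP.res_tau_inv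
    exact ⟨_, (Step.parintL _ _ _ hP').res_tau x, .res_scope _ hx⟩
  · refine ⟨_, (Step.parintR _ _ _ hQ).res_tau x, .res_scope _ fun h => ?_⟩
    have := hQ.fn_target x h
    simp [hx, Label.bound] at this
  · have hxm : x ∉ ms := fun h => hm x h (by simp)
    have hxn : x ∉ ns := fun h => hn x h (by simp)
    have hxπ : x ∉ π.fn := fun h => (hy.left.fn_label x h).elim
      (fun h => (Proc.mem_fn_res.1 h).2 rfl) hxm
    have hxθ : x ∉ θ.fn := fun h => (hy.right.fn_label x h).elim hx hxn
    have hxQ : x ∉ Q'.fn := fun h => by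
      rcases hy.right.fn_target x h with h | h | h
      exacts [hx h, hxn h, hxπ (hy.unify.symm.tfn_subset h)]
    rcases hy.left.res_inv hxm hxπ (fun h => hxθ (hy.unify.tfn_subset h)) with ⟨P', hP, rfl⟩ |
      ⟨n, ms', hn, hnx, rfl, hv, hp, ht, hnf, hP⟩
    · refine ⟨_, Step.res_tau x (Sync.step ⟨hP, hy.right, hy.unify, hy.left_fresh, ?_, hy.disjoint,
        hy.nodup, hy.toFinset⟩), ((Cong.res_scope _ hxQ).resList l).trans ?_⟩
      · exact fun y hy₁ hy₂ => hy.right_fresh y hy₁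
          (Proc.mem_fn_res.2 ⟨hy₂, fun e => hxn (e ▸ hy₁)⟩)
      · rw [Proc.resList_res]
        exact Cong.resList_perm _ (List.perm_append_singleton x l)
    · have hnQ : n ∉ Q.fn := hy.left_fresh n (by simp)
      have hnn : n ∉ ns := Finset.disjoint_left.1 hy.disjoint (by simp)
      rw [Proc.res_par_swap hx hnQ hnf]
      -- The name was extruded and restricted again by the synchronisation. With the restriction
      -- outside it need not be extruded, so `n` leaves `l`.
      refine ⟨_, Step.res_tau n (Sync.step (l := l.erase n) ⟨hP, hy.right, hy.unify,
        fun y h => hy.left_fresh y (by simp [h]), ?_,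
        Finset.disjoint_of_subset_left (Finset.subset_insert _ _) hy.disjoint,
        hy.nodup.erase n, ?_⟩), ?_⟩
      · intro y hy₁ hy₂
        apply hy.right_fresh y hy₁
        rw [Proc.res_swap x n _ hnf]
        exact Proc.mem_fn_res.2 ⟨hy₂, fun e => hnn (e ▸ hy₁)⟩
      · have hl : ∀ z, z ∈ l ↔ (z = n ∨ z ∈ ms') ∨ z ∈ ns := fun z => by
          rw [← List.mem_toFinset, hy.toFinset]; simp [or_assoc]
        ext z
        rw [List.mem_toFinset, hy.nodup.mem_erase_iff, hl, Finset.mem_union]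
        constructor
        · tauto
        · rintro (h | h)
          · exact ⟨fun e => hn (e ▸ h), by tauto⟩
          · exact ⟨fun e => hnn (e ▸ h), by tauto⟩
      · refine Cong.resList_perm _ (List.perm_cons_erase ?_)
        rw [← List.mem_toFinset, hy.toFinset]; simp

theorem EStep.scope (hx : x ∉ Q.fn) (h : EStep (.par (.res x P) Q) ns π X) (hn : x ∉ ns)
    (hf : x ∉ π.fn) (ht : x ∉ π.tfn) :
    ∃ X', EStep (.res x (.par P Q)) ns π X' ∧ Cong X X' := by
  rcases h.par_inv with ⟨P', hP, hQ, rfl⟩ | ⟨Q', hQ, hP, rfl⟩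
  · rcases hP.res_inv hn hf ht with ⟨P', hP', rfl⟩ | ⟨n, ns', hn', -, rfl, hv, hp, ht', hnf, hP'⟩
    · exact ⟨_, (hP'.parL hQ).res hn hf ht, .res_scope _ hx⟩
    · rw [Proc.res_par_swap hx (hQ n (by simp)) hnf]
      exact ⟨_, (hP'.parL fun y hy => hQ y (by simp [hy])).opn hn' hv hp ht', .refl _⟩
  · refine ⟨_, (hQ.parR fun y hy hy' => hP y hy
      (Proc.mem_fn_res.2 ⟨hy', fun e => hn (e ▸ hy)⟩)).res hn hf ht, .res_scope _ fun h => ?_⟩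
    rcases hQ.fn_target x h with h | h | h
    exacts [hx h, hn h, ht h]

theorem Step.unscope_tau (hx : x ∉ Q.fn) (h : Step (.res x (.par P Q)) .tau X) :
    ∃ X', Step (.par (.res x P) Q) .tau X' ∧ Cong X X' := by
  obtain ⟨Y, hY, rfl⟩ := h.res_tau_inv
  rcases hY.par_tau_inv {x} with ⟨P', hP, rfl⟩ | ⟨Q', hQ, rfl⟩ |
    ⟨ms, ns, π, θ, P', Q', l, hy, hm, hn, rfl⟩
  · exact ⟨_, Step.parintL _ _ _ (hP.res_tau x), (Cong.res_scope _ hx).symm⟩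
  · refine ⟨_, Step.parintR _ _ _ hQ, (Cong.res_scope _ fun h => ?_).symm⟩
    have := hQ.fn_target x h
    simp [hx, Label.bound] at this
  · have hxm : x ∉ ms := fun h => hm x h (by simp)
    have hxn : x ∉ ns := fun h => hn x h (by simp)
    have hxθ : x ∉ θ.fn := fun h => (hy.right.fn_label x h).elim hx hxn
    have hxt : x ∉ π.tfn := fun h => hxθ (hy.unify.tfn_subset h)
    have hnP : ∀ y ∈ ns, y ∉ (Proc.res x P).fn := fun y h h' =>
      hy.right_fresh y h (Proc.mem_fn_res.1 h').1
    -- If the synchronisation uses `x`, then `x` is a variable of the label because `Q` does not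
    -- know it; its scope must be opened and `x` joins the restricted names. Otherwise the
    -- restriction stays around `P`.
    by_cases hxπ : x ∈ π.fn
    · have hp : x ∉ π.pn := fun h => hxθ (hy.unify.pn_subset h)
      have hv : x ∈ π.vn := (Finset.mem_union.1 hxπ).resolve_right hp
      have hxl : x ∉ l := by rw [← List.mem_toFinset, hy.toFinset]; simp [hxm, hxn]
      refine ⟨_, Sync.step (l := x :: l) ⟨hy.left.opn hxm hv hp hxt, hy.right, hy.unify, ?_, hnP, ?_,
        List.nodup_cons.2 ⟨hxl, hy.nodup⟩, ?_⟩, .refl _⟩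
      · intro y h
        rcases Finset.mem_insert.1 h with rfl | h
        exacts [hx, hy.left_fresh y h]
      · exact Finset.disjoint_insert_left.2 ⟨hxn, hy.disjoint⟩
      · rw [List.toFinset_cons, hy.toFinset, Finset.insert_union]
    · refine ⟨_, Sync.step ⟨hy.left.res hxm hxπ hxt, hy.right, hy.unify, hy.left_fresh, hnP,
        hy.disjoint, hy.nodup, hy.toFinset⟩, Cong.symm
        (((Cong.res_scope _ fun h => ?_).resList l).trans ?_)⟩
      · rcases hy.right.fn_target x h with h | h | h
        exacts [hx h, hxn h, hxπ (hy.unify.symm.tfn_subset h)]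
      · rw [Proc.resList_res]
        exact Cong.resList_perm _ (List.perm_append_singleton x l)

theorem EStep.unscope (hx : x ∉ Q.fn) (h : EStep (.res x (.par P Q)) ns π X) (hn : x ∉ ns)
    (hf : x ∉ π.fn) (ht : x ∉ π.tfn) :
    ∃ X', EStep (.par (.res x P) Q) ns π X' ∧ Cong X X' := by
  have hnf := h.notMem_fn
  rcases h.res_inv hn hf ht with ⟨Y, hY, rfl⟩ | ⟨n, ns', hnn, hnx, rfl, hv, hp, ht', hn', hY⟩
  · rcases hY.par_inv with ⟨P', hP, hQ, rfl⟩ | ⟨Q', hQ, hP, rfl⟩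
    · exact ⟨_, (hP.res hn hf ht).parL hQ, (Cong.res_scope _ hx).symm⟩
    · refine ⟨_, hQ.parR fun y hy hy' => hP y hy (Proc.mem_fn_res.1 hy').1,
        (Cong.res_scope _ fun h => ?_).symm⟩
      rcases hQ.fn_target x h with h | h | h
      exacts [hx h, hn h, ht h]
  · have hnQ : n ∉ Q.fn := fun h => hn' (Proc.mem_fn_res.2 ⟨Or.inr h, hnx⟩)
    have hnP : n ∉ (Proc.res x P).fn := fun h => hn'
      (Proc.mem_fn_res.2 ⟨Or.inl (Proc.mem_fn_res.1 h).1, hnx⟩)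
    rw [Proc.ren, Proc.ren_swap_eq_self hx hnQ] at hY
    rcases hY.par_inv with ⟨P', hP, hQ, rfl⟩ | ⟨Q', hQ, hP, rfl⟩
    · refine ⟨_, EStep.parL ?_ ?_, .refl _⟩
      · rw [Proc.res_swap x n _ hnP]
        exact hP.opn hnn hv hp ht'
      · intro y hy
        rcases Finset.mem_insert.1 hy with rfl | hy
        exacts [hnQ, hQ y hy]
    -- The component `Q` cannot offer `n`, which is not free in it.
    · exact absurd (hQ.fn_label n (Finset.mem_union_left _ hv)) (by simp [hnQ, hnn])

end Scope

namespace Sim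

/-- Naming the binder by a fresh `x` undoes the shift of `Q`, so the nameless scope law becomes the
named one. -/
theorem scope_aux (P Q : Proc) (s : Finset ℕ) : ∃ x ∉ s, x ∉ Q.fn ∧ ∃ P₁ : Proc,
    Proc.nuB P = .res x P₁ ∧ Proc.nuB (.par P (Q.ren Nat.succ)) = .res x (.par P₁ Q) := by
  obtain ⟨x, hx⟩ := Finset.exists_forall_lt (s ∪ P.fn_finite.toFinset ∪ Q.fn_finite.toFinset)
  simp only [Finset.mem_union, Set.Finite.mem_toFinset] at hx
  have hP : x + 1 ∉ P.fn := fun h => by have := hx (x + 1) (by tauto); omega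
  have hQ : x ∉ Q.fn := fun h => by have := hx x (by tauto); omega
  refine ⟨x, fun h => by have := hx x (by tauto); omega, hQ, P.ren (openRen x),
    Proc.nuB_eq_res hP, ?_⟩
  rw [Proc.nuB_eq_res (x := x), Proc.ren, Proc.ren_ren, Proc.ren_eq_self Q]
  · intro i _; simp [openRen]
  · rintro (h | h)
    · exact hP h
    · obtain ⟨y, hy, e⟩ := (Proc.mem_fn_ren _ _ _).1 h
      exact hQ (Nat.succ_injective e ▸ hy)

theorem scope (P Q : Proc) : Sim Cong (.par (.nuB P) Q) (.nuB (.par P (Q.ren Nat.succ))) where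
  tau := by
    intro X hX
    obtain ⟨x, -, hx, P₁, e₁, e₂⟩ := scope_aux P Q ∅
    rw [e₁] at hX
    rw [e₂]
    exact hX.scope_tau hx
  out := by
    intro ns π X hX _
    obtain ⟨x, hs, hx, P₁, e₁, e₂⟩ := scope_aux P Q (ns ∪ π.fn ∪ π.tfn)
    simp only [Finset.mem_union, not_or] at hs
    rw [e₁] at hX
    rw [e₂]
    obtain ⟨X', hX', h⟩ := hX.scope hx hs.1.1 hs.1.2 hs.2
    exact ⟨π, X', .refl π, hX', h⟩

theorem unscope (P Q : Proc) : Sim Cong (.nuB (.par P (Q.ren Nat.succ))) (.par (.nuB P) Q) where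
  tau := by
    intro X hX
    obtain ⟨x, -, hx, P₁, e₁, e₂⟩ := scope_aux P Q ∅
    rw [e₂] at hX
    rw [e₁]
    exact hX.unscope_tau hx
  out := by
    intro ns π X hX _
    obtain ⟨x, hs, hx, P₁, e₁, e₂⟩ := scope_aux P Q (ns ∪ π.fn ∪ π.tfn)
    simp only [Finset.mem_union, not_or] at hs
    rw [e₂] at hX
    rw [e₁]
    obtain ⟨X', hX', h⟩ := hX.unscope hx hs.1.1 hs.1.2 hs.2
    exact ⟨π, X', .refl π, hX', h⟩

/-! ### Exchange of restrictions -/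

theorem swap_aux (P : Proc) (s : Finset ℕ) : ∃ x ∉ s, ∃ y ∉ s, x ≠ y ∧ ∃ P₁ : Proc,
    Proc.nuB (.nuB P) = .res x (.res y P₁) ∧
    Proc.nuB (.nuB (P.ren swapRen)) = .res y (.res x P₁) := by
  obtain ⟨x, hx⟩ := Finset.exists_forall_lt (s ∪ P.fn_finite.toFinset)
  simp only [Finset.mem_union, Set.Finite.mem_toFinset] at hx
  have hne : x ≠ x + 1 := by omega
  obtain ⟨P₁, hP₁⟩ := exists_unabs P [x + 1, x] (by simp) (by
    intro z hz i hi e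
    have := hx i (Or.inr hi)
    simp only [List.mem_cons, List.not_mem_nil, or_false] at hz
    rcases hz with rfl | rfl <;> simp at e <;> omega)
  refine ⟨x, fun h => by have := hx x (Or.inl h); omega, x + 1,
    fun h => by have := hx _ (Or.inl h); omega, hne, P₁, ?_, ?_⟩
  · rw [Proc.res_res _ hne, ← hP₁]
  · rw [Proc.res_res _ hne.symm, hP₁, Proc.ren_ren]
    simp only [swapRen_absRen hne]

/-- Each of the two names is kept or extruded, which gives four cases. An extruded name is first
alpha-converted to its name in the label; then the two rules are applied in the other order. -/
theorem swap (P : Proc) : Sim Cong (.nuB (.nuB P)) (.nuB (.nuB (P.ren swapRen))) where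
  tau := by
    intro X hX
    obtain ⟨x, -, y, -, -, P₁, e₁, e₂⟩ := swap_aux P ∅
    rw [e₁] at hX
    rw [e₂]
    obtain ⟨Y, hY, rfl⟩ := hX.res_tau_inv
    obtain ⟨Z, hZ, rfl⟩ := hY.res_tau_inv
    exact ⟨_, (hZ.res_tau x).res_tau y, .res_swap _ _ _⟩
  out := by
    intro ns π X hX _
    obtain ⟨x, hx, y, hy, hne, P₁, e₁, e₂⟩ := swap_aux P (ns ∪ π.fn ∪ π.tfn)
    simp only [Finset.mem_union, not_or] at hx hy
    rw [e₁] at hX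
    rw [e₂]
    obtain ⟨⟨hx₁, hx₂⟩, hx₃⟩ := hx
    obtain ⟨⟨hy₁, hy₂⟩, hy₃⟩ := hy
    suffices h : ∃ X', EStep (.res y (.res x P₁)) ns π X' ∧ Cong X X' by
      obtain ⟨X', hX', h⟩ := h
      exact ⟨π, X', .refl π, hX', h⟩
    have hren : ∀ n, n ≠ y → (Proc.res y P₁).ren (Equiv.swap x n) =
        .res y (P₁.ren (Equiv.swap x n)) := fun n hn => by
      rw [Proc.res_ren, Equiv.swap_apply_of_ne_of_ne hne.symm hn.symm]
    have hren' : ∀ n, n ≠ x → (Proc.res x P₁).ren (Equiv.swap y n) =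
        .res x (P₁.ren (Equiv.swap y n)) := fun n hn => by
      rw [Proc.res_ren, Equiv.swap_apply_of_ne_of_ne hne hn.symm]
    rcases hX.res_inv hx₁ hx₂ hx₃ with ⟨Y, hY, rfl⟩ | ⟨n, ns', hn, hnx, rfl, hv, hp, ht, hnf, hY⟩
    · rcases hY.res_inv hy₁ hy₂ hy₃ with ⟨Z, hZ, rfl⟩ | ⟨n, ns', hn, hny, rfl, hv, hp, ht, hnf, hZ⟩
      · exact ⟨_, (hZ.res hx₁ hx₂ hx₃).res hy₁ hy₂ hy₃, .res_swap _ _ _⟩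
      · have hnx : n ≠ x := fun e => hx₁ (by simp [e])
        have hn' : n ∉ (Proc.res y (.res x P₁)).fn := by
          rw [Proc.mem_fn_res] at hnf
          simp only [Proc.mem_fn_res]
          tauto
        rw [Proc.res_swap y n _ hn', hren' n hnx]
        refine ⟨_, EStep.opn (EStep.res hZ ?_ hx₂ hx₃) hn hv hp ht, .refl _⟩
        exact fun h => hx₁ (by simp [h])
    · have hny : n ≠ y := fun e => hy₁ (by simp [e])
      have hnx' : n ∉ (Proc.res x P₁).fn := by
        simp only [Proc.mem_fn_res] at hnf ⊢
        tauto
      have hy₁' : y ∉ ns' := fun h => hy₁ (by simp [h])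
      rw [hren n hny] at hY
      rw [Proc.res_swap x n _ hnx']
      rcases hY.res_inv hy₁' hy₂ hy₃ with ⟨Z, hZ, rfl⟩ |
        ⟨k, ns'', hk, hky, rfl, hkv, hkp, hkt, hkf, hZ⟩
      · exact ⟨_, (hZ.opn hn hv hp ht).res hy₁ hy₂ hy₃, .refl _⟩
      · have hkn : k ≠ n := fun e => hn (by simp [e])
        have hk' : k ∉ (Proc.res y (.res n (P₁.ren (Equiv.swap x n)))).fn := by
          simp only [Proc.mem_fn_res] at hkf ⊢
          tauto
        rw [Proc.res_swap y k _ hk', Proc.res_ren, Equiv.swap_apply_of_ne_of_ne hny hkn.symm,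
          Finset.insert_comm]
        refine ⟨_, EStep.opn (EStep.opn hZ ?_ hv hp ht) ?_ hkv hkp hkt, .refl _⟩
        · exact fun h => hn (by simp [h])
        · simp [hk, hkn]

end Sim

/-! ### Replication -/

/-- Every derivative of a replication contains the replication. -/
theorem Step.rep_target {B X : Proc} {μ : Label} (h : Step (.rep B) μ X) :
    ∃ X', Cong X (.par (.rep B) X') := by
  -- Replication unfolds to `!B | B`, so the induction has to cover both sources at once.
  have key : ∀ {R : Proc} {μ : Label} {X : Proc}, Step R μ X →
      (R = .rep B ∨ R = .par (.rep B) B) → ∃ X', Cong X (.par (.rep B) X') := by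
    intro R μ X h
    induction h with
    | unify P P' Q Q' ms ns p q σ ρ l hu hm hn hd hl hl' hP hQ ihP ihQ =>
      rintro (e | e) <;> cases e
      obtain ⟨X', hX'⟩ := ihP (Or.inl rfl)
      -- The binding names of the label are not free in `!B`, so the received values do not touch
      -- the retained copy.
      have hσ : σ.app (.rep B) = .rep B := Subst.app_eq_self fun x hx hd => by
        rw [hu.isMatch] at hd
        exact hP.notMem_fn x (Finset.mem_union_right _ hd) hx
      have hc : Cong (σ.app P') (.par (.rep B) (σ.app X')) := by
        rw [← hσ]; exact hX'.subst σ.act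
      have hl'' : ∀ x ∈ l, x ∉ (Proc.rep B).fn := by
        intro x hx
        have : x ∈ ms ∪ ns := hl' ▸ List.mem_toFinset.2 hx
        rcases Finset.mem_union.1 this with h | h
        exacts [hm x h, hn x h]
      refine ⟨.resList l (.par (σ.app X') (ρ.app Q')), ?_⟩
      refine (((hc.par _).trans (.assoc _ _ _)).resList l).trans ?_
      exact ((Cong.comm _ _).resList l).trans
        ((Cong.resList_scope _ hl'').symm.trans (.comm _ _))
    | parintL P P' Q _ ih =>
      rintro (e | e) <;> cases e
      obtain ⟨X', h⟩ := ih (Or.inl rfl)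
      exact ⟨_, (h.par _).trans (.assoc _ _ _)⟩
    | parextL P P' Q ns p hd _ ih =>
      rintro (e | e) <;> cases e
      obtain ⟨X', h⟩ := ih (Or.inl rfl)
      exact ⟨_, (h.par _).trans (.assoc _ _ _)⟩
    | parintR P Q Q' h ih =>
      rintro (e | e) <;> cases e
      exact ⟨Q', .refl _⟩
    | parextR P Q Q' ns p hd h ih =>
      rintro (e | e) <;> cases e
      exact ⟨Q', .refl _⟩
    | rep P P' μ h ih =>
      rintro (e | e) <;> cases e
      exact ih (Or.inr rfl)
    | _ => rintro (e | e) <;> cases e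
  exact key h (Or.inl rfl)

theorem EStep.rep_target {B X : Proc} {ns : Finset ℕ} {π : PatternOf Comm}
    (h : EStep (.rep B) ns π X) : ∃ X', Cong X (.par (.rep B) X') := by
  obtain ⟨p, σ, P₀, hs, hm, -, -, rfl⟩ := h
  obtain ⟨X', hX'⟩ := hs.rep_target
  have hσ : σ.app (.rep B) = .rep B := Subst.app_eq_self fun x hx hd => by
    rw [hm] at hd
    exact hs.notMem_fn x (Finset.mem_union_right _ hd) hx
  refine ⟨σ.app X', ?_⟩
  rw [← hσ]
  exact hX'.subst σ.act

/-- The copy of `!B` inside `X` swallows `A` in context. -/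
theorem Cong.absorb_target {A B X X' : Proc} (h : Dominated A B)
    (hX : Cong X (.par (.rep B) X')) : Cong (.par A X) X :=
  (hX.parR A).trans <| (Cong.assoc _ _ _).symm.trans <| ((Cong.absorb h).par X').trans hX.symm

theorem Dominated.sim {A B : Proc} (h : Dominated A B) : Sim Bisimilar A B := by
  have := h fun i => .name i
  rwa [Proc.subst_name A fun i => i, Proc.subst_name B fun i => i, Proc.ren_id, Proc.ren_id] at this

namespace Sim

theorem absorb {A B : Proc} (h : Dominated A B) : Sim Cong (.par A (.rep B)) (.rep B) where
  tau := by
    intro X hX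
    rcases hX.par_tau_inv ∅ with ⟨A', hA, rfl⟩ | ⟨Y, hY, rfl⟩ |
      ⟨ms, ns, π, θ, A', Y, l, hy, -, -, rfl⟩
    · obtain ⟨B', hB, h'⟩ := h.sim.tau A' hA
      exact ⟨_, .rep _ _ _ (.parintR _ _ _ hB), ((Cong.bisimilar h').par _).trans (.comm _ _)⟩
    · obtain ⟨X', hX'⟩ := hY.rep_target
      exact ⟨Y, hY, hX'.absorb_target h⟩
    · obtain ⟨ξ, B', hc, hB, h'⟩ := h.sim.out _ _ _ hy.left hy.left_fresh
      -- The unfolded copy of `B` plays the part of `A` and synchronises with the remaining `!B`.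
      have := Sync.step ⟨hy.right, hB, (hc.unifyN hy.unify).symm, hy.right.notMem_fn,
        hy.left_fresh, hy.disjoint.symm, hy.nodup, by rw [hy.toFinset, Finset.union_comm]⟩
      exact ⟨_, .rep _ _ _ this, (((Cong.bisimilar h').par _).trans (.comm _ _)).resList l⟩
  out := by
    intro ns π X hX hns
    rcases hX.par_inv with ⟨A', hA, hB, rfl⟩ | ⟨Y, hY, -, rfl⟩
    · obtain ⟨θ, B', hc, hB', h'⟩ := h.sim.out _ _ _ hA hB
      exact ⟨θ, _, hc, EStep.rep_iff.2 (hB'.parR hB),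
        ((Cong.bisimilar h').par _).trans (.comm _ _)⟩
    · obtain ⟨X', hX'⟩ := hY.rep_target
      exact ⟨π, Y, .refl π, hY, hX'.absorb_target h⟩

theorem unabsorb {A B : Proc} (h : Dominated A B) : Sim Cong (.rep B) (.par A (.rep B)) where
  tau := by
    intro X hX
    obtain ⟨X', hX'⟩ := hX.rep_target
    exact ⟨_, .parintR _ _ _ hX, (hX'.absorb_target h).symm⟩
  out := by
    intro ns π X hX hns
    obtain ⟨X', hX'⟩ := hX.rep_target
    exact ⟨π, _, .refl π, hX.parR fun x hx hx' => hns x hx (Or.inl hx'),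
      (hX'.absorb_target h).symm⟩

theorem of_bisimilar {P Q : Proc} (h : Bisimilar P Q) : Sim Cong P Q where
  tau P' hP :=
    let ⟨Q', hQ, h'⟩ := (isBisimulation_bisimilar.sim h).tau P' hP
    ⟨Q', hQ, .bisimilar h'⟩
  out ns π P' hP hns :=
    let ⟨θ, Q', hc, hQ, h'⟩ := (isBisimulation_bisimilar.sim h).out ns π P' hP hns
    ⟨θ, Q', hc, hQ, .bisimilar h'⟩

end Sim

/-! ### The congruence is a bisimulation -/

theorem swapRen_swapRen (i : ℕ) : swapRen (swapRen i) = i := by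
  match i with
  | 0 => rfl
  | 1 => rfl
  | i + 2 => simp [swapRen]

/-- Both directions are carried along because of the symmetry constructor, and all substitutions
because the restriction case needs its hypothesis for every renaming of the opened body. -/
theorem Cong.sim {P Q : Proc} (h : Cong P Q) :
    ∀ f : ℕ → Comm, Sim Cong (P.subst f) (Q.subst f) ∧ Sim Cong (Q.subst f) (P.subst f) := by
  induction h with
  | bisimilar h =>
    exact fun f => ⟨.of_bisimilar (h.subst f),
      .of_bisimilar (isBisimulation_bisimilar.symm _ _ (h.subst f))⟩
  | absorb h => exact fun f => ⟨.absorb (h.subst f), .unabsorb (h.subst f)⟩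
  | refl P => exact fun f => ⟨.refl _, .refl _⟩
  | symm _ ih => exact fun f => (ih f).symm
  | trans _ _ ih₁ ih₂ =>
    exact fun f => ⟨(ih₁ f).1.trans (ih₂ f).1, (ih₂ f).2.trans (ih₁ f).2⟩
  | par T h ih => exact fun f => ⟨.par _ (h.subst f) (ih f).1, .par _ (h.subst f).symm (ih f).2⟩
  | nu h ih =>
    intro f
    simp only [Proc.subst]
    constructor <;> refine .nu fun g => ?_ <;> rw [Proc.ren_subst, Proc.ren_subst]
    exacts [(ih _).1, (ih _).2]
  | comm P Q => exact fun f => ⟨.comm _ _, .comm _ _⟩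
  | assoc P Q S => exact fun f => ⟨.assoc _ _ _, .assoc' _ _ _⟩
  | scope P Q =>
    intro f
    simp only [Proc.subst, scope_subst]
    exact ⟨.scope _ _, .unscope _ _⟩
  | swap P =>
    intro f
    simp only [Proc.subst, swap_subst]
    refine ⟨.swap _, ?_⟩
    have := Sim.swap ((P.subst (upSubst 1 (upSubst 1 f))).ren swapRen)
    rwa [Proc.ren_ren _ swapRen swapRen, Proc.ren_eq_self _ _ fun i _ => swapRen_swapRen i] at this

theorem Cong.bisim {P Q : Proc} (h : Cong P Q) : Bisimilar P Q := by
  refine ⟨Cong, isBisimulation_of_sim (fun _ _ => .symm) fun P Q h => ?_,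
    fun P Q h σ _ => h.subst σ.act, h⟩
  have := (h.sim fun i => .name i).1
  rwa [Proc.subst_name P fun i => i, Proc.subst_name Q fun i => i, Proc.ren_id, Proc.ren_id] at this

/-! ### Cases with compatible patterns -/

theorem Comm.subst_name (M : Comm) : M.subst (fun i => .name i) = M := by
  induction M <;> simp_all [subst]

theorem PatternOf.subst_mapLam {β γ : Type} (g : β → γ) (f : ℕ → Comm) (p : PatternOf β) :
    (p.mapLam g).subst f = (p.subst f).mapLam g := by
  have h : ∀ M : Comm, (M.protect : PatternOf β).mapLam g = M.protect := by
    intro M; induction M <;> simp_all [Comm.protect, mapLam]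
  induction p <;> simp_all [mapLam, subst, Comm.mapLam_toPat]

/-- Free names and received values may be substituted independently. In the protected case `⌜n⌝`
against `n` becomes `⌜M⌝` against `M`, which is again compatible atom by atom. -/
theorem CompatN.subst {π θ : PatternOf Comm} (h : CompatN π θ) (f g : ℕ → Comm) :
    CompatN ((π.subst f).mapLam (Comm.subst g)) ((θ.subst f).mapLam (Comm.subst g)) := by
  have hv : ∀ (π : PatternOf Comm) (M : Comm), IsVal π M →
      IsVal ((π.subst f).mapLam (Comm.subst g)) (M.subst g) := by
    intro π
    induction π with
    | lam N => intro M h; exact congrArg _ h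
    | var x => intro M h; cases M <;> exact h.elim
    | pro x => intro M h; cases M <;> exact h.elim
    | comp p q hp hq =>
      intro M h
      cases M with
      | name x => exact h.elim
      | comp M N => exact ⟨hp _ h.1, hq _ h.2⟩
  induction h with
  | lam π M h => exact .lam _ _ (hv π M h)
  | var_var x => exact .refl _
  | pro_pro x => exact .refl _
  | pro_var x =>
    have : ∀ M : Comm, CompatN (M.protect.mapLam (Comm.subst g)) (M.toPat.mapLam (Comm.subst g)) := by
      intro M
      induction M with
      | name x => exact .pro_var x
      | comp M N hM hN => exact .comp _ _ _ _ hM hN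
    exact this (f x)
  | comp _ _ _ _ _ _ h₁ h₂ => exact .comp _ _ _ _ h₁ h₂

/-- Instantiation of the binding names of a case under a substitution. -/
theorem Proc.subst_instSubst (P : Proc) (xs : List ℕ) (g f : ℕ → Comm) :
    ((P.ren (absRen xs)).subst (upSubst xs.length f)).subst (instSubst (xs.map g)) =
      P.subst (fun z => if z ∈ xs then g z else f z) := by
  rw [subst_ren, subst_subst]
  congr 1
  funext z
  by_cases hz : z ∈ xs
  · have := List.idxOf_lt_length_of_mem hz
    have h := instSubst_absRen xs g z
    simp only [hz, if_true] at h ⊢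
    rw [← h]
    simp [upSubst, absRen, hz, this, Comm.subst]
  · have : absRen xs z = z + xs.length := (absRen_eq_add xs z z).2 ⟨rfl, hz⟩
    have h : ∀ i, instSubst (xs.map g) (i + xs.length) = .name i := by
      intro i; simp [instSubst]
    simp [this, upSubst, hz, Comm.ren_subst, h, Comm.subst_name]

/-- The hypotheses concern the identity match only; all other matches, and all substitution
instances of the two cases, follow by substituting into them. -/
theorem dominated_caseOf {p q : Pattern} {P Q : Proc} (hp : p.WF) (hq : q.WF)
    (hf : ∀ x ∈ p.bn, x ∉ (Proc.caseOf q Q).fn) {ρ : Subst}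
    (hc : Compat p (Subst.idOn p.bn) q ρ) (hb : Bisimilar P (ρ.app Q)) :
    Dominated (.caseOf p P) (.caseOf q Q) := by
  intro f
  simp only [Proc.caseOf, Proc.subst]
  have htau : ∀ (p₀ : PatternOf Unit) (P₀ X : Proc), ¬ Step (.caseB p₀ P₀) .tau X := by
    intro p₀ P₀ X hX
    cases hX
  refine ⟨fun X hX => absurd hX (htau _ _ X), fun ns π X hX _ => ?_⟩
  obtain ⟨rfl, he, rfl⟩ := EStep.caseB_iff.1 hX
  let g : ℕ → Comm := fun x => π.bnList.getD (p.bnList.idxOf x) (.name 0)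
  have hlen : p.bnList.length = π.bnList.length := by
    rw [← π.bnList_erase_length, he, PatternOf.bnList_subst, p.bnList_erase_length]
  have hg : p.bnList.map g = π.bnList := by
    refine List.ext_getElem (by simp [hlen]) fun i h1 h2 => ?_
    have : i < p.bnList.length := by simpa using h1
    simp [g, hp.1.idxOf_getElem i this, h2]
  -- One substitution combines the received values on `bn(p)` with the ambient `f` on all other
  -- names.
  let h : ℕ → Comm := fun z => if z ∈ p.bnList then g z else f z
  have hmap : p.bnList.map h = π.bnList := by
    rw [← hg]; exact List.map_congr_left fun z hz => by simp [h, hz]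
  have hπ : π = ((p.mapLam (Subst.idOn p.bn).act).subst f).mapLam (Comm.subst h) := by
    rw [PatternOf.subst_mapLam, PatternOf.mapLam_mapLam, PatternOf.mapLam_congr _ _ h]
    · refine PatternOf.eq_mapLam ?_ ?_
      · rw [he, PatternOf.erase_subst]
      · rw [PatternOf.bnList_subst, hmap]
    · intro b _
      by_cases hb : b ∈ p.bn <;> simp [Subst.act, Subst.idOn, hb, Comm.subst]
  have hX : ((P.ren (absRen p.bnList)).subst (upSubst p.erase.arity f)).subst
      (instSubst π.bnList) = P.subst h := by
    rw [← hg, PatternOf.arity_erase]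
    exact P.subst_instSubst p.bnList g f
  have hθ : (((q.mapLam ρ.act).subst f).mapLam (Comm.subst h)).bnList =
      q.bnList.map fun b => (ρ.act b).subst h := by
    rw [PatternOf.bnList_mapLam, PatternOf.bnList_subst, PatternOf.bnList_mapLam, List.map_map]
    rfl
  refine ⟨((q.mapLam ρ.act).subst f).mapLam (Comm.subst h), _, ?_,
    EStep.caseB_iff.2 ⟨rfl, ?_, rfl⟩, ?_⟩
  · rw [hπ]
    exact (hc.compatN hp.1 hq.1).subst f h
  · rw [PatternOf.erase_mapLam, PatternOf.erase_subst, PatternOf.erase_mapLam]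
  · rw [hX, hθ, PatternOf.arity_erase]
    -- After `h` the left side is the residual of the move. The right side is the residual of the
    -- answer, provided the two substitutions agree on the free names of `Q`.
    have := hb.subst h
    rw [Subst.app, Proc.subst_subst] at this
    rw [PatternOf.arity, Proc.subst_instSubst]
    rwa [Q.subst_congr (fun i => (ρ.act i).subst h) _ ?_] at this
    intro z hz
    by_cases hzq : z ∈ q.bnList
    · simp [hzq]
    · have hzq' : z ∉ q.bn := fun h => hzq ((q.mem_bn z).1 h)
      have hd : z ∉ ρ.dom := by rw [hc.isMatch.2]; exact hzq'
      -- A free name of `Q` not bound by `q` is free in the case, hence not in `bn(p)` by the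
      -- freshness hypothesis; there `h` agrees with `f`.
      have hzp : z ∉ p.bnList := fun h => hf z ((p.mem_bn z).2 h) (by
        rw [Proc.fn_caseOf]; exact Or.inr ⟨hz, hzq'⟩)
      simp [hzq, Subst.act_of_notMem_dom hd, Comm.subst, h, hzp]

end CPC

/-! ### The proposition and its two instances -/

theorem mainTheorem3 :
    (∀ (p q : Pattern) (P' Q' : Proc), p.WF → q.WF →
      (∀ x ∈ p.bn, x ∉ (Proc.rep (Proc.caseOf q Q')).fn) →
      (∃ ρ : Subst, Compat p (Subst.idOn p.bn) q ρ ∧ Bisimilar P' (ρ.app Q')) →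
      Bisimilar (Proc.par (Proc.caseOf p P') (Proc.rep (Proc.caseOf q Q')))
        (Proc.rep (Proc.caseOf q Q'))) ∧
    (∀ (n : ℕ) (P : Proc),
      Bisimilar (Proc.par (Proc.caseOf (.pro n) P) (Proc.rep (Proc.caseOf (.var n) P)))
        (Proc.rep (Proc.caseOf (.var n) P))) ∧
    (∀ (x y z : ℕ) (P Q : Proc), x ≠ y →
      x ∉ (Proc.caseOf (.lam z) Q).fn → y ∉ (Proc.caseOf (.lam z) Q).fn →
      Bisimilar P ((Subst.single z (.comp (.name x) (.name y))).app Q) →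
      Bisimilar
        (Proc.par (Proc.caseOf (.comp (.lam x) (.lam y)) P) (Proc.rep (Proc.caseOf (.lam z) Q)))
        (Proc.rep (Proc.caseOf (.lam z) Q))) := by
  have main : ∀ (p q : Pattern) (P' Q' : Proc), p.WF → q.WF →
      (∀ x ∈ p.bn, x ∉ (Proc.rep (Proc.caseOf q Q')).fn) →
      (∃ ρ : Subst, Compat p (Subst.idOn p.bn) q ρ ∧ Bisimilar P' (ρ.app Q')) →
      Bisimilar (Proc.par (Proc.caseOf p P') (Proc.rep (Proc.caseOf q Q')))
        (Proc.rep (Proc.caseOf q Q')) := by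
    rintro p q P' Q' hp hq hf ⟨ρ, hc, hb⟩
    exact (Cong.absorb (dominated_caseOf hp hq hf hc hb)).bisim
  refine ⟨main, fun n P => ?_, fun x y z P Q hxy hx hy hb => ?_⟩
  · refine main _ _ _ _ ?_ ?_ ?_ ⟨Subst.empty, ?_, ?_⟩
    · simp [PatternOf.WF, PatternOf.bnList, PatternOf.bn]
    · simp [PatternOf.WF, PatternOf.bnList, PatternOf.bn]
    · simp [PatternOf.bn, PatternOf.bnList]
    · exact .pro_var n
    · rw [Subst.app_eq_self fun x _ => by simp [Subst.dom_empty]]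
      exact (Cong.refl P).bisim
  · refine main _ _ _ _ ?_ ?_ ?_ ⟨_, ?_, hb⟩
    · simp [PatternOf.WF, PatternOf.bnList, PatternOf.bn, PatternOf.fn, PatternOf.vn,
        PatternOf.pn, hxy]
    · simp [PatternOf.WF, PatternOf.bnList, PatternOf.bn, PatternOf.fn, PatternOf.vn, PatternOf.pn]
    · intro w hw
      simp only [PatternOf.bn, PatternOf.bnList, List.mem_toFinset, List.mem_append,
        List.mem_singleton] at hw
      rcases hw with rfl | rfl
      exacts [hx, hy]
    · refine .lam _ _ _ _ ?_ ?_ ?_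
      · ext w
        by_cases hw : w ∈ (PatternOf.comp (.lam x) (.lam y) : Pattern).bn <;>
          simp [Subst.dom, Subst.idOn, hw]
      · simp [PatternOf.fn, PatternOf.vn, PatternOf.pn]
      · simp [PatternOf.hat, Subst.idOn, PatternOf.bn, PatternOf.bnList, Comm.toPat]
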